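/- Let $d\ge 1$ and let $\mathcal P$ be the set of Borel probability measures on $\mathbb R^d$ with the bounded-Lipschitz metric $$d_0(m,m')=\sup\Big\{\Big|\int\phi\,d(m'-m)\Big| : \|\phi\|_\infty\le 1,\ |\phi(x)-\phi(y)|\le|x-y|\Big\}.$$ Let $T>0$ and let $(B,A,\nu)$ be a Lévy triplet: $B\in\mathbb R^d$, $A$ a symmetric positive semi-definite $d\times d$ matrix, $\nu\ge 0$ a Borel measure on $\mathbb R^d$ with $\int(1\wedge|z|^2)\,\nu(dz)<\infty$. Put $$\mathcal L u(x)=B\cdot Du(x)+\operatorname{div}(A\,Du)(x)+\int_{\mathbb R^d}\big(u(x+z)-u(x)-Du(x)\cdot z\,\mathbf 1_{|z|<1}\big)\,\nu(dz),\qquad u\in C_b^2(\mathbb R^d),$$ and let $\mathcal L^*$ be its formal adjoint, i.e. the operator with triplet $(-B,A,\nu(-\,\cdot))$. The heat kernel of $\mathcal L$ is $K(t,\cdot)=\mathcal F^{-1}(e^{-t\Psi})$, where $\Psi(\xi)=-iB\cdot\xi+\xi\cdot A\xi+\int(1-e^{i\xi\cdot z}+i\xi\cdot z\,\mathbf 1_{|z|<1})\,\nu(dz)$;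 the heat kernel $K^*$ of $\mathcal L^*$ is defined in the same way. Assume (K): $K(t,\cdot)$ and $K^*(t,\cdot)$, $t>0$, are smooth densities of probability measures, and there is $\alpha\in(1,2]$ such that for each $\beta\in\mathbb N^d$ there is $\mathcal K_\beta>0$ with $\|D^\beta \tilde K(t,\cdot)\|_{L^1(\mathbb R^d)}\le \mathcal K_\beta\, t^{-|\beta|/\alpha}$ for $t\in(0,T]$ and $\tilde K=K,K^*$. Let $b\in (C_b((0,T),C_b^1(\mathbb R^d)))^d$, i.e. $b$ is bounded and continuous from $(0,T)$ to $C^1_b(\mathbb R^d)^d$ with its norm, let $\|b\|_\infty=\sup_{(0,T)\times\mathbb R^d}|b|$, and let $m_0\in\mathcal P$. A distributional solution of $$\partial_t m-\mathcal L^*m-\operatorname{div}(bm)=0\ \text{ in }(0,T)\times\mathbb R^d,\qquad m(0)=m_0,$$ is a curve $m\in C([0,T],\mathcal P)$ such that for all $\phi$ with $\phi,\partial_t\phi,D\phi,D^2\phi$ bounded and continuous on $[0,T]\times\mathbb R^d$ and all $t\in[0,T]$, $$\int\phi(t,x)\,m(t,dx)-\int\phi(0,x)\,m_0(dx)=\int_0^t\!\int\big(\partial_t\phi+\mathcal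 L\phi-D_x\phi\cdot b\big)(s,x)\,m(s,dx)\,ds.$$ Then: (a) There is a distributional solution $m\in C([0,T],\mathcal P)$. (b) There is $c_0>0$, independent of $m_0$ and $b$, such that $d_0(m(s),m(t))\le c_0(1+\|b\|_\infty)|s-t|^{1/2}$ for $s,t\in[0,T]$. (c) The family $\{m(t):t\in[0,T]\}$ is tight. Moreover, let $\psi\in C^2(\mathbb R^d)$ be non-negative and subadditive with $D\psi,D^2\psi$ bounded, $\psi(x)\to\infty$ as $|x|\to\infty$, $\int\psi\,dm_0<\infty$ and $\int_{|z|\ge1}\psi\,d\nu<\infty$. Then there is $c>0$, depending only on $d$ and $\psi$, such that for $t\in[0,T]$ $$\int\psi\,dm(t)\le\int\psi\,dm_0+\|D\psi\|_\infty\Big(2+cT\Big(\|A\|_2+\|B\|_\infty+\|b\|_\infty+\int_{|z|<1}|z|^2\,\nu(dz)\Big)\Big)+T\int_{|z|\ge1}\psi(z)\,\nu(dz),$$ where $\|A\|_2$ is the spectral norm, $\|B\|_\infty=\max_i|B_i|$, and the left-hand side is finite. (d) The distributional solution in $C([0,T],\mathcal P)$ is unique. (e) If $b_n\in(C_b((0,T),C_b^1(\mathbb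 R^d)))^d$ and $\|b_n-b\|_\infty\to0$, then the solutions $m_n$ corresponding to $b_n$ and the same $m_0$ converge to $m$ in $C([0,T],\mathcal P)$, i.e. $\sup_{t\in[0,T]}d_0(m_n(t),m(t))\to0$. -/

import Mathlib

open MeasureTheory Set Filter Topology
open scoped ContDiff

noncomputable section

namespace FokkerPlanck

/-- Euclidean space `ℝᵈ`. -/
abbrev Rd (d : ℕ) : Type := EuclideanSpace ℝ (Fin d)

/-! ### Lévy operators -/

/-- A Lévy triplet `(B, A, ν)`: a drift vector, a symmetric positive semi-definite matrix, and a
Borel measure with `∫ (1 ∧ |z|²) ν(dz) < ∞`. -/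
structure LevyTriplet (d : ℕ) where
  B : Rd d
  A : Matrix (Fin d) (Fin d) ℝ
  ν : Measure (Rd d)
  posSemidef : A.PosSemidef
  lintegral_lt_top : ∫⁻ z, ENNReal.ofReal (min 1 (‖z‖ ^ 2)) ∂ν < ⊤

namespace LevyTriplet

variable {d : ℕ}

/-- The Lévy operator
`𝓛 u(x) = B · Du(x) + div (A Du)(x) + ∫ (u(x+z) - u(x) - Du(x) · z 1_{|z|<1}) ν(dz)`,
to be used for `u ∈ C²_b(ℝᵈ)`; there `div (A Du) = ∑ᵢⱼ Aᵢⱼ ∂ᵢ∂ⱼ u`. -/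
def op (L : LevyTriplet d) (u : Rd d → ℝ) (x : Rd d) : ℝ :=
  fderiv ℝ u x L.B
    + ∑ i, ∑ j, L.A i j *
        iteratedFDeriv ℝ 2 u x ![EuclideanSpace.single i 1, EuclideanSpace.single j 1]
    + ∫ z, (u (x + z) - u x - (Metric.ball (0 : Rd d) 1).indicator (fun w => fderiv ℝ u x w) z) ∂L.ν

/-- The characteristic exponent
`Ψ(ξ) = -i B·ξ + ξ·Aξ + ∫ (1 - exp(i ξ·z) + i ξ·z 1_{|z|<1}) ν(dz)`, so that `𝓛` is the Fourier
multiplier with symbol `-Ψ`. -/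
def symbol (L : LevyTriplet d) (ξ : Rd d) : ℂ :=
  -Complex.I * ((inner ℝ L.B ξ : ℝ) : ℂ)
    + ((inner ℝ ξ (Matrix.toEuclideanCLM (𝕜 := ℝ) L.A ξ) : ℝ) : ℂ)
    + ∫ z, (1 - Complex.exp (Complex.I * ((inner ℝ ξ z : ℝ) : ℂ))
        + (Metric.ball (0 : Rd d) 1).indicator
            (fun w => Complex.I * ((inner ℝ ξ w : ℝ) : ℂ)) z) ∂L.ν

/-- The triplet `(-B, A, ν(-·))` of the formal adjoint `𝓛*`. -/
def adjoint (L : LevyTriplet d) : LevyTriplet d where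
  B := -L.B
  A := L.A
  ν := L.ν.map (fun z => -z)
  posSemidef := L.posSemidef
  lintegral_lt_top := by
    rw [lintegral_map (by fun_prop) measurable_neg]
    simpa using L.lintegral_lt_top

/-- `K(t, ·)`, `t > 0`, are smooth probability densities with
`∫ exp(-i x·ξ) K(t,x) dx = exp(-t Ψ(ξ))`, i.e. `K(t, ·) = 𝓕⁻¹ exp(-t Ψ)` is the heat kernel of `𝓛`
(uniquely determined by these conditions). -/
structure IsSmoothHeatKernel (L : LevyTriplet d) (K : ℝ → Rd d → ℝ) : Prop where
  smooth : ∀ t, 0 < t → ContDiff ℝ ∞ (K t)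
  nonneg : ∀ t, 0 < t → ∀ x, 0 ≤ K t x
  integrable : ∀ t, 0 < t → Integrable (K t)
  integral_eq_one : ∀ t, 0 < t → ∫ x, K t x = 1
  fourier : ∀ t, 0 < t → ∀ ξ : Rd d,
    ∫ x, Complex.exp (-Complex.I * ((inner ℝ x ξ : ℝ) : ℂ)) * ((K t x : ℝ) : ℂ)
      = Complex.exp (-(t : ℂ) * L.symbol ξ)

/-- Assumption (K) on the time interval `(0, T]`: `𝓛` and `𝓛*` have smooth heat kernels `K`, `K*`
and there is `α ∈ (1,2]` such that for every order `n` the derivatives of order `n` satisfy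
`‖Dⁿ K(t, ·)‖_{L¹}, ‖Dⁿ K*(t, ·)‖_{L¹} ≤ 𝒦ₙ t^{-n/α}` for `t ∈ (0, T]`. -/
def HeatKernelBounds (L : LevyTriplet d) (T : ℝ) : Prop :=
  ∃ K K' : ℝ → Rd d → ℝ, L.IsSmoothHeatKernel K ∧ L.adjoint.IsSmoothHeatKernel K' ∧
    ∃ α : ℝ, 1 < α ∧ α ≤ 2 ∧ ∀ n : ℕ, ∃ C : ℝ, 0 < C ∧ ∀ t ∈ Ioc 0 T,
      ∫⁻ x, ‖iteratedFDeriv ℝ n (K t) x‖ₑ ≤ ENNReal.ofReal (C * t ^ (-(n : ℝ) / α)) ∧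
      ∫⁻ x, ‖iteratedFDeriv ℝ n (K' t) x‖ₑ ≤ ENNReal.ofReal (C * t ^ (-(n : ℝ) / α))

end LevyTriplet

/-! ### The space of probability measures -/

variable {d : ℕ}

/-- The functions bounded by `1` and `1`-Lipschitz. -/
def Lip (d : ℕ) : Set (Rd d → ℝ) :=
  {φ | (∀ x, |φ x| ≤ 1) ∧ ∀ x y, |φ x - φ y| ≤ ‖x - y‖}

/-- The Kantorovich–Rubinstein (bounded-Lipschitz) distance. -/
def d₀ (m m' : ProbabilityMeasure (Rd d)) : ℝ :=
  sSup {r | ∃ φ ∈ Lip d, r = |∫ x, φ x ∂(m' : Measure (Rd d)) - ∫ x, φ x ∂(m : Measure (Rd d))|}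

/-- `m ∈ C([0,T], 𝓟)`, where `𝓟` carries the metric `d₀`; only the values of `m` on `[0,T]`
matter. -/
def IsContinuousCurve (T : ℝ) (m : ℝ → ProbabilityMeasure (Rd d)) : Prop :=
  ∀ t ∈ Icc 0 T, Tendsto (fun s => d₀ (m s) (m t)) (𝓝[Icc 0 T] t) (𝓝 0)

/-! ### Drifts, test functions, distributional solutions -/

/-- `b ∈ (C_b((0,T), C¹_b(ℝᵈ)))ᵈ`: a bounded continuous map from `(0,T)` to the normed space of
`C¹` vector fields that are bounded with bounded derivative. -/
structure IsDrift (T : ℝ) (b : ℝ → Rd d → Rd d) : Prop where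
  contDiff : ∀ t ∈ Ioo 0 T, ContDiff ℝ 1 (b t)
  bounded : ∃ M : ℝ, ∀ t ∈ Ioo 0 T, ∀ x, ‖b t x‖ ≤ M ∧ ‖fderiv ℝ (b t) x‖ ≤ M
  continuous : ∀ t ∈ Ioo 0 T, ∀ ε > 0, ∃ δ > 0, ∀ s ∈ Ioo 0 T, |s - t| < δ →
    ∀ x, ‖b s x - b t x‖ ≤ ε ∧ ‖fderiv ℝ (b s) x - fderiv ℝ (b t) x‖ ≤ ε

/-- `‖b‖_∞`, the supremum of `|b(t,x)|` over `(t,x) ∈ (0,T) × ℝᵈ`. -/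
def driftNorm (T : ℝ) (b : ℝ → Rd d → Rd d) : ℝ :=
  sSup {r | ∃ t ∈ Ioo 0 T, ∃ x, r = ‖b t x‖}

/-- `φ ∈ C^{1,2}_b([0,T] × ℝᵈ)`: the functions `φ, ∂ₜφ, Dφ, D²φ` exist and are bounded and
continuous on `[0,T] × ℝᵈ` (one-sided time derivatives at the end points). -/
structure IsTestFunction (T : ℝ) (φ : ℝ → Rd d → ℝ) : Prop where
  differentiableOn : ∀ x, DifferentiableOn ℝ (fun t => φ t x) (Icc 0 T)
  contDiff : ∀ t ∈ Icc 0 T, ContDiff ℝ 2 (φ t)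
  continuousOn : ContinuousOn (fun p : ℝ × Rd d => φ p.1 p.2) (Icc 0 T ×ˢ univ)
  continuousOn_dt : ContinuousOn
    (fun p : ℝ × Rd d => derivWithin (fun t => φ t p.2) (Icc 0 T) p.1) (Icc 0 T ×ˢ univ)
  continuousOn_dx : ContinuousOn (fun p : ℝ × Rd d => fderiv ℝ (φ p.1) p.2) (Icc 0 T ×ˢ univ)
  continuousOn_dxx : ContinuousOn
    (fun p : ℝ × Rd d => iteratedFDeriv ℝ 2 (φ p.1) p.2) (Icc 0 T ×ˢ univ)
  bounded : ∃ M : ℝ, ∀ t ∈ Icc 0 T, ∀ x, |φ t x| ≤ M ∧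
    |derivWithin (fun s => φ s x) (Icc 0 T) t| ≤ M ∧ ‖fderiv ℝ (φ t) x‖ ≤ M ∧
    ‖iteratedFDeriv ℝ 2 (φ t) x‖ ≤ M

/-- `m` is a distributional solution, in `C([0,T], 𝓟)`, of
`∂ₜ m - 𝓛* m - div (b m) = 0` in `(0,T) × ℝᵈ`, `m(0) = m₀`. -/
structure IsSolution (L : LevyTriplet d) (T : ℝ) (b : ℝ → Rd d → Rd d)
    (m₀ : ProbabilityMeasure (Rd d)) (m : ℝ → ProbabilityMeasure (Rd d)) : Prop where
  continuous : IsContinuousCurve T m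
  equation : ∀ φ : ℝ → Rd d → ℝ, IsTestFunction T φ → ∀ t ∈ Icc 0 T,
    ∫ x, φ t x ∂(m t : Measure (Rd d)) - ∫ x, φ 0 x ∂(m₀ : Measure (Rd d))
      = ∫ s in (0 : ℝ)..t, ∫ x, (derivWithin (fun r => φ r x) (Icc 0 T) s + L.op (φ s) x
          - fderiv ℝ (φ s) x (b s x)) ∂(m s : Measure (Rd d))

/-! ### Generalized moments -/

/-- The functions measuring tightness: nonnegative, subadditive, of class `C²` with bounded first
and second derivatives, and tending to `∞` at infinity. -/
structure IsTightnessFunction (ψ : Rd d → ℝ) : Prop where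
  contDiff : ContDiff ℝ 2 ψ
  nonneg : ∀ x, 0 ≤ ψ x
  subadditive : ∀ x y, ψ (x + y) ≤ ψ x + ψ y
  bounded : ∃ M : ℝ, ∀ x, ‖fderiv ℝ ψ x‖ ≤ M ∧ ‖iteratedFDeriv ℝ 2 ψ x‖ ≤ M
  tendsto : Tendsto ψ (cocompact (Rd d)) atTop

end FokkerPlanck

end

open FokkerPlanck

open MeasureTheory Set Filter Topology
open scoped ContDiff

noncomputable section

set_option linter.unusedSectionVars false

namespace FokkerPlanck

/-! ### Fourier calculus for Lévy operators. -/

section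
/-! ### Integrability against a Lévy measure -/

namespace LevyTriplet

variable {d : ℕ} (L : LevyTriplet d)

/-! The equation is the forward equation of dX = -b(t,X) dt + dZ, where Z is the Lévy process
generated by 𝓛. On plane waves 𝓛 is multiplication by -Ψ, so Duhamel's formula for the
characteristic function reads exp(tΨ(ξ)) m̂(t,ξ) = m̂₀(ξ) - ∫₀ᵗ exp(sΨ(ξ)) i ∫ ⟨b(s,x),ξ⟩
exp(i⟨x,ξ⟩) m(s,dx) ds. This is `IsDriven`. The functions exp(sΨ(ξ)) exp(i⟨x,ξ⟩) solve the backward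
equation without drift, and testing with them shows that every distributional solution satisfies the
formula (`IsSolution.isDriven`).

Integrated against the Fourier amplitude of a function ψ, the formula becomes ∫ψ dm(t) = ∫Pₜψ dm₀ -
∫₀ᵗ ∫ D(Pₜ₋ₛψ)·b dm(s) ds, with P the heat semigroup. The kernel bound of order one gives ‖D Pᵣψ‖_∞
≤ C r^(-1/α) ‖ψ‖_∞. Hence the right-hand side pairs m(s) only with bounded continuous functions, and
the singularity is integrable because α > 1. A Gronwall argument in duality with bounded continuous
functions then closes. Its outcome, `IsMildApprox.compare`, carries the proof: two curves with the
same initial law that solve the mild equation up to errors η and η' stay within c(η + η') of each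
other. It gives convergence of the approximations, uniqueness, and stability.

For existence, an Euler scheme freezes the drift on short time intervals and adds independent Lévy
increments. The resulting laws solve the Fourier equation exactly, with a velocity close in mean to
b (`IsDrift.exists_isDriven`). The comparison makes them Cauchy, and the Fourier equation passes to
the limit (`IsDrift.exists_mild`). To return to the distributional form, the equation is
differentiated in time, superposed over frequencies, extended to C²_b by mollification and cutoff
(`IsMild.weak`), and extended to time-dependent test functions by the product rule
(`IsMild.isSolution`).

The estimates follow from the weak form. For the Hölder bound, a Lipschitz function is replaced by
one with Hessian of size 1/ε at distance of order ε, with ε = |t-s|^(1/2). Tightness is compactness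
of a continuous image of [0,T]. For the moments, ψ is replaced by its saturation Rψ/(R+ψ), whose
derivative and jump bounds do not depend on R, and Fatou's lemma removes R. -/

lemma integrable_min : Integrable (fun z => min 1 (‖z‖ ^ 2)) L.ν := by
  refine ⟨by fun_prop, ?_⟩
  rw [hasFiniteIntegral_iff_ofReal (Eventually.of_forall fun z => by positivity)]
  exact L.lintegral_lt_top

variable {L} in
lemma integrable_of_norm_le {E : Type*} [NormedAddCommGroup E] {μ : Measure (Rd d)}
    (hμ : μ ≤ L.ν) {f : Rd d → E} {C : ℝ} (hf : AEStronglyMeasurable f μ)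
    (h : ∀ z, ‖f z‖ ≤ C * min 1 (‖z‖ ^ 2)) : Integrable f μ :=
  ((L.integrable_min.mono_measure hμ).const_mul C).mono' hf (Eventually.of_forall h)

lemma min_pos {z : Rd d} (hz : z ≠ 0) : 0 < min 1 (‖z‖ ^ 2) :=
  lt_min one_pos (by positivity)

/-- The Lévy condition does not see the origin, where ν may have infinite mass. Away from the origin
ν integrates a positive function, hence is σ-finite there, and this is what Fubini's theorem needs.
-/
instance sigmaFinite_restrict : SigmaFinite (L.ν.restrict {0}ᶜ) := by
  have h1 : Function.support (fun z : Rd d => min 1 (‖z‖ ^ 2)) = {0}ᶜ := by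
    ext z
    by_cases hz : z = 0
    · simp [hz]
    · simpa [hz] using (min_pos hz).ne'
  have h2 : AEFinStronglyMeasurable (fun z : Rd d => min 1 (‖z‖ ^ 2)) L.ν :=
    L.integrable_min.aefinStronglyMeasurable
  have h3 := h2.sigmaFinite_restrict
  have h4 := h2.ae_eq_zero_compl
  -- Off the σ-finite set the integrable function vanishes almost everywhere, but it is positive at
  -- every z ≠ 0.
  have h5 : L.ν (h2.sigmaFiniteSetᶜ ∩ {0}ᶜ) = 0 := by
    rw [Filter.EventuallyEq, ae_restrict_iff' h2.measurableSet.compl] at h4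
    refine measure_mono_null ?_ h4
    rintro z ⟨hz1, hz2⟩ h
    exact (min_pos hz2).ne' (h hz1)
  have h6 : L.ν.restrict {0}ᶜ ≤ L.ν.restrict h2.sigmaFiniteSet := by
    have : L.ν.restrict {0}ᶜ = L.ν.restrict ({0}ᶜ ∩ h2.sigmaFiniteSet) := by
      refine Measure.restrict_congr_set ?_
      rw [ae_eq_set]
      refine ⟨?_, by simp⟩
      rw [Set.sdiff_self_inter]
      refine measure_mono_null ?_ h5
      rintro z ⟨hz1, hz2⟩
      exact ⟨hz2, hz1⟩
    rw [this]
    exact Measure.restrict_mono_set _ inter_subset_right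
  exact Measure.sigmaFinite_of_le _ h6

lemma restrict_le : L.ν.restrict {0}ᶜ ≤ L.ν := Measure.restrict_le_self

/-- The integrands of the operator and of its symbol both vanish at z = 0, so ν can be replaced by
its σ-finite restriction. -/
lemma setIntegral_compl_zero {E : Type*} [NormedAddCommGroup E] [NormedSpace ℝ E] {f : Rd d → E}
    (h : f 0 = 0) : ∫ z in {0}ᶜ, f z ∂L.ν = ∫ z, f z ∂L.ν :=
  setIntegral_eq_integral_of_forall_compl_eq_zero fun z hz => by
    have : z = 0 := by simpa using hz
    rw [this, h]

end LevyTriplet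

/-! ### Plane waves -/

variable {d : ℕ}

/-- The plane wave `exp (i ⟪x, ξ⟫)`. -/
def wave (x ξ : Rd d) : ℂ := Complex.exp (((inner ℝ x ξ : ℝ) : ℂ) * Complex.I)

lemma norm_wave (x ξ : Rd d) : ‖wave x ξ‖ = 1 := Complex.norm_exp_ofReal_mul_I _

lemma wave_add (x y ξ : Rd d) : wave (x + y) ξ = wave x ξ * wave y ξ := by
  simp [wave, inner_add_left, add_mul, Complex.exp_add]

lemma wave_zero (ξ : Rd d) : wave 0 ξ = 1 := by simp [wave]

@[fun_prop]
lemma continuous_wave {X : Type*} [TopologicalSpace X] {f g : X → Rd d} (hf : Continuous f)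
    (hg : Continuous g) : Continuous fun x => wave (f x) (g x) := by
  unfold wave
  fun_prop

@[fun_prop]
lemma measurable_wave {X : Type*} [MeasurableSpace X] {f g : X → Rd d} (hf : Measurable f)
    (hg : Measurable g) : Measurable fun x => wave (f x) (g x) := by
  unfold wave
  fun_prop

lemma charFun_eq_integral_wave (μ : Measure (Rd d)) (ξ : Rd d) :
    charFun μ ξ = ∫ x, wave x ξ ∂μ := rfl

/-- For a phase r with |r| ≤ 1 this is Taylor's formula; for |r| > 1 the crude bound 2|r| is already
below 2r². -/
lemma norm_wave_sub_one_sub_le (z ξ : Rd d) :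
    ‖wave z ξ - 1 - Complex.I * ((inner ℝ ξ z : ℝ) : ℂ)‖ ≤ 2 * (‖z‖ * ‖ξ‖) ^ 2 := by
  have hr : |inner ℝ z ξ| ≤ ‖z‖ * ‖ξ‖ := abs_real_inner_le_norm z ξ
  rw [real_inner_comm, wave, mul_comm Complex.I]
  set r : ℝ := inner ℝ z ξ
  have hn : ‖(r : ℂ) * Complex.I‖ = |r| := by simp
  have hsq : |r| ^ 2 ≤ (‖z‖ * ‖ξ‖) ^ 2 := by gcongr
  by_cases h : |r| ≤ 1
  · have h1 := Complex.norm_exp_sub_one_sub_id_le (x := (r : ℂ) * Complex.I) (by rw [hn]; exact h)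
    rw [hn] at h1
    nlinarith [sq_nonneg (‖z‖ * ‖ξ‖)]
  · push Not at h
    have h1 : ‖Complex.exp ((r : ℂ) * Complex.I) - 1‖ ≤ |r| := by
      have := Real.norm_exp_I_mul_ofReal_sub_one_le (x := r)
      rwa [mul_comm] at this
    calc _ ≤ |r| + |r| := (norm_sub_le _ _).trans (add_le_add h1 hn.le)
      _ ≤ 2 * |r| ^ 2 := by nlinarith
      _ ≤ _ := by gcongr

/-- The jump part of the symbol. -/
def jumpSymbol (ξ z : Rd d) : ℂ :=
  1 - Complex.exp (Complex.I * ((inner ℝ ξ z : ℝ) : ℂ))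
        + (Metric.ball (0 : Rd d) 1).indicator
            (fun w => Complex.I * ((inner ℝ ξ w : ℝ) : ℂ)) z

lemma jumpSymbol_eq (ξ z : Rd d) : jumpSymbol ξ z =
    -(wave z ξ - 1 - (Metric.ball (0 : Rd d) 1).indicator
            (fun w => Complex.I * ((inner ℝ ξ w : ℝ) : ℂ)) z) := by
  rw [jumpSymbol, wave, real_inner_comm, mul_comm]; ring

lemma jumpSymbol_zero_right (ξ : Rd d) : jumpSymbol ξ 0 = 0 := by
  simp [jumpSymbol, indicator]

lemma measurable_jumpSymbol : Measurable fun p : Rd d × Rd d => jumpSymbol p.1 p.2 := by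
  unfold jumpSymbol
  refine Measurable.add (by fun_prop) ?_
  have : (fun p : Rd d × Rd d => (Metric.ball (0 : Rd d) 1).indicator
            (fun w => Complex.I * ((inner ℝ p.1 w : ℝ) : ℂ)) p.2)
      = (Prod.snd ⁻¹' Metric.ball (0 : Rd d) 1).indicator
          (fun p => Complex.I * ((inner ℝ p.1 p.2 : ℝ) : ℂ)) := by
    ext p; simp [indicator]
  rw [this]
  exact Measurable.indicator (by fun_prop) (measurable_snd Metric.isOpen_ball.measurableSet)

/-- Small jumps use the second-order bound and large jumps the bound 2. The product form separates ξ
from z, which gives the domination needed to exchange the two integrals. -/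
lemma norm_jumpSymbol_le (ξ z : Rd d) :
    ‖jumpSymbol ξ z‖ ≤ 2 * (1 + ‖ξ‖ ^ 2) * min 1 (‖z‖ ^ 2) := by
  rw [jumpSymbol_eq, norm_neg]
  by_cases hz : ‖z‖ < 1
  · rw [indicator_of_mem (by simpa using hz), min_eq_right (by nlinarith [norm_nonneg z])]
    refine (norm_wave_sub_one_sub_le z ξ).trans ?_
    nlinarith [sq_nonneg ‖z‖, sq_nonneg ‖ξ‖]
  · push Not at hz
    rw [indicator_of_notMem (by simpa using hz), min_eq_left (by nlinarith), sub_zero]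
    calc _ ≤ ‖wave z ξ‖ + ‖(1 : ℂ)‖ := norm_sub_le _ _
      _ ≤ _ := by rw [norm_wave]; simp; nlinarith [sq_nonneg ‖ξ‖]

namespace LevyTriplet

variable (L : LevyTriplet d)

lemma symbol_eq (ξ : Rd d) : L.symbol ξ = -Complex.I * ((inner ℝ L.B ξ : ℝ) : ℂ)
    + ((inner ℝ ξ (Matrix.toEuclideanCLM (𝕜 := ℝ) L.A ξ) : ℝ) : ℂ)
    + ∫ z in {0}ᶜ, jumpSymbol ξ z ∂L.ν := by
  rw [L.setIntegral_compl_zero (jumpSymbol_zero_right ξ)]; rfl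

lemma measurable_symbol : Measurable L.symbol := by
  have : L.symbol = fun ξ => -Complex.I * ((inner ℝ L.B ξ : ℝ) : ℂ)
      + ((inner ℝ ξ (Matrix.toEuclideanCLM (𝕜 := ℝ) L.A ξ) : ℝ) : ℂ)
      + ∫ z in {0}ᶜ, jumpSymbol ξ z ∂L.ν := funext L.symbol_eq
  rw [this]
  refine Measurable.add (by fun_prop) ?_
  exact (measurable_jumpSymbol.stronglyMeasurable.integral_prod_right
    (ν := L.ν.restrict {0}ᶜ)).measurable

/-- Quadratic growth of the symbol is what dictates the weight 1 + |ξ|² in `IsAmplitude`. -/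
lemma exists_norm_symbol_le : ∃ C, 0 ≤ C ∧ ∀ ξ, ‖L.symbol ξ‖ ≤ C * (1 + ‖ξ‖ ^ 2) := by
  refine ⟨‖L.B‖ + ‖Matrix.toEuclideanCLM (𝕜 := ℝ) L.A‖ + 2 * ∫ z, min 1 (‖z‖ ^ 2) ∂L.ν,
    by positivity, fun ξ => ?_⟩
  have h0 : 0 ≤ ‖ξ‖ := norm_nonneg ξ
  have h1 : ‖-Complex.I * ((inner ℝ L.B ξ : ℝ) : ℂ)‖ ≤ ‖L.B‖ * (1 + ‖ξ‖ ^ 2) := by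
    rw [norm_mul, norm_neg, Complex.norm_I, one_mul, Complex.norm_real]
    refine (norm_inner_le_norm _ _).trans ?_
    gcongr; nlinarith
  have h2 : ‖((inner ℝ ξ (Matrix.toEuclideanCLM (𝕜 := ℝ) L.A ξ) : ℝ) : ℂ)‖
      ≤ ‖Matrix.toEuclideanCLM (𝕜 := ℝ) L.A‖ * (1 + ‖ξ‖ ^ 2) := by
    rw [Complex.norm_real]
    refine (norm_inner_le_norm _ _).trans ?_
    have := (Matrix.toEuclideanCLM (𝕜 := ℝ) L.A).le_opNorm ξ
    calc _ ≤ ‖ξ‖ * (‖Matrix.toEuclideanCLM (𝕜 := ℝ) L.A‖ * ‖ξ‖) := by gcongr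
      _ = ‖Matrix.toEuclideanCLM (𝕜 := ℝ) L.A‖ * ‖ξ‖ ^ 2 := by ring
      _ ≤ _ := by gcongr; linarith
  have h3 : ‖∫ z, jumpSymbol ξ z ∂L.ν‖ ≤ 2 * (1 + ‖ξ‖ ^ 2) * ∫ z, min 1 (‖z‖ ^ 2) ∂L.ν := by
    rw [← integral_const_mul]
    exact norm_integral_le_of_norm_le (L.integrable_min.const_mul _)
      (Eventually.of_forall (norm_jumpSymbol_le ξ))
  calc ‖L.symbol ξ‖ ≤ _ := norm_add₃_le
    _ ≤ _ := add_le_add_three h1 h2 h3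
    _ = _ := by ring

end LevyTriplet

end

section
/-! ### Superpositions of plane waves -/

variable {d : ℕ}

lemma contDiff_two_of_hasFDerivAt {E F : Type*} [NormedAddCommGroup E] [NormedSpace ℝ E]
    [NormedAddCommGroup F] [NormedSpace ℝ F] {f : E → F} {f' : E → E →L[ℝ] F}
    {f'' : E → E →L[ℝ] E →L[ℝ] F} (h : ∀ x, HasFDerivAt f (f' x) x)
    (h' : ∀ x, HasFDerivAt f' (f'' x) x) (hc : Continuous f'') : ContDiff ℝ 2 f := by
  have e1 : fderiv ℝ f = f' := funext fun x => (h x).fderiv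
  have e2 : fderiv ℝ f' = f'' := funext fun x => (h' x).fderiv
  rw [show (2 : WithTop ℕ∞) = 1 + 1 by norm_num, contDiff_succ_iff_fderiv]
  refine ⟨fun x => (h x).differentiableAt, by simp, ?_⟩
  rw [e1, contDiff_one_iff_fderiv, e2]
  exact ⟨fun x => (h' x).differentiableAt, hc⟩

section synth

variable {F : Type*} [NormedAddCommGroup F] [NormedSpace ℝ F] [NormedSpace ℂ F]
  [IsScalarTower ℝ ℂ F]

/-- The superposition of plane waves with amplitude `G`. -/
def synth (μ : Measure (Rd d)) (G : Rd d → F) (x : Rd d) : F := ∫ ξ, wave x ξ • G ξ ∂μ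

variable {μ : Measure (Rd d)} {G : Rd d → F}

lemma integrable_wave_smul (hG : Integrable G μ) (x : Rd d) :
    Integrable (fun ξ => wave x ξ • G ξ) μ :=
  hG.norm.mono' ((by fun_prop : AEStronglyMeasurable (fun ξ => wave x ξ) μ).smul
    hG.aestronglyMeasurable) (Eventually.of_forall fun ξ => by rw [norm_smul, norm_wave, one_mul])

lemma continuous_synth (hG : Integrable G μ) : Continuous (synth μ G) := by
  refine continuous_of_dominated (bound := fun ξ => ‖G ξ‖)
    (fun x => (integrable_wave_smul hG x).aestronglyMeasurable)
    (fun x => Eventually.of_forall fun ξ => by rw [norm_smul, norm_wave, one_mul]) hG.norm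
    (Eventually.of_forall fun ξ => by fun_prop)

lemma norm_synth_le (G : Rd d → F) (x : Rd d) : ‖synth μ G x‖ ≤ ∫ ξ, ‖G ξ‖ ∂μ := by
  refine (norm_integral_le_integral_norm _).trans_eq ?_
  simp [norm_smul, norm_wave]

/-- The amplitude of the derivative of a superposition of plane waves. -/
def gradAmp (G : Rd d → F) (ξ : Rd d) : Rd d →L[ℝ] F :=
  (innerSL ℝ ξ).smulRight (Complex.I • G ξ)

lemma gradAmp_apply (G : Rd d → F) (ξ v : Rd d) :
    gradAmp G ξ v = (inner ℝ ξ v : ℝ) • Complex.I • G ξ := by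
  simp [gradAmp]

lemma norm_gradAmp (G : Rd d → F) (ξ : Rd d) : ‖gradAmp G ξ‖ = ‖ξ‖ * ‖G ξ‖ := by
  simp [gradAmp, ContinuousLinearMap.norm_smulRight_apply, norm_smul]

lemma aestronglyMeasurable_gradAmp (hG : AEStronglyMeasurable G μ) :
    AEStronglyMeasurable (gradAmp G) μ := by
  have : gradAmp G = fun ξ => ContinuousLinearMap.smulRightL ℝ (Rd d) F (innerSL ℝ ξ)
      (Complex.I • G ξ) := by
    ext; simp [gradAmp]
  rw [this]
  exact ((ContinuousLinearMap.smulRightL ℝ (Rd d) F).comp (innerSL ℝ)).aestronglyMeasurable_comp₂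
    aestronglyMeasurable_id (hG.const_smul Complex.I)

lemma integrable_gradAmp (hG : AEStronglyMeasurable G μ)
    (hG' : Integrable (fun ξ => ‖ξ‖ * ‖G ξ‖) μ) : Integrable (gradAmp G) μ :=
  hG'.mono' (aestronglyMeasurable_gradAmp hG) (Eventually.of_forall fun ξ => (norm_gradAmp G ξ).le)

lemma hasFDerivAt_wave (x ξ : Rd d) :
    HasFDerivAt (fun x => wave x ξ) ((innerSL ℝ ξ).smulRight (wave x ξ * Complex.I)) x := by
  have h1 : HasFDerivAt (fun x : Rd d => inner ℝ x ξ) (innerSL ℝ ξ) x := by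
    have := (innerSL ℝ ξ).hasFDerivAt (x := x)
    refine this.congr_of_eventuallyEq (Eventually.of_forall fun y => ?_)
    simp [real_inner_comm]
  have h2 := ((Complex.ofRealCLM.hasFDerivAt.comp x h1).mul_const Complex.I).cexp
  refine h2.congr_fderiv ?_
  ext v
  simp [wave]
  ring

/-- The values lie in a general space `F` so that the lemma can be applied again to `gradAmp G`,
which produces the Hessian. -/
lemma hasFDerivAt_synth (hG : Integrable G μ) (hG' : Integrable (fun ξ => ‖ξ‖ * ‖G ξ‖) μ)
    (x : Rd d) : HasFDerivAt (synth μ G) (synth μ (gradAmp G) x) x := by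
  refine hasFDerivAt_integral_of_dominated_of_fderiv_le (bound := fun ξ => ‖ξ‖ * ‖G ξ‖)
    (F' := fun x ξ => wave x ξ • gradAmp G ξ) (s := univ) univ_mem
    (Eventually.of_forall fun y => (integrable_wave_smul hG y).aestronglyMeasurable)
    (integrable_wave_smul hG x)
    (integrable_wave_smul (integrable_gradAmp hG.aestronglyMeasurable hG') x).aestronglyMeasurable
    (Eventually.of_forall fun ξ y _ => by rw [norm_smul, norm_wave, one_mul, norm_gradAmp]) hG'
    (Eventually.of_forall fun ξ y _ => ?_)
  refine ((hasFDerivAt_wave y ξ).smul_const (G ξ)).congr_fderiv ?_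
  ext v
  have hr : ∀ (r : ℝ) (f : F), r • f = (r : ℂ) • f := fun r f => (algebraMap_smul ℂ r f).symm
  simp only [ContinuousLinearMap.smulRight_apply, smul_apply, gradAmp_apply,
    innerSL_apply_apply, hr, smul_smul]
  simp only [Complex.real_smul]
  congr 1
  ring

end synth

/-- `g` is measurable and `(1 + |ξ|²) g` is integrable. -/
structure IsAmplitude (μ : Measure (Rd d)) (g : Rd d → ℂ) : Prop where
  meas : AEStronglyMeasurable g μ
  int : Integrable (fun ξ => (1 + ‖ξ‖ ^ 2) * ‖g ξ‖) μ

namespace IsAmplitude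

variable {μ : Measure (Rd d)} {g : Rd d → ℂ} (hg : IsAmplitude μ g)
include hg

lemma integrable_of_norm_le {E : Type*} [NormedAddCommGroup E] {f : Rd d → E}
    (hf : AEStronglyMeasurable f μ) {C : ℝ} (h : ∀ ξ, ‖f ξ‖ ≤ C * ((1 + ‖ξ‖ ^ 2) * ‖g ξ‖)) :
    Integrable f μ :=
  (hg.int.const_mul C).mono' hf (Eventually.of_forall h)

lemma integrable : Integrable g μ :=
  hg.integrable_of_norm_le hg.meas (C := 1) fun ξ => by
    nlinarith [mul_nonneg (sq_nonneg ‖ξ‖) (norm_nonneg (g ξ))]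

lemma integrable_norm_mul : Integrable (fun ξ => ‖ξ‖ * ‖g ξ‖) μ :=
  hg.integrable_of_norm_le (by have := hg.meas; fun_prop) (C := 1) fun ξ => by
    rw [Real.norm_of_nonneg (by positivity), one_mul]
    gcongr
    nlinarith [norm_nonneg ξ]

lemma integrable_gradAmp : Integrable (gradAmp g) μ :=
  FokkerPlanck.integrable_gradAmp hg.meas hg.integrable_norm_mul

lemma integrable_norm_mul_gradAmp : Integrable (fun ξ => ‖ξ‖ * ‖gradAmp g ξ‖) μ := by
  simp_rw [norm_gradAmp]
  refine hg.integrable_of_norm_le (by have := hg.meas; fun_prop) (C := 1) fun ξ => ?_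
  rw [Real.norm_of_nonneg (by positivity), one_mul, ← mul_assoc]
  gcongr
  nlinarith [norm_nonneg ξ]

lemma integrable_gradAmp_gradAmp : Integrable (gradAmp (gradAmp g)) μ :=
  FokkerPlanck.integrable_gradAmp hg.integrable_gradAmp.aestronglyMeasurable
    hg.integrable_norm_mul_gradAmp

/-- The real part of a superposition of plane waves, its gradient and its Hessian. -/
lemma hasFDerivAt_re (x : Rd d) : HasFDerivAt (fun x => (synth μ g x).re)
    (Complex.reCLM.comp (synth μ (gradAmp g) x)) x :=
  Complex.reCLM.hasFDerivAt.comp x (hasFDerivAt_synth hg.integrable hg.integrable_norm_mul x)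

lemma hasFDerivAt_fderiv_re (x : Rd d) :
    HasFDerivAt (fun x => (Complex.reCLM.comp (synth μ (gradAmp g) x) : Rd d →L[ℝ] ℝ))
    ((ContinuousLinearMap.compL ℝ (Rd d) ℂ ℝ Complex.reCLM).comp
      (synth μ (gradAmp (gradAmp g)) x)) x :=
  (ContinuousLinearMap.compL ℝ (Rd d) ℂ ℝ Complex.reCLM).hasFDerivAt.comp x
    (hasFDerivAt_synth hg.integrable_gradAmp hg.integrable_norm_mul_gradAmp x)

lemma contDiff_re : ContDiff ℝ 2 (fun x => (synth μ g x).re) :=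
  contDiff_two_of_hasFDerivAt hg.hasFDerivAt_re hg.hasFDerivAt_fderiv_re <| by
    have := continuous_synth hg.integrable_gradAmp_gradAmp
    fun_prop

lemma fderiv_re : fderiv ℝ (fun x => (synth μ g x).re) =
    fun x => Complex.reCLM.comp (synth μ (gradAmp g) x) :=
  funext fun x => (hg.hasFDerivAt_re x).fderiv

lemma fderiv_re_apply (x v : Rd d) : fderiv ℝ (fun x => (synth μ g x).re) x v =
    (∫ ξ, wave x ξ * (Complex.I * ((inner ℝ ξ v : ℝ) : ℂ) * g ξ) ∂μ).re := by
  rw [hg.fderiv_re]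
  simp only [ContinuousLinearMap.comp_apply, Complex.reCLM_apply, synth]
  rw [ContinuousLinearMap.integral_apply (integrable_wave_smul hg.integrable_gradAmp x)]
  congr 2; ext ξ
  simp only [smul_apply, gradAmp_apply, smul_eq_mul, Complex.real_smul]
  ring

lemma fderiv_fderiv_re_apply (x v w : Rd d) :
    fderiv ℝ (fderiv ℝ (fun x => (synth μ g x).re)) x v w =
    (∫ ξ, wave x ξ * (-((inner ℝ ξ v : ℝ) * (inner ℝ ξ w : ℝ) : ℂ) * g ξ) ∂μ).re := by
  rw [hg.fderiv_re, (hg.hasFDerivAt_fderiv_re x).fderiv]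
  simp only [ContinuousLinearMap.comp_apply, ContinuousLinearMap.compL_apply, Complex.reCLM_apply,
    synth]
  have h := integrable_wave_smul hg.integrable_gradAmp_gradAmp x
  rw [ContinuousLinearMap.integral_apply h,
    ContinuousLinearMap.integral_apply (h.apply_continuousLinearMap v)]
  congr 2; ext ξ
  simp [gradAmp_apply]
  linear_combination (wave x ξ * (inner ℝ ξ v : ℝ) * (inner ℝ ξ w : ℝ) * g ξ) * Complex.I_mul_I

end IsAmplitude

end

section
/-! ### The Lévy operator -/

variable {d : ℕ}

/-- The integrand of the jump part of a Lévy operator. -/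
def jump (u : Rd d → ℝ) (x z : Rd d) : ℝ :=
  u (x + z) - u x - (Metric.ball (0 : Rd d) 1).indicator (fun w => fderiv ℝ u x w) z

lemma jump_zero_right (u : Rd d → ℝ) (x : Rd d) : jump u x 0 = 0 := by simp [jump, indicator]

namespace LevyTriplet

variable (L : LevyTriplet d)

lemma op_eq (u : Rd d → ℝ) (x : Rd d) : L.op u x = fderiv ℝ u x L.B
    + ∑ i, ∑ j, L.A i j * fderiv ℝ (fderiv ℝ u) x (EuclideanSpace.single i 1)
        (EuclideanSpace.single j 1) + ∫ z, jump u x z ∂L.ν := by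
  simp [op, iteratedFDeriv_two_apply, jump]

lemma inner_toEuclideanCLM (ξ : Rd d) : inner ℝ ξ (Matrix.toEuclideanCLM (𝕜 := ℝ) L.A ξ)
    = ∑ i, ∑ j, L.A i j * (inner ℝ ξ (EuclideanSpace.single i (1 : ℝ)) *
      inner ℝ ξ (EuclideanSpace.single j (1 : ℝ))) := by
  simp only [PiLp.inner_apply, Matrix.ofLp_toEuclideanCLM, Matrix.mulVec, dotProduct]
  refine Finset.sum_congr rfl fun i _ => ?_
  simp [Finset.sum_mul]
  refine Finset.sum_congr rfl fun j _ => ?_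
  ring

end LevyTriplet

lemma IsAmplitude.jump_re {μ : Measure (Rd d)} {g : Rd d → ℂ} (hg : IsAmplitude μ g)
    (x z : Rd d) : jump (fun x => (synth μ g x).re) x z =
    (∫ ξ, wave x ξ * (-jumpSymbol ξ z * g ξ) ∂μ).re := by
  have i1 := integrable_wave_smul hg.integrable (x + z)
  have i2 := integrable_wave_smul hg.integrable x
  have i3 : Integrable (fun ξ => wave x ξ * (Complex.I * ((inner ℝ ξ z : ℝ) : ℂ) * g ξ)) μ := by
    refine ((integrable_wave_smul hg.integrable_gradAmp x).apply_continuousLinearMap z).congr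
      (Eventually.of_forall fun ξ => ?_)
    simp only [smul_apply, gradAmp_apply, smul_eq_mul, Complex.real_smul]
    ring
  simp only [smul_eq_mul] at i1 i2
  by_cases hz : z ∈ Metric.ball (0 : Rd d) 1
  · rw [jump, indicator_of_mem hz, hg.fderiv_re_apply, ← Complex.sub_re, ← Complex.sub_re]
    simp only [synth, smul_eq_mul]
    have i4 : Integrable (fun ξ => wave (x + z) ξ * g ξ - wave x ξ * g ξ) μ := i1.sub i2
    rw [← integral_sub i1 i2, ← integral_sub i4 i3]
    congr 2; ext ξ
    rw [jumpSymbol_eq, indicator_of_mem hz, wave_add]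
    ring
  · rw [jump, indicator_of_notMem hz, sub_zero, ← Complex.sub_re]
    simp only [synth, smul_eq_mul]
    rw [← integral_sub i1 i2]
    congr 2; ext ξ
    rw [jumpSymbol_eq, indicator_of_notMem hz, wave_add]
    ring

/-- A Lévy operator acts on plane waves as multiplication by minus its symbol. -/
theorem LevyTriplet.op_synth_re (L : LevyTriplet d) {μ : Measure (Rd d)} [SFinite μ]
    {g : Rd d → ℂ} (hg : IsAmplitude μ g) (x : Rd d) : L.op (fun x => (synth μ g x).re) x =
    (∫ ξ, wave x ξ * (-L.symbol ξ * g ξ) ∂μ).re := by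
  have hgm := hg.meas
  have iB : Integrable (fun ξ => wave x ξ * (Complex.I * ((inner ℝ ξ L.B : ℝ) : ℂ) * g ξ)) μ := by
    refine ((integrable_wave_smul hg.integrable_gradAmp x).apply_continuousLinearMap L.B).congr
      (Eventually.of_forall fun ξ => ?_)
    simp only [smul_apply, gradAmp_apply, smul_eq_mul, Complex.real_smul]
    ring
  have iA : ∀ v w : Rd d, Integrable
      (fun ξ => wave x ξ * (-((inner ℝ ξ v : ℝ) * (inner ℝ ξ w : ℝ) : ℂ) * g ξ)) μ := by
    intro v w
    refine (((integrable_wave_smul hg.integrable_gradAmp_gradAmp x).apply_continuousLinearMap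
      v).apply_continuousLinearMap w).congr (Eventually.of_forall fun ξ => ?_)
    simp only [smul_apply, gradAmp_apply, smul_eq_mul, Complex.real_smul]
    linear_combination (wave x ξ * (inner ℝ ξ v : ℝ) * (inner ℝ ξ w : ℝ) * g ξ) * Complex.I_mul_I
  -- Absolute integrability over frequency and jump size jointly: the integrand is dominated by a
  -- product of a function of ξ and the Lévy weight in z.
  have iJ : Integrable (fun p : Rd d × Rd d => wave x p.1 * (-jumpSymbol p.1 p.2 * g p.1))
      (μ.prod (L.ν.restrict {0}ᶜ)) := by
    have h1 := (hg.int.const_mul 2).mul_prod (L.integrable_min.mono_measure L.restrict_le)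
    refine h1.mono' ?_ (Eventually.of_forall fun p => ?_)
    · have h2 : AEStronglyMeasurable (fun p : Rd d × Rd d => g p.1)
          (μ.prod (L.ν.restrict {0}ᶜ)) := hgm.comp_fst
      exact (by fun_prop : Measurable fun p : Rd d × Rd d => wave x p.1).aestronglyMeasurable.mul
        (measurable_jumpSymbol.aestronglyMeasurable.neg.mul h2)
    · rw [norm_mul, norm_wave, one_mul, norm_mul, norm_neg]
      calc _ ≤ 2 * (1 + ‖p.1‖ ^ 2) * min 1 (‖p.2‖ ^ 2) * ‖g p.1‖ := by
            gcongr; exact norm_jumpSymbol_le _ _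
        _ = _ := by ring
  have eJ : ∫ z, jump (fun x => (synth μ g x).re) x z ∂L.ν
      = (∫ ξ, wave x ξ * (-(∫ z in {0}ᶜ, jumpSymbol ξ z ∂L.ν) * g ξ) ∂μ).re := by
    rw [← L.setIntegral_compl_zero (jump_zero_right _ x)]
    simp_rw [hg.jump_re]
    have h3 : ∀ f : Rd d → ℂ, Integrable f (L.ν.restrict {0}ᶜ) →
        ∫ z in {0}ᶜ, (f z).re ∂L.ν = (∫ z in {0}ᶜ, f z ∂L.ν).re := fun f hf =>
      integral_re hf
    have h4 : Integrable (fun z => ∫ ξ, wave x ξ * (-jumpSymbol ξ z * g ξ) ∂μ)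
        (L.ν.restrict {0}ᶜ) := iJ.integral_prod_right
    rw [h3 _ h4, ← integral_integral_swap (f := fun ξ z => wave x ξ * (-jumpSymbol ξ z * g ξ)) iJ]
    congr 2; ext ξ
    rw [integral_const_mul, integral_mul_const, integral_neg]
  have iJ' : Integrable (fun ξ => wave x ξ * (-(∫ z in {0}ᶜ, jumpSymbol ξ z ∂L.ν) * g ξ)) μ := by
    refine iJ.integral_prod_left.congr (Eventually.of_forall fun ξ => ?_)
    simp only
    rw [integral_const_mul, integral_mul_const, integral_neg]
  rw [L.op_eq, hg.fderiv_re_apply, eJ]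
  simp_rw [hg.fderiv_fderiv_re_apply]
  have eA : ∑ i, ∑ j, L.A i j * (∫ ξ, wave x ξ *
        (-((inner ℝ ξ (EuclideanSpace.single i (1 : ℝ)) : ℝ) *
          (inner ℝ ξ (EuclideanSpace.single j (1 : ℝ)) : ℝ) : ℂ) * g ξ) ∂μ).re
      = (∫ ξ, ∑ i, ∑ j, (L.A i j : ℂ) * (wave x ξ *
        (-((inner ℝ ξ (EuclideanSpace.single i (1 : ℝ)) : ℝ) *
          (inner ℝ ξ (EuclideanSpace.single j (1 : ℝ)) : ℝ) : ℂ) * g ξ)) ∂μ).re := by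
    rw [integral_finsetSum _ fun i _ => integrable_finsetSum _ fun j _ => (iA _ _).const_mul _,
      Complex.re_sum]
    refine Finset.sum_congr rfl fun i _ => ?_
    rw [integral_finsetSum _ fun j _ => (iA _ _).const_mul _, Complex.re_sum]
    refine Finset.sum_congr rfl fun j _ => ?_
    rw [integral_const_mul, Complex.re_ofReal_mul]
  rw [eA, ← Complex.add_re, ← Complex.add_re, ← integral_add iB (integrable_finsetSum _ fun i _ =>
    integrable_finsetSum _ fun j _ => (iA _ _).const_mul _), ← integral_add _ iJ']
  · congr 2; ext ξ
    rw [L.symbol_eq, L.inner_toEuclideanCLM, real_inner_comm L.B]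
    push_cast
    have : ∑ i, ∑ j, (L.A i j : ℂ) * (wave x ξ *
        (-((inner ℝ ξ (EuclideanSpace.single i (1 : ℝ)) : ℝ) *
          (inner ℝ ξ (EuclideanSpace.single j (1 : ℝ)) : ℝ) : ℂ) * g ξ))
      = -(wave x ξ * g ξ) * ∑ i, ∑ j, (L.A i j : ℂ) *
        ((inner ℝ ξ (EuclideanSpace.single i (1 : ℝ)) : ℝ) *
          (inner ℝ ξ (EuclideanSpace.single j (1 : ℝ)) : ℝ) : ℂ) := by
      simp_rw [Finset.mul_sum]
      refine Finset.sum_congr rfl fun i _ => Finset.sum_congr rfl fun j _ => by ring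
    rw [this]
    ring
  · exact iB.add (integrable_finsetSum _ fun i _ =>
      integrable_finsetSum _ fun j _ => (iA _ _).const_mul _)

end

section
/-! ### The Lévy operator on `C²_b` -/

variable {d : ℕ}

/-- The gradient varies by at most M|z| on the ball of radius |z| about x, so the mean value
inequality applies to u minus its linear part. The factor 1/2 is not needed. -/
lemma abs_taylor_le {u : Rd d → ℝ} (hu : ContDiff ℝ 2 u) {M : ℝ}
    (h : ∀ x, ‖fderiv ℝ (fderiv ℝ u) x‖ ≤ M) (x z : Rd d) :
    |u (x + z) - u x - fderiv ℝ u x z| ≤ M * ‖z‖ ^ 2 := by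
  have hd : Differentiable ℝ u := hu.differentiable (by norm_num)
  have hd' : Differentiable ℝ (fderiv ℝ u) :=
    (hu.fderiv_right (m := 1) (by norm_num)).differentiable (by norm_num)
  have h1 : ∀ y ∈ Metric.closedBall x ‖z‖, ‖fderiv ℝ u y - fderiv ℝ u x‖ ≤ M * ‖z‖ := by
    intro y hy
    have := Convex.norm_image_sub_le_of_norm_fderiv_le (𝕜 := ℝ) (f := fderiv ℝ u) (C := M)
      (s := univ) (fun w _ => hd' w) (fun w _ => h w) convex_univ (mem_univ x) (mem_univ y)
    refine this.trans ?_
    gcongr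
    · exact le_trans (by positivity) (h x)
    · simpa [dist_eq_norm] using hy
  have h2 := Convex.norm_image_sub_le_of_norm_hasFDerivWithin_le' (𝕜 := ℝ) (f := u)
    (f' := fderiv ℝ u) (φ := fderiv ℝ u x) (C := M * ‖z‖) (s := Metric.closedBall x ‖z‖)
    (fun y _ => (hd y).hasFDerivAt.hasFDerivWithinAt) h1 (convex_closedBall x ‖z‖)
    (Metric.mem_closedBall_self (norm_nonneg z)) (y := x + z) (by simp)
  rw [add_sub_cancel_left] at h2
  calc _ ≤ _ := h2
    _ = _ := by ring

/-- `u` is of class `C²`, and `|u| ≤ M₀`, `|Du| ≤ M₁`, `|D²u| ≤ M₂`. -/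
structure CB2 (u : Rd d → ℝ) (M₀ M₁ M₂ : ℝ) : Prop where
  contDiff : ContDiff ℝ 2 u
  bound₀ : ∀ x, |u x| ≤ M₀
  bound₁ : ∀ x, ‖fderiv ℝ u x‖ ≤ M₁
  bound₂ : ∀ x, ‖fderiv ℝ (fderiv ℝ u) x‖ ≤ M₂

lemma measurable_jump (u : Rd d → ℝ) (hu : Continuous u) (x : Rd d) : Measurable (jump u x) := by
  unfold jump
  exact Measurable.sub (by fun_prop)
    (Measurable.indicator (by fun_prop) Metric.isOpen_ball.measurableSet)

namespace CB2

variable {u : Rd d → ℝ} {M₀ M₁ M₂ : ℝ} (hu : CB2 u M₀ M₁ M₂)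
include hu

lemma nonneg₀ : 0 ≤ M₀ := (abs_nonneg _).trans (hu.bound₀ 0)
lemma nonneg₁ : 0 ≤ M₁ := (norm_nonneg _).trans (hu.bound₁ 0)
lemma nonneg₂ : 0 ≤ M₂ := le_trans (by positivity) (hu.bound₂ 0)

lemma continuous : Continuous u := hu.contDiff.continuous

lemma continuous_fderiv : Continuous (fderiv ℝ u) := hu.contDiff.continuous_fderiv (by norm_num)

lemma continuous_fderiv_fderiv : Continuous (fderiv ℝ (fderiv ℝ u)) :=
  (hu.contDiff.fderiv_right (m := 1) (by norm_num)).continuous_fderiv (by norm_num)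

lemma abs_jump_le (x z : Rd d) : |jump u x z| ≤ (2 * M₀ + M₂) * min 1 (‖z‖ ^ 2) := by
  have h0 := hu.nonneg₀
  have h2 := hu.nonneg₂
  by_cases hz : ‖z‖ < 1
  · rw [jump, indicator_of_mem (by simpa using hz), min_eq_right (by nlinarith [norm_nonneg z])]
    refine (abs_taylor_le hu.contDiff hu.bound₂ x z).trans ?_
    gcongr; linarith
  · push Not at hz
    rw [jump, indicator_of_notMem (by simpa using hz), min_eq_left (by nlinarith), sub_zero]
    calc _ ≤ |u (x + z)| + |u x| := abs_sub _ _
      _ ≤ _ := by linarith [hu.bound₀ (x + z), hu.bound₀ x]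

lemma integrable_jump (L : LevyTriplet d) (x : Rd d) : Integrable (jump u x) L.ν :=
  LevyTriplet.integrable_of_norm_le le_rfl (measurable_jump u hu.continuous x).aestronglyMeasurable
    (hu.abs_jump_le x)

lemma continuous_op (L : LevyTriplet d) : Continuous (L.op u) := by
  have h1 := hu.continuous_fderiv
  have h2 := hu.continuous_fderiv_fderiv
  have h0 := hu.continuous
  have h3 : Continuous fun x => ∫ z, jump u x z ∂L.ν := by
    refine continuous_of_dominated (bound := fun z => (2 * M₀ + M₂) * min 1 (‖z‖ ^ 2))
      (fun x => (measurable_jump u hu.continuous x).aestronglyMeasurable)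
      (fun x => Eventually.of_forall (hu.abs_jump_le x)) (L.integrable_min.const_mul _)
      (Eventually.of_forall fun z => ?_)
    unfold jump
    refine Continuous.sub (by fun_prop) ?_
    by_cases hz : z ∈ Metric.ball (0 : Rd d) 1
    · simp_rw [indicator_of_mem hz]; fun_prop
    · simp_rw [indicator_of_notMem hz]; fun_prop
  have : L.op u = _ := funext (L.op_eq u)
  rw [this]
  fun_prop

lemma abs_op_le (L : LevyTriplet d) (x : Rd d) : |L.op u x| ≤
    (‖L.B‖ + (∑ i, ∑ j, |L.A i j|) + 2 * ∫ z, min 1 (‖z‖ ^ 2) ∂L.ν) * (M₀ + M₁ + M₂) := by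
  have h0 := hu.nonneg₀
  have h1 := hu.nonneg₁
  have h2 := hu.nonneg₂
  have e1 : |fderiv ℝ u x L.B| ≤ ‖L.B‖ * (M₀ + M₁ + M₂) := by
    refine ((fderiv ℝ u x).le_opNorm L.B).trans ?_
    rw [mul_comm]
    gcongr
    linarith [hu.bound₁ x]
  have e2 : |∑ i, ∑ j, L.A i j * fderiv ℝ (fderiv ℝ u) x (EuclideanSpace.single i 1)
        (EuclideanSpace.single j 1)| ≤ (∑ i, ∑ j, |L.A i j|) * (M₀ + M₁ + M₂) := by
    rw [Finset.sum_mul]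
    refine (Finset.abs_sum_le_sum_abs _ _).trans (Finset.sum_le_sum fun i _ => ?_)
    rw [Finset.sum_mul]
    refine (Finset.abs_sum_le_sum_abs _ _).trans (Finset.sum_le_sum fun j _ => ?_)
    rw [abs_mul]
    gcongr
    have := (fderiv ℝ (fderiv ℝ u) x).le_opNorm₂ (EuclideanSpace.single i 1)
      (EuclideanSpace.single j 1)
    simp only [PiLp.norm_single, norm_one, mul_one] at this
    exact this.trans (by linarith [hu.bound₂ x])
  have e3 : |∫ z, jump u x z ∂L.ν| ≤ (2 * ∫ z, min 1 (‖z‖ ^ 2) ∂L.ν) * (M₀ + M₁ + M₂) := by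
    have : |∫ z, jump u x z ∂L.ν| ≤ ∫ z, (2 * M₀ + M₂) * min 1 (‖z‖ ^ 2) ∂L.ν :=
      norm_integral_le_of_norm_le (f := jump u x) (L.integrable_min.const_mul _)
        (Eventually.of_forall (hu.abs_jump_le x))
    rw [integral_const_mul] at this
    have hI : 0 ≤ ∫ z, min 1 (‖z‖ ^ 2) ∂L.ν := integral_nonneg fun z => by positivity
    nlinarith
  rw [L.op_eq]
  calc _ ≤ _ := abs_add_three _ _ _
    _ ≤ _ := add_le_add_three e1 e2 e3
    _ = _ := by ring

end CB2

lemma tendsto_clm_apply {ι E F : Type*} [NormedAddCommGroup E] [NormedSpace ℝ E]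
    [NormedAddCommGroup F] [NormedSpace ℝ F] {l : Filter ι} {f : ι → E →L[ℝ] F} {g : E →L[ℝ] F}
    (h : Tendsto f l (𝓝 g)) (v : E) : Tendsto (fun n => f n v) l (𝓝 (g v)) :=
  ((ContinuousLinearMap.apply ℝ F v).continuous.tendsto g).comp h

/-- Pointwise convergence of the first two derivatives, with uniform bounds, implies convergence
of the Lévy operator. -/
lemma LevyTriplet.tendsto_op (L : LevyTriplet d) {ι : Type*} {l : Filter ι}
    [l.IsCountablyGenerated] {u : ι → Rd d → ℝ} {v : Rd d → ℝ} {M₀ M₁ M₂ : ℝ}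
    (hu : ∀ n, CB2 (u n) M₀ M₁ M₂) (x : Rd d) (h0 : ∀ y, Tendsto (fun n => u n y) l (𝓝 (v y)))
    (h1 : Tendsto (fun n => fderiv ℝ (u n) x) l (𝓝 (fderiv ℝ v x)))
    (h2 : Tendsto (fun n => fderiv ℝ (fderiv ℝ (u n)) x) l (𝓝 (fderiv ℝ (fderiv ℝ v) x))) :
    Tendsto (fun n => L.op (u n) x) l (𝓝 (L.op v x)) := by
  simp_rw [L.op_eq]
  refine ((tendsto_clm_apply h1 _).add (tendsto_finsetSum _ fun i _ =>
    tendsto_finsetSum _ fun j _ => (tendsto_clm_apply (tendsto_clm_apply h2 _) _).const_mul _)).add ?_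
  refine tendsto_integral_filter_of_dominated_convergence
    (fun z => (2 * M₀ + M₂) * min 1 (‖z‖ ^ 2))
    (Eventually.of_forall fun n =>
      (measurable_jump (u n) (hu n).continuous x).aestronglyMeasurable)
    (Eventually.of_forall fun n => Eventually.of_forall ((hu n).abs_jump_le x))
    (L.integrable_min.const_mul _) (Eventually.of_forall fun z => ?_)
  refine ((h0 _).sub (h0 _)).sub ?_
  by_cases hz : z ∈ Metric.ball (0 : Rd d) 1
  · simp_rw [indicator_of_mem hz]
    exact tendsto_clm_apply h1 z
  · simp_rw [indicator_of_notMem hz]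
    exact tendsto_const_nhds

end

/-! ### The mild equation in Fourier variables, its dual form, and the smoothing of the heat
semigroup. -/

section
/-! ### Random motions driven by a Lévy noise and a drift -/

variable {d : ℕ} {Ω : Type*} [MeasurableSpace Ω]

/-- The characteristic function of the law of `X s`, weighted with the velocity `V s`. -/
def driftTerm (π : ℝ → Measure Ω) (X V : ℝ → Ω → Rd d) (s : ℝ) (ξ : Rd d) : ℂ :=
  ∫ w, wave (X s w) ξ * ((inner ℝ (V s w) ξ : ℝ) : ℂ) ∂π s

/-- The laws of `X t` solve, on `[0, τ]` and on the Fourier side, the mild form of the equation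
`dX = -V dt + dZ` where `Z` is the Lévy process of `L`. -/
structure IsDriven (L : LevyTriplet d) (τ : ℝ) (m₀ : Measure (Rd d)) (π : ℝ → Measure Ω)
    (X V : ℝ → Ω → Rd d) (M : ℝ) : Prop where
  prob : ∀ s, IsProbabilityMeasure (π s)
  measX : ∀ s, Measurable (X s)
  measV : ∀ s, Measurable (V s)
  boundV : ∀ s w, ‖V s w‖ ≤ M
  measurable_driftTerm : ∀ ξ, Measurable fun s => driftTerm π X V s ξ
  eq : ∀ t ∈ Icc 0 τ, ∀ ξ, Complex.exp (t * L.symbol ξ) * ∫ w, wave (X t w) ξ ∂π t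
    = charFun m₀ ξ
      - ∫ s in Ioo 0 t, Complex.exp (s * L.symbol ξ) * (Complex.I * driftTerm π X V s ξ)

lemma norm_exp_neg_mul_le {z : ℂ} (hz : 0 ≤ z.re) {r : ℝ} (hr : 0 ≤ r) :
    ‖Complex.exp (-(r : ℂ) * z)‖ ≤ 1 := by
  rw [Complex.norm_exp]
  simp only [neg_mul, Complex.neg_re, Complex.re_ofReal_mul]
  exact Real.exp_le_one_iff.2 (by nlinarith)

lemma norm_exp_mul_le {z : ℂ} {r R : ℝ} (hr : 0 ≤ r) (hR : r ≤ R) :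
    ‖Complex.exp ((r : ℂ) * z)‖ ≤ Real.exp (R * ‖z‖) := by
  rw [Complex.norm_exp, Complex.re_ofReal_mul]
  refine Real.exp_le_exp.2 ?_
  calc r * z.re ≤ r * ‖z‖ := by gcongr; exact Complex.re_le_norm z
    _ ≤ _ := by gcongr

lemma IsAmplitude.mul {μ : Measure (Rd d)} {g : Rd d → ℂ} (hg : IsAmplitude μ g)
    {h : Rd d → ℂ} (hm : AEStronglyMeasurable h μ) (hb : ∀ ξ, ‖h ξ‖ ≤ 1) :
    IsAmplitude μ fun ξ => h ξ * g ξ := by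
  have hm' := hg.meas
  refine ⟨hm.mul hm', hg.integrable_of_norm_le (by fun_prop) (C := 1) fun ξ => ?_⟩
  rw [Real.norm_of_nonneg (by positivity), one_mul, norm_mul]
  gcongr
  exact mul_le_of_le_one_left (norm_nonneg _) (hb ξ)

/-- The amplitude of the heat semigroup applied to a superposition of plane waves. -/
def heatAmp (L : LevyTriplet d) (g : Rd d → ℂ) (r : ℝ) (ξ : Rd d) : ℂ :=
  Complex.exp (-(r : ℂ) * L.symbol ξ) * g ξ

lemma IsAmplitude.heatAmp {L : LevyTriplet d} (hL : ∀ ξ, 0 ≤ (L.symbol ξ).re)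
    {μ : Measure (Rd d)} {g : Rd d → ℂ} (hg : IsAmplitude μ g) {r : ℝ} (hr : 0 ≤ r) :
    IsAmplitude μ (heatAmp L g r) :=
  hg.mul (by have := L.measurable_symbol; fun_prop) fun ξ => norm_exp_neg_mul_le (hL ξ) hr

namespace IsDriven

variable {L : LevyTriplet d} {τ : ℝ} {m₀ : Measure (Rd d)} {π : ℝ → Measure Ω}
  {X V : ℝ → Ω → Rd d} {M : ℝ} (h : IsDriven L τ m₀ π X V M)
include h

lemma nonneg : 0 ≤ M := by
  have := h.prob 0
  obtain ⟨w⟩ := nonempty_of_isProbabilityMeasure (π 0)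
  exact (norm_nonneg _).trans (h.boundV 0 w)

lemma norm_integrand_le (s : ℝ) (w : Ω) (ξ : Rd d) :
    ‖wave (X s w) ξ * ((inner ℝ (V s w) ξ : ℝ) : ℂ)‖ ≤ M * ‖ξ‖ := by
  rw [norm_mul, norm_wave, one_mul, Complex.norm_real]
  refine (norm_inner_le_norm _ _).trans ?_
  gcongr
  exact h.boundV s w

lemma measurable_integrand (s : ℝ) : Measurable fun p : Ω × Rd d =>
    wave (X s p.1) p.2 * ((inner ℝ (V s p.1) p.2 : ℝ) : ℂ) := by
  have := h.measX s
  have := h.measV s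
  fun_prop

lemma norm_driftTerm_le (s : ℝ) (ξ : Rd d) : ‖driftTerm π X V s ξ‖ ≤ M * ‖ξ‖ := by
  have := h.prob s
  refine (norm_integral_le_of_norm_le_const
    (Eventually.of_forall fun w => h.norm_integrand_le s w ξ)).trans_eq ?_
  simp

lemma continuous_driftTerm (s : ℝ) : Continuous (driftTerm π X V s) := by
  have := h.prob s
  rw [continuous_iff_continuousAt]
  intro ξ₀
  refine continuousAt_of_dominated (bound := fun _ => M * (‖ξ₀‖ + 1))
    (Eventually.of_forall fun ξ =>
      ((h.measurable_integrand s).comp measurable_prodMk_right).aestronglyMeasurable) ?_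
    (integrable_const _) (Eventually.of_forall fun w => by fun_prop)
  filter_upwards [Metric.ball_mem_nhds ξ₀ one_pos] with ξ hξ
  refine Eventually.of_forall fun w => (h.norm_integrand_le s w ξ).trans ?_
  have := h.nonneg
  gcongr
  have : ‖ξ - ξ₀‖ < 1 := by simpa [dist_eq_norm] using hξ
  linarith [norm_sub_norm_le ξ ξ₀]

lemma measurable_driftTerm_uncurry :
    Measurable fun p : ℝ × Rd d => driftTerm π X V p.1 p.2 := by
  have := stronglyMeasurable_uncurry_of_continuous_of_stronglyMeasurable
    (u := fun (ξ : Rd d) (s : ℝ) => driftTerm π X V s ξ) h.continuous_driftTerm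
    (fun ξ => (h.measurable_driftTerm ξ).stronglyMeasurable)
  exact this.measurable.comp measurable_swap

/-- Duality between a driven motion and the heat semigroup. -/
theorem integral_synth (hL : ∀ ξ, 0 ≤ (L.symbol ξ).re) [IsProbabilityMeasure m₀] {g : Rd d → ℂ}
    (hg : IsAmplitude volume g) {t : ℝ} (ht : t ∈ Icc 0 τ) :
    ∃ f : ℝ → ℝ, IntegrableOn f (Ioo 0 t) ∧
      ∫ w, (synth volume g (X t w)).re ∂π t
        = (∫ ξ, heatAmp L g t ξ * charFun m₀ ξ).re - ∫ s in Ioo 0 t, f s ∧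
      ∀ s ∈ Ioo 0 t, f s = ∫ w, fderiv ℝ (fun x => (synth volume (heatAmp L g (t - s)) x).re)
        (X s w) (V s w) ∂π s := by
  have hΨ := L.measurable_symbol
  have hgm := hg.meas
  have hM := h.nonneg
  have hprob := h.prob
  have hXm := h.measX
  -- This is the Duhamel integrand in time and frequency; its integral over ξ will be the pairing of
  -- the velocity with the gradient of the heat flow at time t - s.
  set F : ℝ → Rd d → ℂ := fun s ξ => heatAmp L g (t - s) ξ * (Complex.I * driftTerm π X V s ξ)
  have hFi : Integrable (Function.uncurry F) ((volume.restrict (Ioo 0 t)).prod volume) := by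
    have h1 : Integrable (fun p : ℝ × Rd d => M * (‖p.2‖ * ‖g p.2‖))
        ((volume.restrict (Ioo 0 t)).prod volume) :=
      (hg.integrable_norm_mul.const_mul M).comp_snd _
    refine h1.mono' ?_ ?_
    · have h2 : AEStronglyMeasurable (fun p : ℝ × Rd d => g p.2)
          ((volume.restrict (Ioo 0 t)).prod volume) := hgm.comp_snd
      have h3 := h.measurable_driftTerm_uncurry
      simp only [F, heatAmp, Function.uncurry_def]
      have h4 : Measurable fun p : ℝ × Rd d =>
          Complex.exp (-((t - p.1 : ℝ) : ℂ) * L.symbol p.2) := by fun_prop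
      exact (h4.aestronglyMeasurable.mul h2).mul (h3.const_mul _).aestronglyMeasurable
    · have : ∀ᵐ p ∂((volume.restrict (Ioo 0 t)).prod (volume : Measure (Rd d))),
          p.1 ∈ Ioo 0 t := Measure.quasiMeasurePreserving_fst.ae
            (ae_restrict_mem measurableSet_Ioo)
      filter_upwards [this] with p hp
      simp only [F, heatAmp, Function.uncurry_def, norm_mul, Complex.norm_I, one_mul]
      have h5 := norm_exp_neg_mul_le (hL p.2) (r := t - p.1) (by linarith [hp.2])
      calc _ ≤ 1 * ‖g p.2‖ * (M * ‖p.2‖) := by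
            gcongr; exact h.norm_driftTerm_le _ _
        _ = _ := by ring
  refine ⟨fun s => (∫ ξ, F s ξ).re, hFi.integral_prod_left.re, ?_, ?_⟩
  · have e1 : ∫ w, synth volume g (X t w) ∂π t = ∫ ξ, (∫ w, wave (X t w) ξ ∂π t) * g ξ := by
      have hi : Integrable (fun p : Ω × Rd d => wave (X t p.1) p.2 * g p.2)
          ((π t).prod volume) := by
        refine (hg.integrable.norm.comp_snd (π t)).mono' ?_ (Eventually.of_forall fun p => ?_)
        · have h2 : AEStronglyMeasurable (fun p : Ω × Rd d => g p.2)
            ((π t).prod volume) := hgm.comp_snd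
          exact (by fun_prop : Measurable fun p : Ω × Rd d =>
            wave (X t p.1) p.2).aestronglyMeasurable.mul h2
        · rw [norm_mul, norm_wave, one_mul]
      simp only [synth, smul_eq_mul]
      rw [integral_integral_swap (f := fun w ξ => wave (X t w) ξ * g ξ) hi]
      simp_rw [integral_mul_const]
    -- Multiplying the Fourier equation by exp(-tΨ) g turns the growing weights exp(sΨ) into
    -- exp(-(t-s)Ψ), of modulus at most one.
    have e2 : ∀ ξ, (∫ w, wave (X t w) ξ ∂π t) * g ξ
        = heatAmp L g t ξ * charFun m₀ ξ - ∫ s in Ioo 0 t, F s ξ := by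
      intro ξ
      have h1 := h.eq t ht ξ
      have h2 : Complex.exp (-(t : ℂ) * L.symbol ξ) * Complex.exp (t * L.symbol ξ) = 1 := by
        rw [← Complex.exp_add]; simp
      have h3 : ∫ s in Ioo 0 t, F s ξ = Complex.exp (-(t : ℂ) * L.symbol ξ) * g ξ *
          ∫ s in Ioo 0 t, Complex.exp (s * L.symbol ξ) * (Complex.I * driftTerm π X V s ξ) := by
        rw [← integral_const_mul]
        congr 1; ext s
        simp only [F, heatAmp]
        rw [show -((t - s : ℝ) : ℂ) * L.symbol ξ = -(t : ℂ) * L.symbol ξ + s * L.symbol ξ by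
          push_cast; ring, Complex.exp_add]
        ring
      rw [h3, heatAmp]
      linear_combination (Complex.exp (-(t : ℂ) * L.symbol ξ) * g ξ) * h1
        - (∫ w, wave (X t w) ξ ∂π t) * g ξ * h2
    have i1 : Integrable (fun ξ => heatAmp L g t ξ * charFun m₀ ξ) := by
      refine (hg.heatAmp hL ht.1).integrable.norm.mono'
        ((hg.heatAmp hL ht.1).meas.mul (by fun_prop)) (Eventually.of_forall fun ξ => ?_)
      rw [norm_mul]
      exact mul_le_of_le_one_right (norm_nonneg _) (norm_charFun_le_one ξ)
    have i2 : Integrable (fun w => synth volume g (X t w)) (π t) := by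
      refine Integrable.of_bound (C := ∫ ξ, ‖g ξ‖) ?_
        (Eventually.of_forall fun w => norm_synth_le _ _)
      exact ((continuous_synth hg.integrable).measurable.comp (hXm t)).aestronglyMeasurable
    have e3 : ∫ w, (synth volume g (X t w)).re ∂π t
        = (∫ w, synth volume g (X t w) ∂π t).re := integral_re i2
    have e4 : ∫ s in Ioo 0 t, (∫ ξ, F s ξ).re = (∫ s in Ioo 0 t, ∫ ξ, F s ξ).re :=
      integral_re hFi.integral_prod_left
    rw [e3, e1, e4, ← Complex.sub_re]
    simp_rw [e2]
    have i3 : Integrable (fun ξ => ∫ s in Ioo 0 t, F s ξ) := hFi.integral_prod_right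
    rw [integral_sub i1 i3, integral_integral_swap hFi]
  · intro s hs
    have hr : 0 ≤ t - s := by linarith [hs.2]
    have ha := hg.heatAmp hL hr
    have ham := ha.meas
    have hi : Integrable (fun p : Rd d × Ω => heatAmp L g (t - s) p.1 *
        (Complex.I * (wave (X s p.2) p.1 * ((inner ℝ (V s p.2) p.1 : ℝ) : ℂ))))
        (volume.prod (π s)) := by
      refine ((ha.integrable_norm_mul.const_mul M).comp_fst (π s)).mono' ?_
        (Eventually.of_forall fun p => ?_)
      · have h2 : AEStronglyMeasurable (fun p : Rd d × Ω => heatAmp L g (t - s) p.1)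
            (volume.prod (π s)) := ham.comp_fst
        exact h2.mul (((h.measurable_integrand s).comp measurable_swap).const_mul
          Complex.I).aestronglyMeasurable
      · rw [norm_mul, norm_mul, Complex.norm_I, one_mul]
        calc _ ≤ ‖heatAmp L g (t - s) p.1‖ * (M * ‖p.1‖) := by
              gcongr; exact h.norm_integrand_le _ _ _
          _ = _ := by ring
    have e1 : ∫ ξ, F s ξ = ∫ w, (∫ ξ, heatAmp L g (t - s) ξ *
        (Complex.I * (wave (X s w) ξ * ((inner ℝ (V s w) ξ : ℝ) : ℂ)))) ∂π s := by
      rw [← integral_integral_swap (f := fun ξ w => heatAmp L g (t - s) ξ *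
        (Complex.I * (wave (X s w) ξ * ((inner ℝ (V s w) ξ : ℝ) : ℂ)))) hi]
      congr 1; ext ξ
      simp only [F, driftTerm]
      rw [integral_const_mul, integral_const_mul]
    have e2 := (integral_re (μ := π s) hi.integral_prod_right).symm
    simp only
    rw [e1]
    refine e2.trans ?_
    congr 1; ext w
    rw [ha.fderiv_re_apply]
    simp only [RCLike.re_to_complex]
    congr 2; ext ξ
    rw [real_inner_comm ξ]
    ring

end IsDriven

end

section
/-! ### The gradient bound for the heat semigroup -/

variable {d : ℕ}

/-- The increment is the integral of Df along the segment; Tonelli and translation invariance do the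
rest. -/
lemma lintegral_enorm_add_sub_le {f : Rd d → ℝ} (hf : ContDiff ℝ 1 f) (v : Rd d) :
    ∫⁻ x, ‖f (x + v) - f x‖ₑ ≤ (∫⁻ x, ‖fderiv ℝ f x‖ₑ) * ‖v‖ₑ := by
  have hc : Continuous (fderiv ℝ f) := hf.continuous_fderiv one_ne_zero
  have hd : Differentiable ℝ f := hf.differentiable one_ne_zero
  have h1 : ∀ x, ‖f (x + v) - f x‖ₑ ≤ ∫⁻ r in Ioc (0 : ℝ) 1, ‖fderiv ℝ f (x + r • v)‖ₑ * ‖v‖ₑ := by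
    intro x
    have hder : ∀ r : ℝ, HasDerivAt (fun r : ℝ => f (x + r • v)) (fderiv ℝ f (x + r • v) v) r := by
      intro r
      have h2 : HasDerivAt (fun r : ℝ => x + r • v) v r := by
        simpa using ((hasDerivAt_id r).smul_const v).const_add x
      exact (hd (x + r • v)).hasFDerivAt.comp_hasDerivAt r h2
    have e1 := intervalIntegral.integral_eq_sub_of_hasDerivAt (a := 0) (b := 1)
      (fun r _ => hder r) ((by fun_prop : Continuous fun r : ℝ =>
        fderiv ℝ f (x + r • v) v).intervalIntegrable _ _)
    simp only [one_smul, zero_smul, add_zero] at e1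
    rw [← e1, intervalIntegral.integral_of_le zero_le_one]
    refine (enorm_integral_le_lintegral_enorm _).trans (lintegral_mono fun r => ?_)
    exact ContinuousLinearMap.le_opENorm _ _
  have hm : Measurable fun p : Rd d × ℝ => ‖fderiv ℝ f (p.1 + p.2 • v)‖ₑ * ‖v‖ₑ := by
    have : Continuous fun p : Rd d × ℝ => fderiv ℝ f (p.1 + p.2 • v) := by fun_prop
    exact this.enorm.measurable.mul_const _
  calc _ ≤ ∫⁻ x, ∫⁻ r in Ioc (0 : ℝ) 1, ‖fderiv ℝ f (x + r • v)‖ₑ * ‖v‖ₑ := lintegral_mono h1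
    _ = ∫⁻ r in Ioc (0 : ℝ) 1, ∫⁻ x, ‖fderiv ℝ f (x + r • v)‖ₑ * ‖v‖ₑ :=
        lintegral_lintegral_swap hm.aemeasurable
    _ = ∫⁻ r in Ioc (0 : ℝ) 1, (∫⁻ x, ‖fderiv ℝ f x‖ₑ) * ‖v‖ₑ := by
        congr 1; ext r
        rw [lintegral_mul_const _ (by
          have : Continuous fun x : Rd d => fderiv ℝ f (x + r • v) := by fun_prop
          exact this.enorm.measurable)]
        rw [lintegral_add_right_eq_self (fun x => ‖fderiv ℝ f x‖ₑ) (r • v)]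
    _ = _ := by simp

namespace LevyTriplet

variable {L : LevyTriplet d} {K : ℝ → Rd d → ℝ} (hK : L.IsSmoothHeatKernel K)
include hK

lemma IsSmoothHeatKernel.integral_wave_neg {t : ℝ} (ht : 0 < t) (ξ : Rd d) :
    ∫ x, wave (-x) ξ * (K t x : ℂ) = Complex.exp (-(t : ℂ) * L.symbol ξ) := by
  rw [← hK.fourier t ht ξ]
  congr 1; ext x
  rw [wave]
  congr 2
  rw [inner_neg_left]
  push_cast
  ring

/-- At time 1, exp(-Ψ) is the Fourier transform of a probability density, hence of modulus at most
one. -/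
lemma IsSmoothHeatKernel.symbol_re_nonneg (ξ : Rd d) : 0 ≤ (L.symbol ξ).re := by
  have h1 : ‖Complex.exp (-((1 : ℝ) : ℂ) * L.symbol ξ)‖ ≤ 1 := by
    rw [← hK.integral_wave_neg one_pos]
    refine (norm_integral_le_integral_norm _).trans_eq ?_
    refine Eq.trans ?_ (hK.integral_eq_one 1 one_pos)
    congr 1; ext x
    rw [norm_mul, norm_wave, one_mul, Complex.norm_real,
      Real.norm_of_nonneg (hK.nonneg 1 one_pos x)]
  rw [Complex.norm_exp, Real.exp_le_one_iff] at h1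
  simpa using h1

/-- The semigroup defined by the multiplier exp(-tΨ) is convolution with K(t,·). This makes the L¹
bounds on the kernel usable. -/
lemma IsSmoothHeatKernel.synth_heatAmp {g : Rd d → ℂ} (hg : IsAmplitude volume g) {t : ℝ}
    (ht : 0 < t) (x : Rd d) : (synth volume (heatAmp L g t) x).re
      = ∫ y, K t (x - y) * (synth volume g y).re := by
  have hi : Integrable (fun p : Rd d × Rd d => wave (x - p.1) p.2 * g p.2 * (K t p.1 : ℂ))
      (volume.prod volume) := by
    have h1 := (hK.integrable t ht).norm.mul_prod hg.integrable.norm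
    have h2 : AEStronglyMeasurable (fun p : Rd d × Rd d => g p.2)
        (volume.prod volume) := hg.meas.comp_snd
    have h3 : Measurable fun p : Rd d × Rd d => (K t p.1 : ℂ) :=
      (Complex.measurable_ofReal.comp (hK.smooth t ht).continuous.measurable).comp measurable_fst
    refine h1.mono' (((by fun_prop : Measurable fun p : Rd d × Rd d =>
      wave (x - p.1) p.2).aestronglyMeasurable.mul h2).mul h3.aestronglyMeasurable)
      (Eventually.of_forall fun p => ?_)
    rw [norm_mul, norm_mul, norm_wave, one_mul, Complex.norm_real, mul_comm]
  have e1 : synth volume (heatAmp L g t) x = ∫ y, (K t y : ℂ) * synth volume g (x - y) := by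
    calc _ = ∫ ξ, ∫ y, wave (x - y) ξ * g ξ * (K t y : ℂ) := by
          simp only [synth, heatAmp, smul_eq_mul]
          congr 1; ext ξ
          rw [← hK.integral_wave_neg ht, ← integral_mul_const, ← integral_const_mul]
          congr 1; ext y
          rw [sub_eq_add_neg, wave_add]
          ring
      _ = ∫ y, ∫ ξ, wave (x - y) ξ * g ξ * (K t y : ℂ) :=
          (integral_integral_swap (f := fun y ξ => wave (x - y) ξ * g ξ * (K t y : ℂ)) hi).symm
      _ = _ := by
          congr 1; ext y
          rw [integral_mul_const, mul_comm]
          simp [synth]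
  have hi2 : Integrable fun y => (K t y : ℂ) * synth volume g (x - y) := by
    refine hi.integral_prod_left.congr (Eventually.of_forall fun y => ?_)
    simp only
    rw [integral_mul_const, mul_comm]
    simp [synth]
  have e2 : (∫ y, (K t y : ℂ) * synth volume g (x - y)).re
      = ∫ y, ((K t y : ℂ) * synth volume g (x - y)).re := (integral_re hi2).symm
  rw [e1, e2]
  simp_rw [Complex.re_ofReal_mul]
  rw [← integral_sub_left_eq_self (fun y => K t (x - y) * (synth volume g y).re) volume x]
  simp

/-- The gradient bound for the heat semigroup, from the `L¹` bound of the gradient of the kernel. -/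
lemma IsSmoothHeatKernel.norm_fderiv_le {g : Rd d → ℂ} (hg : IsAmplitude volume g) {t C N : ℝ}
    (ht : 0 < t) (hC : 0 ≤ C) (hKt : ∫⁻ x, ‖fderiv ℝ (K t) x‖ₑ ≤ ENNReal.ofReal C)
    (hN : ∀ x, |(synth volume g x).re| ≤ N) (x : Rd d) :
    ‖fderiv ℝ (fun x => (synth volume (heatAmp L g t) x).re) x‖ ≤ N * C := by
  have hN0 : 0 ≤ N := (abs_nonneg _).trans (hN 0)
  have hKi := hK.integrable t ht
  refine norm_fderiv_le_of_lip' ℝ (by positivity) (Eventually.of_forall fun x' => ?_)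
  obtain ⟨v, rfl⟩ : ∃ v, x' = x + v := ⟨x' - x, by abel⟩
  rw [add_sub_cancel_left, hK.synth_heatAmp hg ht, hK.synth_heatAmp hg ht]
  have hψ : Continuous fun x => (synth volume g x).re :=
    Complex.continuous_re.comp (continuous_synth hg.integrable)
  have hi : ∀ x, Integrable fun y => K t (x - y) * (synth volume g y).re := fun x =>
    (hKi.comp_sub_left x).mul_bdd (c := N) hψ.aestronglyMeasurable (Eventually.of_forall hN)
  rw [← integral_sub (hi _) (hi _)]
  have hi3 : Integrable fun y => N * ‖K t (x + v - y) - K t (x - y)‖ :=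
    (((hKi.comp_sub_left (x + v)).sub (hKi.comp_sub_left x)).norm).const_mul N
  -- The translation falls on the kernel, so the datum enters only through its sup bound N.
  calc _ ≤ ∫ y, N * ‖K t (x + v - y) - K t (x - y)‖ := by
        refine norm_integral_le_of_norm_le hi3 (Eventually.of_forall fun y => ?_)
        rw [← sub_mul, norm_mul, mul_comm]
        gcongr
        exact hN y
    _ = N * ∫ y, ‖K t (y + v) - K t y‖ := by
        rw [integral_const_mul, ← integral_sub_left_eq_self (fun y => ‖K t (y + v) - K t y‖)
          volume x]
        congr 2; ext y
        rw [show x + v - y = x - y + v by abel]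
    _ ≤ N * (C * ‖v‖) := by
        gcongr
        have hm : AEStronglyMeasurable (fun y => K t (y + v) - K t y) volume :=
          ((hKi.comp_add_right v).sub hKi).aestronglyMeasurable
        rw [integral_norm_eq_lintegral_enorm hm]
        refine ENNReal.toReal_le_of_le_ofReal (by positivity) ?_
        refine (lintegral_enorm_add_sub_le ((hK.smooth t ht).of_le (by simp)) v).trans ?_
        rw [ENNReal.ofReal_mul hC, ofReal_norm]
        gcongr
    _ = _ := by ring

end LevyTriplet

/-- The consequences of the assumption on the heat kernels that are used below: the symbol has
nonnegative real part, and the heat semigroup maps bounded functions to functions with gradient of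
order `r ^ (-a)`, where `a < 1`. -/
structure HasGradientBound (L : LevyTriplet d) (T a C : ℝ) : Prop where
  lt_one : a < 1
  nonneg : 0 ≤ C
  symbol_re : ∀ ξ, 0 ≤ (L.symbol ξ).re
  bound : ∀ (g : Rd d → ℂ) (N : ℝ), IsAmplitude volume g → (∀ x, |(synth volume g x).re| ≤ N) →
    ∀ r ∈ Ioc 0 T, ∀ x,
      ‖fderiv ℝ (fun x => (synth volume (heatAmp L g r) x).re) x‖ ≤ N * (C * r ^ (-a))

/-- The bound of order one gives the exponent a = 1/α, and α > 1 makes r^(-a) integrable at 0. -/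
theorem LevyTriplet.HeatKernelBounds.hasGradientBound {L : LevyTriplet d} {T : ℝ}
    (h : L.HeatKernelBounds T) : ∃ a C, HasGradientBound L T a C := by
  obtain ⟨K, K', hK, -, α, hα1, hα2, hb⟩ := h
  obtain ⟨C, hC, hCb⟩ := hb 1
  refine ⟨1 / α, C, by rw [div_lt_one] <;> linarith, hC.le, hK.symbol_re_nonneg,
    fun g N hg hN r hr x => ?_⟩
  have hr0 : 0 < r := hr.1
  refine hK.norm_fderiv_le hg hr0 (by positivity) ?_ hN x
  have := (hCb r hr).1
  have e : ∀ x, ‖iteratedFDeriv ℝ 1 (K r) x‖ₑ = ‖fderiv ℝ (K r) x‖ₑ := fun x => by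
    rw [← ofReal_norm, ← ofReal_norm, norm_iteratedFDeriv_one]
  simp_rw [e] at this
  convert this using 3
  rw [Nat.cast_one, neg_div]

end

/-! ### Approximation tools: mollifiers, cutoffs, Fourier inversion. -/

section
/-! ### Mollification -/

variable {d : ℕ} {F : Type*} [NormedAddCommGroup F] [NormedSpace ℝ F] [CompleteSpace F]

/-- The average of `f` with the weight `φ`, centred at each point. -/
def mollify (φ : ContDiffBump (0 : Rd d)) (f : Rd d → F) (x : Rd d) : F :=
  ∫ y, φ.normed volume y • f (x - y)

lemma mollify_eq_convolution (φ : ContDiffBump (0 : Rd d)) (f : Rd d → F) :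
    mollify φ f = convolution (φ.normed volume) f (ContinuousLinearMap.lsmul ℝ ℝ) volume := rfl

lemma contDiff_mollify (φ : ContDiffBump (0 : Rd d)) {f : Rd d → F} (hf : Continuous f) :
    ContDiff ℝ ∞ (mollify φ f) := by
  rw [mollify_eq_convolution]
  exact φ.hasCompactSupport_normed.contDiff_convolution_left _ φ.contDiff_normed
    hf.locallyIntegrable

lemma hasCompactSupport_mollify (φ : ContDiffBump (0 : Rd d)) {f : Rd d → F}
    (hf : HasCompactSupport f) : HasCompactSupport (mollify φ f) := by
  rw [mollify_eq_convolution]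
  exact φ.hasCompactSupport_normed.convolution _ hf

lemma integrable_mollify (φ : ContDiffBump (0 : Rd d)) {f : Rd d → F} (hf : Continuous f)
    (x : Rd d) : Integrable fun y => φ.normed volume y • f (x - y) := by
  refine Continuous.integrable_of_hasCompactSupport ?_
    (φ.hasCompactSupport_normed.smul_right)
  have := φ.contDiff_normed (n := 0) (μ := volume)
  exact this.continuous.smul (by fun_prop)

lemma norm_mollify_le (φ : ContDiffBump (0 : Rd d)) {f : Rd d → F} {M : ℝ}
    (h : ∀ x, ‖f x‖ ≤ M) (x : Rd d) : ‖mollify φ f x‖ ≤ M := by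
  refine (norm_integral_le_of_norm_le (φ.integrable_normed.mul_const M)
    (Eventually.of_forall fun y => ?_)).trans_eq ?_
  · rw [norm_smul, Real.norm_of_nonneg (φ.nonneg_normed y)]
    gcongr
    · exact φ.nonneg_normed y
    · exact h _
  · rw [integral_mul_const, φ.integral_normed, one_mul]

lemma norm_mollify_sub_le (φ : ContDiffBump (0 : Rd d)) {f : Rd d → F} {K : ℝ}
    (hf : Continuous f) (h : ∀ x y, ‖f x - f y‖ ≤ K * ‖x - y‖) (x v : Rd d) :
    ‖mollify φ f (x + v) - mollify φ f x‖ ≤ K * ‖v‖ := by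
  rw [mollify, mollify, ← integral_sub (integrable_mollify φ hf _) (integrable_mollify φ hf _)]
  simp_rw [← smul_sub]
  have := norm_mollify_le φ (f := fun y => f (y + v) - f y) (M := K * ‖v‖)
    (fun y => by simpa using h (y + v) y) x
  refine le_trans (le_of_eq ?_) this
  rw [mollify]
  congr 3; ext y
  rw [show x + v - y = x - y + v by abel]

lemma hasFDerivAt_mollify (φ : ContDiffBump (0 : Rd d)) {f : Rd d → F} (hf : ContDiff ℝ 1 f)
    {M : ℝ} (h : ∀ x, ‖fderiv ℝ f x‖ ≤ M) (x : Rd d) :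
    HasFDerivAt (mollify φ f) (mollify φ (fderiv ℝ f) x) x := by
  have hc := hf.continuous_fderiv one_ne_zero
  refine hasFDerivAt_integral_of_dominated_of_fderiv_le (s := univ)
    (bound := fun y => φ.normed volume y * M)
    (F' := fun x y => φ.normed volume y • fderiv ℝ f (x - y)) univ_mem
    (Eventually.of_forall fun z => (integrable_mollify φ hf.continuous z).aestronglyMeasurable)
    (integrable_mollify φ hf.continuous x) (integrable_mollify φ hc x).aestronglyMeasurable
    (Eventually.of_forall fun y z _ => ?_) (φ.integrable_normed.mul_const M)
    (Eventually.of_forall fun y z _ => ?_)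
  · rw [norm_smul, Real.norm_of_nonneg (φ.nonneg_normed y)]
    gcongr
    · exact φ.nonneg_normed y
    · exact h _
  · have h1 := (hf.differentiable one_ne_zero (z - y)).hasFDerivAt.comp z
      ((hasFDerivAt_id z).sub_const y)
    exact h1.const_smul _

/-- A sequence of mollifiers concentrating at the origin. -/
def bump (d n : ℕ) : ContDiffBump (0 : Rd d) :=
  ⟨1 / (2 * (n + 1)), 1 / (n + 1), by positivity, by
    have : (0 : ℝ) ≤ n := n.cast_nonneg
    rw [div_lt_div_iff₀ (by positivity) (by positivity)]; linarith⟩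

/-- The mollified function may itself change with n, as `cut n f` does. Only its values near x
matter, since the mollifiers have support shrinking to the origin. -/
lemma tendsto_mollify {f : ℕ → Rd d → F} {g : Rd d → F} (hf : ∀ n, Continuous (f n))
    (hg : Continuous g) {x : Rd d} (h : ∀ᶠ n in atTop, ∀ y ∈ Metric.ball x 1, f n y = g y) :
    Tendsto (fun n => mollify (bump d n) (f n) x) atTop (𝓝 (g x)) := by
  have := ContDiffBump.convolution_tendsto_right (μ := (volume : Measure (Rd d))) (l := atTop)
    (φ := bump d) (g := f) (k := fun _ => x) (x₀ := x) (z₀ := g x)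
    tendsto_one_div_add_atTop_nhds_zero_nat
    (Eventually.of_forall fun n => (hf n).aestronglyMeasurable) ?_ tendsto_const_nhds
  · exact this
  · have h1 : Tendsto (fun p : ℕ × Rd d => g p.2) (atTop ×ˢ 𝓝 x) (𝓝 (g x)) :=
      (hg.tendsto x).comp tendsto_snd
    refine h1.congr' ?_
    filter_upwards [h.prod_mk (Metric.ball_mem_nhds x one_pos)] with p hp
    exact (hp.1 p.2 hp.2).symm

/-! ### Cutoff -/

/-- A fixed cutoff function, equal to `1` on the unit ball. -/
def cutoff (d : ℕ) : ContDiffBump (0 : Rd d) := ⟨1, 2, one_pos, one_lt_two⟩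

/-- Multiplication by a cutoff at scale `n + 1`. -/
def cut (n : ℕ) (f : Rd d → ℝ) (x : Rd d) : ℝ := cutoff d ((n + 1 : ℝ)⁻¹ • x) * f x

lemma contDiff_cutoff_smul {k : ℕ∞} (r : ℝ) : ContDiff ℝ k fun x => cutoff d (r • x) :=
  (cutoff d).contDiff.comp (contDiff_const_smul r)

lemma continuous_cut (n : ℕ) {f : Rd d → ℝ} (hf : Continuous f) : Continuous (cut n f) :=
  (contDiff_cutoff_smul (k := 0) _).continuous.mul hf

lemma hasCompactSupport_cut (n : ℕ) (f : Rd d → ℝ) : HasCompactSupport (cut n f) := by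
  refine HasCompactSupport.mul_right ?_
  exact (cutoff d).hasCompactSupport.comp_smul (by positivity)

lemma abs_cut_le (n : ℕ) {f : Rd d → ℝ} {M : ℝ} (h : ∀ x, |f x| ≤ M) (x : Rd d) :
    |cut n f x| ≤ M := by
  rw [cut, abs_mul, abs_of_nonneg (cutoff d).nonneg]
  exact (mul_le_of_le_one_left (abs_nonneg _) (cutoff d).le_one).trans (h x)

lemma eventually_cut_eq (f : Rd d → ℝ) (x : Rd d) :
    ∀ᶠ n in atTop, ∀ y ∈ Metric.ball x 2, cut n f y = f y := by
  obtain ⟨N, hN⟩ := exists_nat_gt (‖x‖ + 2)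
  filter_upwards [eventually_ge_atTop N] with n hn y hy
  rw [cut, (cutoff d).one_of_mem_closedBall, one_mul]
  have h1 : ‖y‖ ≤ ‖x‖ + 2 := by
    have := norm_sub_norm_le y x
    rw [Metric.mem_ball, dist_eq_norm] at hy
    linarith
  have h2 : (N : ℝ) ≤ n := by exact_mod_cast hn
  simp only [cutoff, Metric.mem_closedBall, dist_zero_right, norm_smul]
  rw [Real.norm_of_nonneg (by positivity), inv_mul_le_iff₀ (by positivity)]
  linarith

lemma eventually_cut_eq' {f : Rd d → ℝ} (x : Rd d) :
    ∀ᶠ n in atTop, ∀ y ∈ Metric.ball x 1, fderiv ℝ (cut n f) y = fderiv ℝ f y ∧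
      fderiv ℝ (fderiv ℝ (cut n f)) y = fderiv ℝ (fderiv ℝ f) y := by
  filter_upwards [eventually_cut_eq f x] with n hn y hy
  have h1 : ∀ y ∈ Metric.ball x 2, cut n f =ᶠ[𝓝 y] f := fun y hy => by
    filter_upwards [Metric.isOpen_ball.mem_nhds hy] with z hz using hn z hz
  have h2 : ∀ y ∈ Metric.ball x 2, fderiv ℝ (cut n f) y = fderiv ℝ f y :=
    fun y hy => (h1 y hy).fderiv_eq
  have hy' : y ∈ Metric.ball x 2 := Metric.ball_subset_ball one_le_two hy
  refine ⟨h2 y hy', Filter.EventuallyEq.fderiv_eq ?_⟩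
  filter_upwards [Metric.isOpen_ball.mem_nhds hy'] with z hz using h2 z hz

lemma fderiv_comp_const_smul {χ : Rd d → ℝ} (r : ℝ) :
    fderiv ℝ (fun x => χ (r • x)) = fun x => r • fderiv ℝ χ (r • x) := by
  ext1 x; exact fderiv_comp_smul r

lemma fderiv_fderiv_comp_const_smul {χ : Rd d → ℝ} (hχ : ContDiff ℝ 2 χ) (r : ℝ) :
    fderiv ℝ (fderiv ℝ fun x => χ (r • x)) = fun x => (r * r) • fderiv ℝ (fderiv ℝ χ) (r • x) := by
  have hχ' : ContDiff ℝ 1 (fderiv ℝ χ) := hχ.fderiv_right (by norm_num)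
  rw [fderiv_comp_const_smul]
  ext1 x
  have h1 : DifferentiableAt ℝ (fun x : Rd d => fderiv ℝ χ (r • x)) x :=
    (hχ'.differentiable one_ne_zero).differentiableAt.comp x (differentiableAt_id.const_smul r)
  have h2 : fderiv ℝ (fun x : Rd d => fderiv ℝ χ (r • x)) x
      = r • fderiv ℝ (fderiv ℝ χ) (r • x) := fderiv_comp_smul r
  rw [fderiv_fun_const_smul h1, h2, smul_smul]

lemma exists_norm_fderiv_le {G : Type*} [NormedAddCommGroup G] [NormedSpace ℝ G] {f : Rd d → G}
    (hf : ContDiff ℝ 1 f) (hs : HasCompactSupport f) : ∃ C, 0 ≤ C ∧ ∀ x, ‖fderiv ℝ f x‖ ≤ C := by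
  obtain ⟨C, hC⟩ := (hs.fderiv ℝ).norm.exists_bound_of_continuous
    (hf.continuous_fderiv one_ne_zero).norm
  refine ⟨C, (norm_nonneg _).trans (hC 0), fun x => ?_⟩
  simpa using hC x

/-- Each derivative of the rescaled cutoff gains a factor r ≤ 1, so the bounds are uniform over all
cutoff scales. -/
lemma exists_norm_fderiv_scale_le {χ : Rd d → ℝ} (hχ : ContDiff ℝ 2 χ) (hs : HasCompactSupport χ) :
    ∃ C, 0 ≤ C ∧ ∀ r : ℝ, 0 ≤ r → r ≤ 1 → ∀ x : Rd d,
    ‖fderiv ℝ (fun x => χ (r • x)) x‖ ≤ C ∧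
    ‖fderiv ℝ (fderiv ℝ (fun x => χ (r • x))) x‖ ≤ C := by
  have hχ' : ContDiff ℝ 1 (fderiv ℝ χ) := hχ.fderiv_right (by norm_num)
  obtain ⟨C₁, h01, h1⟩ := exists_norm_fderiv_le (hχ.of_le (by norm_num)) hs
  obtain ⟨C₂, h02, h2⟩ := exists_norm_fderiv_le hχ' (hs.fderiv ℝ)
  refine ⟨C₁ + C₂, by positivity, fun r hr0 hr1 x => ?_⟩
  rw [fderiv_fderiv_comp_const_smul hχ, fderiv_comp_const_smul]
  have e1 : ‖r • fderiv ℝ χ (r • x)‖ = r * ‖fderiv ℝ χ (r • x)‖ := by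
    rw [norm_smul, Real.norm_of_nonneg hr0]
  have e2 : ‖(r * r) • fderiv ℝ (fderiv ℝ χ) (r • x)‖
      ≤ (r * r) * ‖fderiv ℝ (fderiv ℝ χ) (r • x)‖ := by
    refine (ContinuousLinearMap.opNorm_smul_le _ _).trans_eq ?_
    rw [Real.norm_of_nonneg (by positivity)]
  have a1 := h1 (r • x)
  have a2 := h2 (r • x)
  constructor
  · refine e1.le.trans ?_
    nlinarith
  · refine e2.trans ?_
    have : r * r ≤ 1 := mul_le_one₀ hr1 hr0 hr1
    nlinarith [mul_nonneg hr0 hr0]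

end

section
/-! ### Approximation by smooth functions with compact support -/

variable {d : ℕ}

open scoped FourierTransform in
-- Fourier inversion for the Schwartz function ψ; the rapid decay of its transform absorbs the
-- weight 1 + |ξ|².
lemma exists_isAmplitude {ψ : Rd d → ℝ} (h1 : ContDiff ℝ ∞ ψ) (h2 : HasCompactSupport ψ) :
    ∃ g : Rd d → ℂ, IsAmplitude volume g ∧ ∀ x, (synth volume g x).re = ψ x := by
  have h3 : HasCompactSupport fun x => (ψ x : ℂ) := h2.comp_left (g := Complex.ofReal) rfl
  have h4 : ContDiff ℝ ∞ fun x => (ψ x : ℂ) := Complex.ofRealCLM.contDiff.comp h1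
  set f : SchwartzMap (Rd d) ℂ := h3.toSchwartzMap h4
  have hpi : (2 * Real.pi)⁻¹ ≠ 0 := by positivity
  -- The Jacobian of the change of frequency η = ξ/2π between the conventions exp(2πi⟨x,η⟩) and
  -- exp(i⟨x,ξ⟩).
  set c : ℝ := |((2 * Real.pi)⁻¹ ^ Module.finrank ℝ (Rd d))⁻¹|
  have hc : c ≠ 0 := by positivity
  have hF := (𝓕 f).continuous
  refine ⟨fun ξ => (c : ℂ)⁻¹ * (𝓕 f) ((2 * Real.pi)⁻¹ • ξ), ⟨by fun_prop, ?_⟩, fun x => ?_⟩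
  · have i1 : Integrable (fun η : Rd d => c⁻¹ * (1 * (‖η‖ ^ 0 * ‖(𝓕 f) η‖)
        + (2 * Real.pi) ^ 2 * (‖η‖ ^ 2 * ‖(𝓕 f) η‖))) :=
      ((((𝓕 f).integrable_pow_mul volume 0).const_mul _).add
        (((𝓕 f).integrable_pow_mul volume 2).const_mul _)).const_mul _
    refine (i1.comp_smul hpi).congr (Eventually.of_forall fun ξ => ?_)
    have hc' : ‖(c : ℂ)⁻¹‖ = c⁻¹ := by
      rw [norm_inv, Complex.norm_real, Real.norm_of_nonneg (abs_nonneg _)]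
    simp only [norm_smul, norm_mul, hc', norm_inv, pow_zero, Real.norm_of_nonneg Real.pi_pos.le,
      Real.norm_ofNat]
    field_simp
  · have e1 : synth volume (fun ξ => (c : ℂ)⁻¹ * (𝓕 f) ((2 * Real.pi)⁻¹ • ξ)) x = f x := by
      have e2 : f x = ∫ η : Rd d, Complex.exp (((2 * Real.pi * inner ℝ η x : ℝ) : ℂ) * Complex.I)
          • (𝓕 f) η := by
        rw [← Real.fourierInv_eq', ← SchwartzMap.fourierInv_coe]
        rw [FourierTransform.fourierInv_fourier_eq]
      have e3 := Measure.integral_comp_smul (volume : Measure (Rd d)) (fun η : Rd d =>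
        (c : ℂ)⁻¹ * (Complex.exp (((2 * Real.pi * inner ℝ η x : ℝ) : ℂ) * Complex.I)
          • (𝓕 f) η)) (2 * Real.pi)⁻¹
      have e5 : ∫ η : Rd d, (c : ℂ)⁻¹ * (Complex.exp (((2 * Real.pi * inner ℝ η x : ℝ) : ℂ)
          * Complex.I) • (𝓕 f) η) = (c : ℂ)⁻¹ * f x := by
        rw [e2]; exact integral_const_mul _ _
      rw [e5] at e3
      have e4 : c • ((c : ℂ)⁻¹ * f x) = f x := by
        rw [Complex.real_smul, ← mul_assoc, mul_inv_cancel₀ (by exact_mod_cast hc), one_mul]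
      rw [← e4, ← e3, synth]
      congr 1; ext ξ
      rw [wave, inner_smul_left, real_inner_comm]
      simp only [smul_eq_mul, conj_trivial]
      rw [mul_inv_cancel_left₀ (by positivity)]
      ring
    rw [e1]
    rfl

/-- The approximation of `f` by cutoff and mollification. -/
def smoothApprox (n : ℕ) (f : Rd d → ℝ) : Rd d → ℝ := mollify (bump d n) (cut n f)

lemma contDiff_smoothApprox (n : ℕ) {f : Rd d → ℝ} (hf : Continuous f) :
    ContDiff ℝ ∞ (smoothApprox n f) :=
  contDiff_mollify _ (continuous_cut n hf)

lemma hasCompactSupport_smoothApprox (n : ℕ) (f : Rd d → ℝ) :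
    HasCompactSupport (smoothApprox n f) :=
  hasCompactSupport_mollify _ (hasCompactSupport_cut n f)

lemma abs_smoothApprox_le (n : ℕ) {f : Rd d → ℝ} {M : ℝ} (h : ∀ x, |f x| ≤ M) (x : Rd d) :
    |smoothApprox n f x| ≤ M :=
  norm_mollify_le (bump d n) (f := cut n f) (abs_cut_le n h) x

lemma tendsto_smoothApprox {f : Rd d → ℝ} (hf : Continuous f) (x : Rd d) :
    Tendsto (fun n => smoothApprox n f x) atTop (𝓝 (f x)) := by
  refine tendsto_mollify (fun n => continuous_cut n hf) hf ?_
  filter_upwards [eventually_cut_eq f x] with n hn y hy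
  exact hn y (Metric.ball_subset_ball one_le_two hy)

/-- A bound for integrals of test functions against a difference of probability measures extends
to bounded continuous functions. -/
lemma abs_integral_sub_le_of_smooth {μ μ' : Measure (Rd d)} [IsProbabilityMeasure μ]
    [IsProbabilityMeasure μ'] {D : ℝ}
    (h : ∀ ψ : Rd d → ℝ, ContDiff ℝ ∞ ψ → HasCompactSupport ψ → (∀ x, |ψ x| ≤ 1) →
      |∫ x, ψ x ∂μ - ∫ x, ψ x ∂μ'| ≤ D)
    {f : Rd d → ℝ} (hf : Continuous f) (hf1 : ∀ x, |f x| ≤ 1) :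
    |∫ x, f x ∂μ - ∫ x, f x ∂μ'| ≤ D := by
  have key : ∀ (ρ : Measure (Rd d)) [IsProbabilityMeasure ρ],
      Tendsto (fun n => ∫ x, smoothApprox n f x ∂ρ) atTop (𝓝 (∫ x, f x ∂ρ)) := fun ρ _ =>
    tendsto_integral_of_dominated_convergence (fun _ => 1)
      (fun n => (contDiff_smoothApprox n hf).continuous.aestronglyMeasurable) (integrable_const _)
      (fun n => Eventually.of_forall (abs_smoothApprox_le n hf1))
      (Eventually.of_forall (tendsto_smoothApprox hf))
  exact le_of_tendsto ((key μ).sub (key μ')).abs (Eventually.of_forall fun n =>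
    h _ (contDiff_smoothApprox n hf) (hasCompactSupport_smoothApprox n f)
      (abs_smoothApprox_le n hf1))

lemma norm_fderiv_smul_le {F : Type*} [NormedAddCommGroup F] [NormedSpace ℝ F] {c : Rd d → ℝ}
    {f : Rd d → F} {x : Rd d} (hc : DifferentiableAt ℝ c x) (hf : DifferentiableAt ℝ f x) :
    ‖fderiv ℝ (fun x => c x • f x) x‖ ≤ |c x| * ‖fderiv ℝ f x‖ + ‖fderiv ℝ c x‖ * ‖f x‖ := by
  rw [fderiv_fun_smul hc hf]
  refine (norm_add_le _ _).trans (add_le_add ?_ ?_)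
  · rw [norm_smul, Real.norm_eq_abs]
  · rw [ContinuousLinearMap.norm_smulRight_apply]

lemma norm_fderiv_add_le {F : Type*} [NormedAddCommGroup F] [NormedSpace ℝ F] {f g : Rd d → F}
    {x : Rd d} (hf : DifferentiableAt ℝ f x) (hg : DifferentiableAt ℝ g x) {A B : ℝ}
    (hA : ‖fderiv ℝ f x‖ ≤ A) (hB : ‖fderiv ℝ g x‖ ≤ B) :
    ‖fderiv ℝ (fun x => f x + g x) x‖ ≤ A + B := by
  rw [fderiv_fun_add hf hg]
  exact (norm_add_le _ _).trans (add_le_add hA hB)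

lemma CB2.mul {u v : Rd d → ℝ} {M₀ M₁ M₂ N₀ N₁ N₂ : ℝ} (hu : CB2 u M₀ M₁ M₂)
    (hv : CB2 v N₀ N₁ N₂) :
    CB2 (fun x => u x * v x) (M₀ * N₀) (M₀ * N₁ + M₁ * N₀)
      (M₀ * N₂ + M₁ * N₁ + (N₀ * M₂ + N₁ * M₁)) := by
  have a0 := hu.nonneg₀
  have a1 := hu.nonneg₁
  have b0 := hv.nonneg₀
  have b1 := hv.nonneg₁
  have du : Differentiable ℝ u := hu.contDiff.differentiable (by norm_num)
  have dv : Differentiable ℝ v := hv.contDiff.differentiable (by norm_num)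
  have du' : Differentiable ℝ (fderiv ℝ u) :=
    (hu.contDiff.fderiv_right (m := 1) (by norm_num)).differentiable one_ne_zero
  have dv' : Differentiable ℝ (fderiv ℝ v) :=
    (hv.contDiff.fderiv_right (m := 1) (by norm_num)).differentiable one_ne_zero
  have e : fderiv ℝ (fun x => u x * v x) = fun x => u x • fderiv ℝ v x + v x • fderiv ℝ u x := by
    ext1 x; exact fderiv_fun_mul (du x) (dv x)
  refine ⟨hu.contDiff.mul hv.contDiff, fun x => ?_, fun x => ?_, fun x => ?_⟩
  · rw [abs_mul]
    gcongr
    · exact hu.bound₀ x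
    · exact hv.bound₀ x
  · refine (norm_fderiv_smul_le (du x) (dv x)).trans ?_
    gcongr
    · exact hu.bound₀ x
    · exact hv.bound₁ x
    · exact hu.bound₁ x
    · exact hv.bound₀ x
  · rw [e]
    refine norm_fderiv_add_le ((du x).smul (dv' x)) ((dv x).smul (du' x))
      ((norm_fderiv_smul_le (du x) (dv' x)).trans ?_)
      ((norm_fderiv_smul_le (dv x) (du' x)).trans ?_)
    · gcongr
      · exact hu.bound₀ x
      · exact hv.bound₂ x
      · exact hu.bound₁ x
      · exact hv.bound₁ x
    · gcongr
      · exact hv.bound₀ x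
      · exact hu.bound₂ x
      · exact hv.bound₁ x
      · exact hu.bound₁ x

/-- The point is that one triple of bounds serves all n, as dominated convergence requires. -/
lemma CB2.cut {u : Rd d → ℝ} {M₀ M₁ M₂ : ℝ} (hu : CB2 u M₀ M₁ M₂) :
    ∃ N₀ N₁ N₂, ∀ n, CB2 (cut n u) N₀ N₁ N₂ := by
  obtain ⟨C, hC, h⟩ := exists_norm_fderiv_scale_le (χ := cutoff d) (cutoff d).contDiff
    (cutoff d).hasCompactSupport
  refine ⟨_, _, _, fun n => CB2.mul (M₀ := 1) (M₁ := C) (M₂ := C) ⟨contDiff_cutoff_smul (k := 2) _,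
    fun x => ?_, fun x => ?_, fun x => ?_⟩ hu⟩
  · rw [abs_of_nonneg (cutoff d).nonneg]
    exact (cutoff d).le_one
  · exact (h _ (by positivity) (inv_le_one_of_one_le₀ (by simp)) x).1
  · exact (h _ (by positivity) (inv_le_one_of_one_le₀ (by simp)) x).2

section

variable {u : Rd d → ℝ} {M₀ M₁ M₂ : ℝ} (φ : ContDiffBump (0 : Rd d)) (hu : CB2 u M₀ M₁ M₂)
include hu

lemma CB2.fderiv_mollify : fderiv ℝ (mollify φ u) = mollify φ (fderiv ℝ u) := funext fun x =>
  (hasFDerivAt_mollify φ (hu.contDiff.of_le (by norm_num)) hu.bound₁ x).fderiv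

lemma CB2.fderiv_fderiv_mollify :
    fderiv ℝ (fderiv ℝ (mollify φ u)) = mollify φ (fderiv ℝ (fderiv ℝ u)) := by
  rw [hu.fderiv_mollify]
  exact funext fun x => (hasFDerivAt_mollify φ (hu.contDiff.fderiv_right (by norm_num))
    hu.bound₂ x).fderiv

lemma CB2.mollify : CB2 (mollify φ u) M₀ M₁ M₂ := by
  refine ⟨contDiff_infty.1 (contDiff_mollify φ hu.continuous) 2,
    norm_mollify_le φ (f := u) hu.bound₀, ?_, ?_⟩
  · rw [hu.fderiv_mollify]
    exact norm_mollify_le φ hu.bound₁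
  · rw [hu.fderiv_fderiv_mollify]
    exact norm_mollify_le φ hu.bound₂

end

/-- Functions of class `C²_b` are approximated, together with their derivatives up to order two, by
smooth functions with compact support. -/
lemma CB2.exists_smoothApprox {u : Rd d → ℝ} {M₀ M₁ M₂ : ℝ} (hu : CB2 u M₀ M₁ M₂) :
    ∃ N₀ N₁ N₂, (∀ n, CB2 (smoothApprox n u) N₀ N₁ N₂) ∧
      (∀ x, Tendsto (fun n => fderiv ℝ (smoothApprox n u) x) atTop (𝓝 (fderiv ℝ u x))) ∧
      ∀ x, Tendsto (fun n => fderiv ℝ (fderiv ℝ (smoothApprox n u)) x) atTop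
        (𝓝 (fderiv ℝ (fderiv ℝ u) x)) := by
  obtain ⟨N₀, N₁, N₂, h⟩ := hu.cut
  refine ⟨N₀, N₁, N₂, fun n => (h n).mollify _, fun x => ?_, fun x => ?_⟩
  · simp_rw [smoothApprox, (h _).fderiv_mollify]
    refine tendsto_mollify (fun n => (h n).continuous_fderiv) hu.continuous_fderiv ?_
    filter_upwards [eventually_cut_eq' x] with n hn y hy using (hn y hy).1
  · simp_rw [smoothApprox, (h _).fderiv_fderiv_mollify]
    refine tendsto_mollify (fun n => (h n).continuous_fderiv_fderiv)
      hu.continuous_fderiv_fderiv ?_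
    filter_upwards [eventually_cut_eq' x] with n hn y hy using (hn y hy).2

end

/-! ### A Gronwall argument with a weakly singular kernel. -/

section
/-! ### Comparison of approximate mild solutions -/

variable {d : ℕ}

/-- The weakly singular integral controlling the heat semigroup on `(0, T)` with the exponential
weight of rate `k`. -/
def singInt (T a k : ℝ) : ℝ := ∫ r in Ioo 0 T, r ^ (-a) * Real.exp (-k * r)

lemma integrableOn_rpow_neg {a : ℝ} (ha : a < 1) (t : ℝ) :
    IntegrableOn (fun r : ℝ => r ^ (-a)) (Ioo 0 t) := by
  rcases le_or_gt t 0 with ht | ht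
  · simp [Ioo_eq_empty (not_lt.2 ht)]
  · have := intervalIntegral.intervalIntegrable_rpow' (a := 0) (b := t) (r := -a) (by linarith)
    rw [intervalIntegrable_iff_integrableOn_Ioo_of_le ht.le] at this
    exact this

lemma integrableOn_rpow_mul_exp {a : ℝ} (ha : a < 1) (t k : ℝ) :
    IntegrableOn (fun r : ℝ => r ^ (-a) * Real.exp (-k * r)) (Ioo 0 t) := by
  have h1 : IntegrableOn (fun r : ℝ => r ^ (-a) * Real.exp (-k * r)) (Ioo 0 t) :=
    (integrableOn_rpow_neg ha t).mul_bdd (c := Real.exp (|k| * |t|))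
      (by fun_prop) (by
        filter_upwards [ae_restrict_mem measurableSet_Ioo] with r hr
        rw [Real.norm_of_nonneg (Real.exp_nonneg _)]
        refine Real.exp_le_exp.2 ((le_abs_self _).trans ?_)
        rw [abs_mul, abs_neg]
        gcongr
        · exact hr.1.le
        · exact hr.2.le)
  exact h1

lemma singInt_nonneg (T a k : ℝ) : 0 ≤ singInt T a k :=
  setIntegral_nonneg measurableSet_Ioo fun _ hr =>
    mul_nonneg (Real.rpow_nonneg hr.1.le _) (Real.exp_nonneg _)

/-- Against the weight exp(-kr) the singular kernel has arbitrarily small mass as k grows. This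
turns the mild equation into a contraction and replaces a singular Gronwall lemma. -/
lemma tendsto_singInt {a : ℝ} (ha : a < 1) (T : ℝ) :
    Tendsto (fun k => singInt T a k) atTop (𝓝 0) := by
  have : Tendsto (fun k => singInt T a k) atTop (𝓝 (∫ _ in Ioo 0 T, (0 : ℝ))) := by
    refine tendsto_integral_filter_of_dominated_convergence (fun r : ℝ => r ^ (-a))
      (Eventually.of_forall fun k => (integrableOn_rpow_mul_exp ha T k).aestronglyMeasurable) ?_
      (integrableOn_rpow_neg ha T) ?_
    · filter_upwards [eventually_ge_atTop 0] with k hk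
      filter_upwards [ae_restrict_mem measurableSet_Ioo] with r hr
      have h0 := Real.rpow_nonneg hr.1.le (-a)
      rw [Real.norm_of_nonneg (mul_nonneg h0 (Real.exp_nonneg _))]
      refine mul_le_of_le_one_right h0 (Real.exp_le_one_iff.2 ?_)
      nlinarith [hr.1]
    · filter_upwards [ae_restrict_mem measurableSet_Ioo] with r hr
      rw [← mul_zero (r ^ (-a))]
      refine tendsto_const_nhds.mul (Real.tendsto_exp_atBot.comp ?_)
      simp_rw [neg_mul]
      exact tendsto_neg_atTop_atBot.comp (tendsto_id.atTop_mul_const hr.1)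
  simpa using this

lemma integrableOn_sing {a : ℝ} (ha : a < 1) (t k : ℝ) :
    IntegrableOn (fun s : ℝ => (t - s) ^ (-a) * Real.exp (k * s)) (Ioo 0 t) := by
  rcases le_or_gt t 0 with ht | ht
  · simp [Ioo_eq_empty (not_lt.2 ht)]
  have h1 := integrableOn_rpow_mul_exp ha t k
  rw [← intervalIntegrable_iff_integrableOn_Ioo_of_le ht.le] at h1
  have h2 := ((h1.comp_sub_left t).symm).const_mul (Real.exp (k * t))
  simp only [sub_self, sub_zero] at h2
  rw [intervalIntegrable_iff_integrableOn_Ioo_of_le ht.le] at h2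
  refine h2.congr_fun (fun s _ => ?_) measurableSet_Ioo
  simp only
  rw [mul_left_comm, ← Real.exp_add]
  ring_nf

/-- The substitution r = t - s extracts exp(kt), so a bound proportional to exp(ks) reproduces
itself with the factor `singInt T a k`. -/
lemma integral_sing_le {a : ℝ} (ha : a < 1) {t T : ℝ} (ht : t ∈ Icc 0 T) (k : ℝ) :
    ∫ s in Ioo 0 t, (t - s) ^ (-a) * Real.exp (k * s) ≤ Real.exp (k * t) * singInt T a k := by
  have e1 : ∫ s in Ioo 0 t, (t - s) ^ (-a) * Real.exp (k * s)
      = Real.exp (k * t) * ∫ r in Ioo 0 t, r ^ (-a) * Real.exp (-k * r) := by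
    rw [← integral_Ioc_eq_integral_Ioo, ← integral_Ioc_eq_integral_Ioo,
      ← intervalIntegral.integral_of_le ht.1, ← intervalIntegral.integral_of_le ht.1]
    have := intervalIntegral.integral_comp_sub_left (a := 0) (b := t)
      (fun r => r ^ (-a) * Real.exp (-k * r)) t
    simp only [sub_self, sub_zero] at this
    rw [← this, ← intervalIntegral.integral_const_mul]
    congr 1; ext s
    rw [mul_left_comm, ← Real.exp_add]
    ring_nf
  rw [e1]
  gcongr
  refine setIntegral_mono_set (integrableOn_rpow_mul_exp ha T k) ?_
    (Ioo_subset_Ioo_right ht.2).eventuallyLE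
  filter_upwards [ae_restrict_mem measurableSet_Ioo] with r hr
  exact mul_nonneg (Real.rpow_nonneg hr.1.le _) (Real.exp_nonneg _)

/-- `m` solves the mild form of the equation with drift `b`, up to an error of size `η`. -/
structure IsMildApprox (L : LevyTriplet d) (T a : ℝ) (b : ℝ → Rd d → Rd d)
    (m₀ : Measure (Rd d)) (η : ℝ) (m : ℝ → Measure (Rd d)) : Prop where
  prob : ∀ t, IsProbabilityMeasure (m t)
  mild : ∀ (g : Rd d → ℂ) (N : ℝ), IsAmplitude volume g → (∀ x, |(synth volume g x).re| ≤ N) →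
    ∀ t ∈ Icc 0 T, ∃ f : ℝ → ℝ, IntegrableOn f (Ioo 0 t) ∧
      ∫ x, (synth volume g x).re ∂m t
        = (∫ ξ, heatAmp L g t ξ * charFun m₀ ξ).re - ∫ s in Ioo 0 t, f s ∧
      ∀ s ∈ Ioo 0 t, |f s - ∫ x, fderiv ℝ (fun x => (synth volume (heatAmp L g (t - s)) x).re) x
        (b s x) ∂m s| ≤ N * η * (t - s) ^ (-a)

section compare

variable {L : LevyTriplet d} {T a C M : ℝ} {b : ℝ → Rd d → Rd d}
  {m₀ : Measure (Rd d)}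

/-- Replacing V by b(s,X) in the dual formula costs at most the sup of |D Pₜ₋ₛψ| times the mean of
|V - b(s,X)|, that is N C (t-s)^(-a) η. Only the sup norm N of ψ enters. -/
lemma IsDriven.isMildApprox {Ω : Type*} [MeasurableSpace Ω] {π : ℝ → Measure Ω}
    {X V : ℝ → Ω → Rd d} {M' η : ℝ} [IsProbabilityMeasure m₀] (h : IsDriven L T m₀ π X V M')
    (hL : HasGradientBound L T a C)
    (hb : ∀ s ∈ Ioo 0 T, Continuous (b s)) (hbM : ∀ s ∈ Ioo 0 T, ∀ x, ‖b s x‖ ≤ M)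
    (hη : ∀ s ∈ Ioo 0 T, ∫ w, ‖V s w - b s (X s w)‖ ∂π s ≤ η) :
    IsMildApprox L T a b m₀ (C * η) fun t => (π t).map (X t) := by
  have hp := h.prob
  refine ⟨fun t => Measure.isProbabilityMeasure_map (h.measX t).aemeasurable,
    fun g N hg hN t ht => ?_⟩
  have hN0 : 0 ≤ N := (abs_nonneg _).trans (hN 0)
  obtain ⟨f, h1, h2, h3⟩ := h.integral_synth hL.symbol_re hg ht
  have hψ : Continuous fun x => (synth volume g x).re :=
    Complex.continuous_re.comp (continuous_synth hg.integrable)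
  refine ⟨f, h1, ?_, fun s hs => ?_⟩
  · rw [integral_map (h.measX t).aemeasurable hψ.aestronglyMeasurable, h2]
  · have hsT : s ∈ Ioo 0 T := ⟨hs.1, hs.2.trans_le ht.2⟩
    have hr : t - s ∈ Ioc 0 T := ⟨by linarith [hs.2], by linarith [hs.1, ht.2]⟩
    have ha := hg.heatAmp hL.symbol_re hr.1.le
    have hB := hL.bound g N hg hN (t - s) hr
    set Q := fun x => (synth volume (heatAmp L g (t - s)) x).re
    have hQ : Continuous (fderiv ℝ Q) := ha.contDiff_re.continuous_fderiv (by norm_num)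
    have hbs := hb s hsT
    have hXm := h.measX s
    have hVm := h.measV s
    have hr0 : 0 ≤ (t - s) ^ (-a) := Real.rpow_nonneg hr.1.le _
    have hB0 : 0 ≤ N * (C * (t - s) ^ (-a)) := by have := hL.nonneg; positivity
    have i1 : Integrable (fun w => fderiv ℝ Q (X s w) (V s w)) (π s) := by
      refine Integrable.of_bound (C := N * (C * (t - s) ^ (-a)) * M') ?_
        (Eventually.of_forall fun w => ?_)
      · have : Continuous fun p : Rd d × Rd d => fderiv ℝ Q p.1 p.2 := by fun_prop
        exact (this.measurable.comp (hXm.prodMk hVm)).aestronglyMeasurable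
      · exact ((fderiv ℝ Q (X s w)).le_of_opNorm_le (hB _) _).trans
          (mul_le_mul_of_nonneg_left (h.boundV s w) hB0)
    have i2 : Integrable (fun w => fderiv ℝ Q (X s w) (b s (X s w))) (π s) := by
      refine Integrable.of_bound (C := N * (C * (t - s) ^ (-a)) * M) ?_
        (Eventually.of_forall fun w => ?_)
      · have : Continuous fun x => fderiv ℝ Q x (b s x) := by fun_prop
        exact (this.measurable.comp hXm).aestronglyMeasurable
      · exact ((fderiv ℝ Q (X s w)).le_of_opNorm_le (hB _) _).trans
          (mul_le_mul_of_nonneg_left (hbM s hsT _) hB0)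
    have i3 : Integrable (fun w => ‖V s w - b s (X s w)‖) (π s) := by
      refine Integrable.of_bound (C := M' + M) ?_ (Eventually.of_forall fun w => ?_)
      · exact (hVm.sub (hbs.measurable.comp hXm)).norm.aestronglyMeasurable
      · rw [norm_norm]
        exact (norm_sub_le _ _).trans (add_le_add (h.boundV s w) (hbM s hsT _))
    rw [h3 s hs, integral_map hXm.aemeasurable
      (by fun_prop : Continuous fun x => fderiv ℝ Q x (b s x)).aestronglyMeasurable,
      ← integral_sub i1 i2]
    calc _ ≤ ∫ w, N * (C * (t - s) ^ (-a)) * ‖V s w - b s (X s w)‖ ∂π s := by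
          rw [← Real.norm_eq_abs]
          refine norm_integral_le_of_norm_le (i3.const_mul _) (Eventually.of_forall fun w => ?_)
          rw [← map_sub]
          exact (fderiv ℝ Q (X s w)).le_of_opNorm_le (hB _) _
      _ = N * (C * (t - s) ^ (-a)) * ∫ w, ‖V s w - b s (X s w)‖ ∂π s := integral_const_mul _ _
      _ ≤ N * (C * (t - s) ^ (-a)) * η := by gcongr; exact hη s hsT
      _ = _ := by ring

/-- One step of the Gronwall iteration. -/
lemma IsMildApprox.step (hL : HasGradientBound L T a C)
    (hb : ∀ s ∈ Ioo 0 T, Continuous (b s)) (hM : 0 ≤ M) (hbM : ∀ s ∈ Ioo 0 T, ∀ x, ‖b s x‖ ≤ M)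
    {η η' : ℝ} {m m' : ℝ → Measure (Rd d)} (hη : 0 ≤ η) (hη' : 0 ≤ η')
    (h : IsMildApprox L T a b m₀ η m) (h' : IsMildApprox L T a b m₀ η' m') {k D : ℝ} (hk : 0 ≤ k)
    (hkM : C * M * singInt T a k ≤ 1 / 2) (hD : 0 ≤ D)
    (hrec : ∀ t ∈ Icc 0 T, ∀ f : Rd d → ℝ, Continuous f → (∀ x, |f x| ≤ 1) →
      |∫ x, f x ∂m t - ∫ x, f x ∂m' t| ≤ D * Real.exp (k * t)) :
    ∀ t ∈ Icc 0 T, ∀ f : Rd d → ℝ, Continuous f → (∀ x, |f x| ≤ 1) →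
      |∫ x, f x ∂m t - ∫ x, f x ∂m' t|
        ≤ ((η + η') * singInt T a 0 + D / 2) * Real.exp (k * t) := by
  intro t ht f hf hf1
  have := h.prob
  have := h'.prob
  have hC := hL.nonneg
  -- By density it suffices to test with smooth compactly supported functions, which are
  -- superpositions of plane waves.
  refine abs_integral_sub_le_of_smooth (fun ψ hψ1 hψ2 hψ3 => ?_) hf hf1
  obtain ⟨g, hg, hgψ⟩ := exists_isAmplitude hψ1 hψ2
  have hg1 : ∀ x, |(synth volume g x).re| ≤ 1 := fun x => by rw [hgψ]; exact hψ3 x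
  obtain ⟨F, i1, e1, b1⟩ := h.mild g 1 hg hg1 t ht
  obtain ⟨F', i1', e1', b1'⟩ := h'.mild g 1 hg hg1 t ht
  simp_rw [hgψ] at e1 e1'
  -- The factor exp(0·s) puts both terms in the form covered by `integrableOn_sing` and
  -- `integral_sing_le`.
  have key : ∀ s ∈ Ioo 0 t, |F s - F' s| ≤ (η + η') * ((t - s) ^ (-a) * Real.exp (0 * s))
      + C * M * D * ((t - s) ^ (-a) * Real.exp (k * s)) := by
    intro s hs
    have hsT : s ∈ Ioo 0 T := ⟨hs.1, hs.2.trans_le ht.2⟩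
    have hr : t - s ∈ Ioc 0 T := ⟨by linarith [hs.2], by linarith [hs.1, ht.2]⟩
    have ha := hg.heatAmp hL.symbol_re hr.1.le
    have hB := hL.bound g 1 hg hg1 (t - s) hr
    have b2 := b1 s hs
    have b2' := b1' s hs
    set Q := fun x => (synth volume (heatAmp L g (t - s)) x).re
    have hQ : Continuous (fderiv ℝ Q) := ha.contDiff_re.continuous_fderiv (by norm_num)
    have hbs := hb s hsT
    have hr0 : 0 ≤ (t - s) ^ (-a) := Real.rpow_nonneg hr.1.le _
    set R : ℝ := C * (t - s) ^ (-a) * M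
    have hR : 0 ≤ R := by positivity
    have hbd : ∀ x, |fderiv ℝ Q x (b s x)| ≤ R := fun x =>
      ((fderiv ℝ Q x).le_of_opNorm_le (hB x) _).trans (by
        rw [one_mul]; exact mul_le_mul_of_nonneg_left (hbM s hsT x) (by positivity))
    have b3 : |∫ x, fderiv ℝ Q x (b s x) ∂m s - ∫ x, fderiv ℝ Q x (b s x) ∂m' s|
        ≤ R * (D * Real.exp (k * s)) := by
      -- Divided by its bound R, the function DQ·b is continuous and bounded by 1, hence admissible
      -- in the inductive bound. If R = 0 it vanishes identically.
      rcases hR.eq_or_lt with h0 | h0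
      · have : ∀ x, fderiv ℝ Q x (b s x) = 0 := fun x =>
          abs_eq_zero.1 (le_antisymm ((hbd x).trans h0.symm.le) (abs_nonneg _))
        simp [this, ← h0]
      · have h1 := hrec s ⟨hs.1.le, hsT.2.le⟩ (fun x => R⁻¹ * fderiv ℝ Q x (b s x))
          (by fun_prop) (fun x => by
            rw [abs_mul, abs_of_pos (inv_pos.2 h0), inv_mul_le_iff₀ h0, mul_one]; exact hbd x)
        rw [integral_const_mul, integral_const_mul, ← mul_sub, abs_mul, abs_of_pos (inv_pos.2 h0),
          inv_mul_le_iff₀ h0] at h1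
        exact h1
    have h5 : F s - F' s = (F s - ∫ x, fderiv ℝ Q x (b s x) ∂m s)
        + (∫ x, fderiv ℝ Q x (b s x) ∂m s - ∫ x, fderiv ℝ Q x (b s x) ∂m' s)
        - (F' s - ∫ x, fderiv ℝ Q x (b s x) ∂m' s) := by ring
    rw [h5]
    calc _ ≤ 1 * η * (t - s) ^ (-a) + R * (D * Real.exp (k * s))
          + 1 * η' * (t - s) ^ (-a) :=
          (abs_sub _ _).trans (add_le_add ((abs_add_le _ _).trans (add_le_add b2 b3)) b2')
      _ = _ := by simp only [R, zero_mul, Real.exp_zero]; ring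
  have hint : IntegrableOn (fun s => (η + η') * ((t - s) ^ (-a) * Real.exp (0 * s))
      + C * M * D * ((t - s) ^ (-a) * Real.exp (k * s))) (Ioo 0 t) :=
    ((integrableOn_sing hL.lt_one t 0).const_mul _).add
      ((integrableOn_sing hL.lt_one t k).const_mul _)
  have s0 := singInt_nonneg T a 0
  have sk := singInt_nonneg T a k
  have g0 := integral_sing_le hL.lt_one ht 0
  have gk := integral_sing_le hL.lt_one ht k
  have hexp : 1 ≤ Real.exp (k * t) := Real.one_le_exp (mul_nonneg hk ht.1)
  rw [zero_mul, Real.exp_zero, one_mul] at g0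
  calc |∫ x, ψ x ∂m t - ∫ x, ψ x ∂m' t| = |∫ s in Ioo 0 t, (F s - F' s)| := by
        rw [e1, e1', integral_sub i1 i1', ← abs_neg]; congr 1; ring
    _ ≤ ∫ s in Ioo 0 t, ((η + η') * ((t - s) ^ (-a) * Real.exp (0 * s))
      + C * M * D * ((t - s) ^ (-a) * Real.exp (k * s))) := by
        rw [← Real.norm_eq_abs]
        refine norm_integral_le_of_norm_le hint ?_
        filter_upwards [ae_restrict_mem measurableSet_Ioo] with s hs using key s hs
    _ = (η + η') * (∫ s in Ioo 0 t, (t - s) ^ (-a) * Real.exp (0 * s))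
        + C * M * D * ∫ s in Ioo 0 t, (t - s) ^ (-a) * Real.exp (k * s) := by
        rw [integral_add ((integrableOn_sing hL.lt_one t 0).const_mul _)
          ((integrableOn_sing hL.lt_one t k).const_mul _), integral_const_mul, integral_const_mul]
    _ ≤ (η + η') * singInt T a 0 + C * M * D * (Real.exp (k * t) * singInt T a k) := by
        gcongr
    _ = (η + η') * singInt T a 0 + (C * M * singInt T a k) * D * Real.exp (k * t) := by ring
    -- The choice of k halves the previous bound D, and exp(kt) ≥ 1 lets the error term carry the
    -- same weight.
    _ ≤ (η + η') * singInt T a 0 * Real.exp (k * t) + 1 / 2 * D * Real.exp (k * t) := by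
        refine add_le_add (le_mul_of_one_le_right (by positivity) hexp) ?_
        gcongr
    _ = _ := by ring

/-- Approximate mild solutions with the same drift and the same initial law are close. -/
theorem IsMildApprox.compare (hL : HasGradientBound L T a C)
    (hb : ∀ s ∈ Ioo 0 T, Continuous (b s)) (hM : 0 ≤ M) (hbM : ∀ s ∈ Ioo 0 T, ∀ x, ‖b s x‖ ≤ M) :
    ∃ c, 0 ≤ c ∧ ∀ {η η' : ℝ} {m m' : ℝ → Measure (Rd d)}, 0 ≤ η → 0 ≤ η' →
      IsMildApprox L T a b m₀ η m → IsMildApprox L T a b m₀ η' m' →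
      ∀ t ∈ Icc 0 T, ∀ f : Rd d → ℝ, Continuous f → (∀ x, |f x| ≤ 1) →
        |∫ x, f x ∂m t - ∫ x, f x ∂m' t| ≤ c * (η + η') := by
  have h1 : Tendsto (fun k => C * M * singInt T a k) atTop (𝓝 0) := by
    simpa using (tendsto_singInt hL.lt_one T).const_mul (C * M)
  obtain ⟨k, hk, hkM⟩ := ((eventually_ge_atTop (0 : ℝ)).and
    (h1.eventually_le_const (by norm_num : (0 : ℝ) < 1 / 2))).exists
  have s0 := singInt_nonneg T a 0
  refine ⟨2 * singInt T a 0 * Real.exp (k * T), by positivity, ?_⟩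
  intro η η' m m' hη hη' h h' t ht f hf hf1
  have := h.prob
  have := h'.prob
  -- One step maps D to E + D/2 with E = (η + η') `singInt T a 0`. The fixed point is 2E, and the
  -- iteration starts from the trivial bound 2 between probability measures.
  have key : ∀ n : ℕ, ∀ t ∈ Icc 0 T, ∀ f : Rd d → ℝ, Continuous f → (∀ x, |f x| ≤ 1) →
      |∫ x, f x ∂m t - ∫ x, f x ∂m' t|
        ≤ (2 * ((η + η') * singInt T a 0) + 2 * (1 / 2) ^ n) * Real.exp (k * t) := by
    intro n
    induction n with
    | zero =>
      intro t ht f hf hf1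
      have hb : ∀ (ρ : Measure (Rd d)) [IsProbabilityMeasure ρ], |∫ x, f x ∂ρ| ≤ 1 := by
        intro ρ _
        refine (norm_integral_le_of_norm_le_const (f := f) (C := 1)
          (Eventually.of_forall hf1)).trans_eq ?_
        simp
      have hexp : 1 ≤ Real.exp (k * t) := Real.one_le_exp (mul_nonneg hk ht.1)
      have h3 : 0 ≤ (η + η') * singInt T a 0 := by positivity
      calc _ ≤ |∫ x, f x ∂m t| + |∫ x, f x ∂m' t| := abs_sub _ _
        _ ≤ 2 := by linarith [hb (m t), hb (m' t)]
        _ ≤ (2 * ((η + η') * singInt T a 0) + 2 * (1 / 2) ^ 0) * 1 := by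
          rw [pow_zero]; linarith
        _ ≤ _ := by gcongr
    | succ n ih =>
      intro t ht f hf hf1
      refine (IsMildApprox.step hL hb hM hbM hη hη' h h' hk hkM (by positivity) ih t ht f hf
        hf1).trans_eq ?_
      ring
  have lim : Tendsto (fun n : ℕ => (2 * ((η + η') * singInt T a 0) + 2 * (1 / 2 : ℝ) ^ n)
      * Real.exp (k * t)) atTop (𝓝 ((2 * ((η + η') * singInt T a 0) + 2 * 0)
      * Real.exp (k * t))) :=
    (((tendsto_pow_atTop_nhds_zero_of_lt_one (by norm_num) (by norm_num)).const_mul 2).const_add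
      _).mul_const _
  refine (ge_of_tendsto lim (Eventually.of_forall fun n => key n t ht f hf hf1)).trans ?_
  rw [mul_zero, add_zero]
  calc _ ≤ 2 * ((η + η') * singInt T a 0) * Real.exp (k * T) := by
        gcongr
        exact ht.2
    _ = _ := by ring

end compare

end

/-! ### Weakly continuous curves, and the passage from distributional to mild solutions. -/

section
/-! ### Continuous curves of probability measures -/

variable {d : ℕ}

lemma abs_integral_le_of_abs_le {μ : Measure (Rd d)} [IsProbabilityMeasure μ] {f : Rd d → ℝ}
    {C : ℝ} (h : ∀ x, |f x| ≤ C) : |∫ x, f x ∂μ| ≤ C := by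
  refine (norm_integral_le_of_norm_le_const (f := f) (C := C) (Eventually.of_forall h)).trans_eq ?_
  simp

lemma abs_integral_sub_le_d₀ (m m' : ProbabilityMeasure (Rd d)) {φ : Rd d → ℝ} (hφ : φ ∈ Lip d) :
    |∫ x, φ x ∂(m' : Measure (Rd d)) - ∫ x, φ x ∂(m : Measure (Rd d))| ≤ d₀ m m' := by
  refine le_csSup ⟨2, ?_⟩ ⟨φ, hφ, rfl⟩
  rintro r ⟨φ, hφ, rfl⟩
  refine (abs_sub _ _).trans ?_
  have h1 := abs_integral_le_of_abs_le (μ := (m : Measure (Rd d))) hφ.1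
  have h2 := abs_integral_le_of_abs_le (μ := (m' : Measure (Rd d))) hφ.1
  linarith

lemma d₀_le {m m' : ProbabilityMeasure (Rd d)} {C : ℝ}
    (h : ∀ φ ∈ Lip d,
      |∫ x, φ x ∂(m' : Measure (Rd d)) - ∫ x, φ x ∂(m : Measure (Rd d))| ≤ C) : d₀ m m' ≤ C := by
  refine csSup_le ⟨_, 0, ⟨by simp, by simp⟩, rfl⟩ ?_
  rintro r ⟨φ, hφ, rfl⟩
  exact h φ hφ

lemma d₀_nonneg (m m' : ProbabilityMeasure (Rd d)) : 0 ≤ d₀ m m' :=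
  (abs_nonneg _).trans (abs_integral_sub_le_d₀ m m' (φ := fun _ => 0) ⟨by simp, by simp⟩)

lemma continuous_of_mem_Lip {φ : Rd d → ℝ} (hφ : φ ∈ Lip d) : Continuous φ :=
  (LipschitzWith.of_dist_le' (K := 1) fun x y => by
    rw [one_mul, dist_eq_norm, dist_eq_norm]; exact hφ.2 x y).continuous

/-- Continuity in d₀ implies weak continuity, because bounded Lipschitz functions determine weak
convergence and each of them lies in `Lip d` after centring and scaling. -/
lemma IsContinuousCurve.continuousOn {T : ℝ} {m : ℝ → ProbabilityMeasure (Rd d)}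
    (h : IsContinuousCurve T m) : ContinuousOn m (Icc 0 T) := by
  intro t ht
  rw [ContinuousWithinAt, tendsto_iff_forall_lipschitz_integral_tendsto]
  rintro f ⟨C, hC⟩ ⟨K, hK⟩
  set A : ℝ := max C K + 1
  have hC0 : 0 ≤ C := dist_nonneg.trans (hC 0 0)
  have hA : 0 < A := by have := le_max_left C K; positivity
  have hf : Continuous f := hK.continuous
  have hφ : (fun x => A⁻¹ * (f x - f 0)) ∈ Lip d := by
    refine ⟨fun x => ?_, fun x y => ?_⟩
    · rw [abs_mul, abs_of_pos (inv_pos.2 hA), inv_mul_le_iff₀ hA, mul_one]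
      exact (hC x 0).trans (by linarith [le_max_left C K])
    · rw [← mul_sub, sub_sub_sub_cancel_right, abs_mul, abs_of_pos (inv_pos.2 hA),
        inv_mul_le_iff₀ hA]
      have := hK.dist_le_mul x y
      rw [dist_eq_norm, dist_eq_norm] at this
      refine this.trans ?_
      gcongr
      linarith [le_max_right C K]
  have hi : ∀ (μ : ProbabilityMeasure (Rd d)), ∫ x, A⁻¹ * (f x - f 0) ∂(μ : Measure (Rd d))
      = A⁻¹ * (∫ x, f x ∂(μ : Measure (Rd d)) - f 0) := by
    intro μ
    have : Integrable f (μ : Measure (Rd d)) := by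
      refine Integrable.of_bound (C := C + |f 0|) hf.aestronglyMeasurable
        (Eventually.of_forall fun x => ?_)
      have h1 := hC x 0
      rw [Real.dist_eq] at h1
      rw [Real.norm_eq_abs]
      linarith [abs_sub_abs_le_abs_sub (f x) (f 0)]
    rw [integral_const_mul, integral_sub this (integrable_const _)]
    simp
  rw [tendsto_iff_norm_sub_tendsto_zero]
  refine squeeze_zero (fun s => norm_nonneg _) (fun s => ?_) (by simpa using (h t ht).const_mul A)
  have := abs_integral_sub_le_d₀ (m s) (m t) hφ
  rw [hi, hi, ← mul_sub, sub_sub_sub_cancel_right, abs_mul, abs_of_pos (inv_pos.2 hA),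
    inv_mul_le_iff₀ hA, abs_sub_comm] at this
  exact this

/-- If `m` is weakly continuous and `G` is continuous in time uniformly in space, then
`s ↦ ∫ G s d(m s)` is continuous. -/
lemma continuousOn_integral {𝕜 : Type*} [RCLike 𝕜] {S : Set ℝ} {m : ℝ → ProbabilityMeasure (Rd d)}
    (hm : ContinuousOn m S) {G : ℝ → Rd d → 𝕜} {C : ℝ} (hG : ∀ s ∈ S, Continuous (G s))
    (hC : ∀ s ∈ S, ∀ x, ‖G s x‖ ≤ C)
    (hu : ∀ s ∈ S, ∀ ε > 0, ∀ᶠ r in 𝓝[S] s, ∀ x, ‖G r x - G s x‖ ≤ ε) :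
    ContinuousOn (fun s => ∫ x, G s x ∂(m s : Measure (Rd d))) S := by
  have hi : ∀ s ∈ S, ∀ r, Integrable (G s) (m r : Measure (Rd d)) := fun s hs r =>
    Integrable.of_bound (hG s hs).aestronglyMeasurable C (Eventually.of_forall (hC s hs))
  intro s hs
  have h1 : Tendsto (fun r => ∫ x, G s x ∂(m r : Measure (Rd d))) (𝓝[S] s)
      (𝓝 (∫ x, G s x ∂(m s : Measure (Rd d)))) :=
    (ProbabilityMeasure.tendsto_iff_forall_integral_rclike_tendsto 𝕜).1 (hm s hs)
      (BoundedContinuousFunction.ofNormedAddCommGroup (G s) (hG s hs) C (hC s hs))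
  have h2 : Tendsto (fun r => ∫ x, G r x ∂(m r : Measure (Rd d))
      - ∫ x, G s x ∂(m r : Measure (Rd d))) (𝓝[S] s) (𝓝 0) := by
    rw [Metric.tendsto_nhds]
    intro ε hε
    filter_upwards [hu s hs (ε / 2) (by positivity), self_mem_nhdsWithin] with r hr hrS
    rw [dist_zero_right, ← integral_sub (hi r hrS r) (hi s hs r)]
    refine lt_of_le_of_lt (norm_integral_le_of_norm_le_const (Eventually.of_forall hr)) ?_
    simp
    linarith
  have := h2.add h1
  simpa [ContinuousWithinAt] using this

/-! ### Drifts -/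

lemma measurable_of_continuousOn_Ioo {E : Type*} [NormedAddCommGroup E] [MeasurableSpace E]
    [BorelSpace E] {T : ℝ} {f : ℝ → E} (hf : ContinuousOn f (Ioo 0 T))
    (h0 : ∀ s ∉ Ioo 0 T, f s = 0) : Measurable f := by
  have : f = (Ioo 0 T).piecewise f 0 := by
    ext s
    by_cases hs : s ∈ Ioo 0 T
    · simp [hs]
    · simp [hs, h0 s hs]
  rw [this]
  exact hf.measurable_piecewise continuousOn_const measurableSet_Ioo

/-- The drift, extended by zero outside of `(0, T)`. -/
def cutDrift (T : ℝ) (b : ℝ → Rd d → Rd d) (s : ℝ) (x : Rd d) : Rd d :=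
  (Ioo 0 T).indicator (fun s => b s x) s

lemma cutDrift_of_mem {T : ℝ} {b : ℝ → Rd d → Rd d} {s : ℝ} (hs : s ∈ Ioo 0 T) :
    cutDrift T b s = b s := by
  ext1 x; simp [cutDrift, hs]

lemma cutDrift_of_notMem {T : ℝ} {b : ℝ → Rd d → Rd d} {s : ℝ} (hs : s ∉ Ioo 0 T) :
    cutDrift T b s = 0 := by
  ext1 x; simp [cutDrift, hs]

namespace IsDrift

variable {T : ℝ} {b : ℝ → Rd d → Rd d} (hb : IsDrift T b)
include hb

lemma exists_bound : ∃ M, 0 ≤ M ∧ (∀ s x, ‖cutDrift T b s x‖ ≤ M) ∧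
    ∀ s x y, ‖cutDrift T b s x - cutDrift T b s y‖ ≤ M * ‖x - y‖ := by
  obtain ⟨M, hM⟩ := hb.bounded
  refine ⟨max M 0, le_max_right _ _, fun s x => ?_, fun s x y => ?_⟩
  · by_cases hs : s ∈ Ioo 0 T
    · rw [cutDrift_of_mem hs]; exact (hM s hs x).1.trans (le_max_left _ _)
    · rw [cutDrift_of_notMem hs]; simp
  · by_cases hs : s ∈ Ioo 0 T
    · rw [cutDrift_of_mem hs]
      exact Convex.norm_image_sub_le_of_norm_fderiv_le (𝕜 := ℝ) (s := univ)
        (fun z _ => (hb.contDiff s hs).differentiable one_ne_zero z)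
        (fun z _ => (hM s hs z).2.trans (le_max_left _ _)) convex_univ (mem_univ y) (mem_univ x)
    · rw [cutDrift_of_notMem hs]; simp; positivity

lemma continuous_cutDrift (s : ℝ) : Continuous (cutDrift T b s) := by
  by_cases hs : s ∈ Ioo 0 T
  · rw [cutDrift_of_mem hs]; exact (hb.contDiff s hs).continuous
  · rw [cutDrift_of_notMem hs]; exact continuous_const

lemma bddAbove : BddAbove {r | ∃ t ∈ Ioo 0 T, ∃ x, r = ‖b t x‖} := by
  obtain ⟨M, hM⟩ := hb.bounded
  refine ⟨M, ?_⟩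
  rintro r ⟨t, ht, x, rfl⟩
  exact (hM t ht x).1

lemma norm_le_driftNorm {s : ℝ} (hs : s ∈ Ioo 0 T) (x : Rd d) : ‖b s x‖ ≤ driftNorm T b :=
  le_csSup hb.bddAbove ⟨s, hs, x, rfl⟩

lemma driftNorm_nonneg : 0 ≤ driftNorm T b :=
  Real.sSup_nonneg (by rintro r ⟨t, ht, x, rfl⟩; exact norm_nonneg _)

lemma eventually_norm_sub_le {s : ℝ} (hs : s ∈ Ioo 0 T) {ε : ℝ} (hε : 0 < ε) :
    ∀ᶠ r in 𝓝[Ioo 0 T] s, ∀ x, ‖b r x - b s x‖ ≤ ε := by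
  obtain ⟨δ, hδ, h⟩ := hb.continuous s hs ε hε
  filter_upwards [self_mem_nhdsWithin, nhdsWithin_le_nhds (Metric.ball_mem_nhds s hδ)] with r hr hr'
  intro x
  exact (h r hr (by simpa [Real.dist_eq] using hr') x).1

lemma continuousOn_cutDrift (x : Rd d) : ContinuousOn (fun s => cutDrift T b s x) (Ioo 0 T) := by
  intro s hs
  rw [ContinuousWithinAt, Metric.tendsto_nhds]
  intro ε hε
  filter_upwards [hb.eventually_norm_sub_le hs (half_pos hε), self_mem_nhdsWithin] with r hr hr'
  rw [dist_eq_norm, cutDrift_of_mem hr', cutDrift_of_mem hs]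
  exact (hr x).trans_lt (half_lt_self hε)

lemma measurable_cutDrift (x : Rd d) : Measurable fun s => cutDrift T b s x :=
  measurable_of_continuousOn_Ioo (hb.continuousOn_cutDrift x) fun s hs => by
    rw [cutDrift_of_notMem hs]; rfl

/-- The drift term of a weakly continuous curve is continuous in time. -/
lemma continuousOn_driftTerm {m : ℝ → ProbabilityMeasure (Rd d)} (hm : ContinuousOn m (Icc 0 T))
    (ξ : Rd d) : ContinuousOn (fun s => driftTerm (fun s => (m s : Measure (Rd d))) (fun _ x => x)
      (cutDrift T b) s ξ) (Ioo 0 T) := by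
  obtain ⟨M, hM0, hM, -⟩ := hb.exists_bound
  refine continuousOn_integral (C := M * ‖ξ‖) (hm.mono Ioo_subset_Icc_self) (fun s hs => ?_)
    (fun s hs x => ?_) fun s hs ε hε => ?_
  · have := hb.continuous_cutDrift s
    fun_prop
  · rw [norm_mul, norm_wave, one_mul, Complex.norm_real]
    refine (norm_inner_le_norm _ _).trans ?_
    gcongr
    exact hM s x
  · filter_upwards [hb.eventually_norm_sub_le hs (ε := ε / (‖ξ‖ + 1)) (by positivity),
      self_mem_nhdsWithin] with r hr hr' x
    rw [← mul_sub, norm_mul, norm_wave, one_mul, ← Complex.ofReal_sub, ← inner_sub_left,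
      Complex.norm_real, cutDrift_of_mem hr', cutDrift_of_mem hs]
    refine (norm_inner_le_norm _ _).trans ?_
    calc _ ≤ ε / (‖ξ‖ + 1) * ‖ξ‖ := by gcongr; exact hr x
      _ ≤ ε / (‖ξ‖ + 1) * (‖ξ‖ + 1) := by gcongr; linarith
      _ = ε := by field_simp

end IsDrift

end

section
/-! ### Plane waves as test functions -/

variable {d : ℕ}

/-- A single plane wave is the superposition over a Dirac mass, so the general calculus yields its
derivatives and its image under the Lévy operator. -/
lemma isAmplitude_dirac (ξ : Rd d) (a : ℂ) : IsAmplitude (Measure.dirac ξ) fun _ => a where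
  meas := aestronglyMeasurable_const
  int := integrable_dirac enorm_lt_top

lemma re_synth_dirac (ξ : Rd d) (a : ℂ) :
    (fun x => (synth (Measure.dirac ξ) (fun _ => a) x).re) = fun x => (a * wave x ξ).re := by
  ext x; simp [synth, mul_comm]

lemma contDiff_re_wave (ξ : Rd d) (a : ℂ) : ContDiff ℝ 2 fun x => (a * wave x ξ).re := by
  rw [← re_synth_dirac]; exact (isAmplitude_dirac ξ a).contDiff_re

lemma fderiv_re_wave (ξ : Rd d) (a : ℂ) (x : Rd d) :
    fderiv ℝ (fun x => (a * wave x ξ).re) x = (Complex.I * a * wave x ξ).re • innerSL ℝ ξ := by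
  ext v
  rw [← re_synth_dirac, (isAmplitude_dirac ξ a).fderiv_re_apply, integral_dirac]
  simp only [_root_.smul_apply, innerSL_apply_apply, smul_eq_mul]
  rw [mul_comm _ (inner ℝ ξ v), ← Complex.re_ofReal_mul]
  congr 1; ring

lemma LevyTriplet.op_re_wave (L : LevyTriplet d) (ξ : Rd d) (a : ℂ) (x : Rd d) :
    L.op (fun x => (a * wave x ξ).re) x = (-L.symbol ξ * a * wave x ξ).re := by
  rw [← re_synth_dirac, L.op_synth_re (isAmplitude_dirac ξ a), integral_dirac]
  congr 1; ring

/-- The symmetric bilinear form `(v, w) ↦ ⟪ξ, v⟫ ⟪ξ, w⟫`. -/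
def squareForm (ξ : Rd d) : ContinuousMultilinearMap ℝ (fun _ : Fin 2 => Rd d) ℝ :=
  (ContinuousMultilinearMap.mkPiAlgebra ℝ (Fin 2) ℝ).compContinuousLinearMap fun _ => innerSL ℝ ξ

lemma iteratedFDeriv_two_re_wave (ξ : Rd d) (a : ℂ) (x : Rd d) :
    iteratedFDeriv ℝ 2 (fun x => (a * wave x ξ).re) x = (-(a * wave x ξ).re) • squareForm ξ := by
  ext v
  rw [iteratedFDeriv_two_apply, ← re_synth_dirac, (isAmplitude_dirac ξ a).fderiv_fderiv_re_apply,
    integral_dirac]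
  simp only [_root_.smul_apply, squareForm, smul_eq_mul,
    ContinuousMultilinearMap.compContinuousLinearMap_apply,
    ContinuousMultilinearMap.mkPiAlgebra_apply, Fin.prod_univ_two, innerSL_apply_apply]
  rw [show wave x ξ * (-(((inner ℝ ξ (v 0) : ℝ) : ℂ) * ((inner ℝ ξ (v 1) : ℝ) : ℂ)) * a)
    = ((-(inner ℝ ξ (v 0) * inner ℝ ξ (v 1)) : ℝ) : ℂ) * (a * wave x ξ) by push_cast; ring,
    Complex.re_ofReal_mul]
  ring

lemma hasDerivAt_re_exp_mul (c k a : ℂ) (t : ℝ) :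
    HasDerivAt (fun t : ℝ => (c * Complex.exp (t * k) * a).re)
      (k * (c * Complex.exp (t * k)) * a).re t := by
  have h1 : HasDerivAt (fun t : ℝ => c * Complex.exp (t * k) * a)
      (k * (c * Complex.exp (t * k)) * a) t := by
    have h2 : HasDerivAt (fun t : ℝ => (t : ℂ) * k) (1 * k) t :=
      (Complex.ofRealCLM.hasDerivAt (x := t)).mul_const k
    exact ((h2.cexp.const_mul c).mul_const a).congr_deriv (by ring)
  exact Complex.reCLM.hasFDerivAt.comp_hasDerivAt t h1

/-- For k = Ψ(ξ) this function satisfies ∂ₜφ + 𝓛φ = 0, so only the drift term survives in the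
distributional equation. -/
lemma isTestFunction_re_wave {T : ℝ} (hT : 0 < T) (c k : ℂ) (ξ : Rd d) :
    IsTestFunction T fun s x => (c * Complex.exp (s * k) * wave x ξ).re := by
  have hdt : ∀ t ∈ Icc 0 T, ∀ x : Rd d,
      derivWithin (fun t : ℝ => (c * Complex.exp (t * k) * wave x ξ).re) (Icc 0 T) t
        = (k * (c * Complex.exp (t * k)) * wave x ξ).re := fun t ht x =>
    (hasDerivAt_re_exp_mul c k _ t).hasDerivWithinAt.derivWithin (uniqueDiffOn_Icc hT t ht)
  set R : ℝ := ‖c‖ * Real.exp (T * ‖k‖)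
  have hR : ∀ t ∈ Icc 0 T, ∀ x, ‖c * Complex.exp (t * k) * wave x ξ‖ ≤ R := by
    intro t ht x
    rw [norm_mul, norm_mul, norm_wave, mul_one]
    simp only [R]
    gcongr
    exact norm_exp_mul_le ht.1 ht.2
  have hR0 : 0 ≤ R := by positivity
  refine ⟨fun x t ht => (hasDerivAt_re_exp_mul c k _ t).differentiableAt.differentiableWithinAt,
    fun t ht => contDiff_re_wave _ _, by fun_prop, ?_, ?_, ?_,
    R * (1 + ‖k‖ + ‖ξ‖ + ‖squareForm ξ‖), fun t ht x => ⟨?_, ?_, ?_, ?_⟩⟩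
  · refine ContinuousOn.congr (f := fun p : ℝ × Rd d =>
      (k * (c * Complex.exp (p.1 * k)) * wave p.2 ξ).re) (by fun_prop) ?_
    intro p hp
    exact hdt p.1 hp.1 p.2
  · simp_rw [fderiv_re_wave]; fun_prop
  · simp_rw [iteratedFDeriv_two_re_wave]; fun_prop
  · refine (Complex.abs_re_le_norm _).trans ((hR t ht x).trans ?_)
    exact le_mul_of_one_le_right hR0 (by have := norm_nonneg (squareForm ξ); linarith [norm_nonneg k, norm_nonneg ξ])
  · rw [hdt t ht x]
    refine (Complex.abs_re_le_norm _).trans ?_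
    rw [mul_assoc, norm_mul, mul_comm]
    gcongr
    · exact hR t ht x
    · linarith [norm_nonneg (squareForm ξ), norm_nonneg ξ]
  · rw [fderiv_re_wave, norm_smul, innerSL_apply_norm]
    gcongr
    · refine (Complex.abs_re_le_norm _).trans ?_
      rw [mul_assoc, norm_mul, Complex.norm_I, one_mul]
      exact hR t ht x
    · linarith [norm_nonneg (squareForm ξ), norm_nonneg k]
  · rw [iteratedFDeriv_two_re_wave, norm_smul, norm_neg]
    gcongr
    · exact (Complex.abs_re_le_norm _).trans (hR t ht x)
    · linarith [norm_nonneg ξ, norm_nonneg k]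

/-! ### Distributional solutions are mild solutions -/

/-- Test functions are real; letting the complex factor c vary recovers a complex identity. The
choice here is the conjugate of Z. -/
lemma eq_zero_of_forall_re_mul {Z : ℂ} (h : ∀ c : ℂ, (c * Z).re = 0) : Z = 0 := by
  have := h (starRingEnd ℂ Z)
  rw [← Complex.normSq_eq_conj_mul_self, Complex.ofReal_re] at this
  exact Complex.normSq_eq_zero.1 this

lemma integrableOn_exp_mul {L : LevyTriplet d} {ξ : Rd d} {F : ℝ → ℂ} {t C : ℝ}
    (hF : AEStronglyMeasurable F (volume.restrict (Ioo 0 t))) (hC : ∀ s, ‖F s‖ ≤ C) :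
    IntegrableOn (fun s : ℝ => Complex.exp (s * L.symbol ξ) * F s) (Ioo 0 t) := by
  have h1 : AEStronglyMeasurable (fun s : ℝ => Complex.exp (s * L.symbol ξ))
      (volume.restrict (Ioo 0 t)) := by fun_prop
  refine Integrable.mono' (g := fun _ => Real.exp (t * ‖L.symbol ξ‖) * C)
    (integrable_const _) (h1.mul hF) ?_
  filter_upwards [ae_restrict_mem measurableSet_Ioo] with s hs
  rw [norm_mul]
  gcongr
  · exact norm_exp_mul_le hs.1.le hs.2.le
  · exact hC s

/-- The solution is regarded as a driven motion on ℝᵈ itself, with X the identity and velocity equal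
to the drift. -/
theorem IsSolution.isDriven {L : LevyTriplet d} {T : ℝ} (hT : 0 < T) {b : ℝ → Rd d → Rd d}
    (hb : IsDrift T b) {m₀ : ProbabilityMeasure (Rd d)} {m : ℝ → ProbabilityMeasure (Rd d)}
    (hm : IsSolution L T b m₀ m) {M : ℝ} (hM : ∀ s x, ‖cutDrift T b s x‖ ≤ M) :
    IsDriven L T m₀ (fun s => (m s : Measure (Rd d))) (fun _ x => x) (cutDrift T b) M := by
  have hmeas : ∀ ξ, Measurable fun s => driftTerm (fun s => (m s : Measure (Rd d)))
      (fun _ x => x) (cutDrift T b) s ξ := fun ξ =>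
    measurable_of_continuousOn_Ioo (hb.continuousOn_driftTerm hm.continuous.continuousOn ξ)
      fun s hs => by simp [driftTerm, cutDrift_of_notMem hs]
  have hbd : ∀ ξ s, ‖Complex.I * driftTerm (fun s => (m s : Measure (Rd d)))
      (fun _ x => x) (cutDrift T b) s ξ‖ ≤ M * ‖ξ‖ := by
    intro ξ s
    rw [norm_mul, Complex.norm_I, one_mul]
    refine (norm_integral_le_of_norm_le_const (C := M * ‖ξ‖)
      (Eventually.of_forall fun x => ?_)).trans_eq (by simp)
    rw [norm_mul, norm_wave, one_mul, Complex.norm_real]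
    refine (norm_inner_le_norm _ _).trans ?_
    gcongr
    exact hM s x
  refine ⟨fun s => inferInstance, fun _ => measurable_id,
    fun s => (hb.continuous_cutDrift s).measurable, hM, hmeas, fun t ht ξ => ?_⟩
  rw [← sub_eq_zero]
  refine eq_zero_of_forall_re_mul fun c => ?_
  have hi : ∀ (μ : ProbabilityMeasure (Rd d)) (a : ℂ),
      ∫ x, (a * wave x ξ).re ∂(μ : Measure (Rd d)) = (a * ∫ x, wave x ξ ∂(μ : Measure (Rd d))).re := by
    intro μ a
    rw [← integral_const_mul]
    have : Integrable (fun x => a * wave x ξ) (μ : Measure (Rd d)) :=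
      Integrable.of_bound (C := ‖a‖) (by fun_prop)
        (Eventually.of_forall fun x => by rw [norm_mul, norm_wave, mul_one])
    exact integral_re this
  have heq := hm.equation _ (isTestFunction_re_wave hT c (L.symbol ξ) ξ) t ht
  rw [intervalIntegral.integral_of_le ht.1, integral_Ioc_eq_integral_Ioo, hi, hi] at heq
  have h1 : ∫ s in Ioo 0 t, ∫ x, (derivWithin
        (fun r : ℝ => (c * Complex.exp (r * L.symbol ξ) * wave x ξ).re) (Icc 0 T) s
          + L.op (fun x => (c * Complex.exp (s * L.symbol ξ) * wave x ξ).re) x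
          - fderiv ℝ (fun x => (c * Complex.exp (s * L.symbol ξ) * wave x ξ).re) x (b s x))
        ∂(m s : Measure (Rd d))
      = ∫ s in Ioo 0 t, (-(c * (Complex.exp (s * L.symbol ξ) * (Complex.I *
          driftTerm (fun s => (m s : Measure (Rd d))) (fun _ x => x) (cutDrift T b) s ξ)))).re := by
    refine setIntegral_congr_fun measurableSet_Ioo fun s hs => ?_
    have hs' : s ∈ Ioo 0 T := ⟨hs.1, hs.2.trans_le ht.2⟩
    simp only [driftTerm]
    rw [← integral_const_mul, ← integral_const_mul, ← integral_const_mul, ← integral_neg]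
    have hcb := hb.continuous_cutDrift s
    have : Integrable (fun x => -(c * (Complex.exp (s * L.symbol ξ) * (Complex.I *
        (wave x ξ * ((inner ℝ (cutDrift T b s x) ξ : ℝ) : ℂ)))))) (m s : Measure (Rd d)) := by
      refine Integrable.of_bound (C := ‖c‖ * ‖Complex.exp (s * L.symbol ξ)‖ * (M * ‖ξ‖))
        (by fun_prop) (Eventually.of_forall fun x => ?_)
      rw [norm_neg, norm_mul, norm_mul, norm_mul, norm_mul, Complex.norm_I, one_mul, norm_wave,
        one_mul, mul_assoc, Complex.norm_real]
      gcongr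
      refine (norm_inner_le_norm _ _).trans ?_
      gcongr
      exact hM s x
    refine Eq.trans ?_ (integral_re this)
    congr 1; ext x
    -- The time derivative contributes +Ψ and the Lévy operator -Ψ, so they cancel.
    rw [(hasDerivAt_re_exp_mul c (L.symbol ξ) _ s).hasDerivWithinAt.derivWithin
      (uniqueDiffOn_Icc hT s (Ioo_subset_Icc_self hs')), L.op_re_wave, fderiv_re_wave,
      cutDrift_of_mem hs']
    simp only [_root_.smul_apply, innerSL_apply_apply, smul_eq_mul,
      RCLike.re_to_complex]
    rw [mul_comm _ (inner ℝ ξ (b s x)), ← Complex.re_ofReal_mul, ← Complex.add_re,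
      ← Complex.sub_re, real_inner_comm]
    congr 1; ring
  rw [h1] at heq
  have h2 : ∫ s in Ioo 0 t, (-(c * (Complex.exp (s * L.symbol ξ) * (Complex.I *
          driftTerm (fun s => (m s : Measure (Rd d))) (fun _ x => x) (cutDrift T b) s ξ)))).re
      = (-(c * ∫ s in Ioo 0 t, (Complex.exp (s * L.symbol ξ) * (Complex.I *
          driftTerm (fun s => (m s : Measure (Rd d))) (fun _ x => x) (cutDrift T b) s ξ)))).re := by
    rw [← integral_const_mul, ← integral_neg]
    refine integral_re (((integrableOn_exp_mul (C := M * ‖ξ‖) ?_ (hbd ξ)).const_mul c).neg)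
    exact ((hmeas ξ).const_mul _).aestronglyMeasurable
  rw [h2] at heq
  rw [charFun_eq_integral_wave]
  simp only [Complex.ofReal_zero, zero_mul, Complex.exp_zero, mul_one, Complex.neg_re] at heq
  rw [mul_sub, mul_sub, ← mul_assoc, Complex.sub_re, Complex.sub_re]
  linarith

end

/-! ### Existence of mild solutions by an Euler scheme. -/

section
variable {d : ℕ}

/-! ### The noise -/

open Classical in
/-- The law of the increment of the Lévy process of `L` over a time span `r`, given by the
reflected heat kernel. -/
def noise (K : ℝ → Rd d → ℝ) (r : ℝ) : Measure (Rd d) :=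
  if 0 < r then (volume.withDensity fun x => ENNReal.ofReal (K r x)).map (fun x => -x)
  else Measure.dirac 0

namespace LevyTriplet.IsSmoothHeatKernel

variable {L : LevyTriplet d} {K : ℝ → Rd d → ℝ} (hK : L.IsSmoothHeatKernel K)
include hK

lemma isProbabilityMeasure_noise (r : ℝ) : IsProbabilityMeasure (noise K r) := by
  rw [noise]
  split_ifs with hr
  · have : IsProbabilityMeasure (volume.withDensity fun x => ENNReal.ofReal (K r x)) := by
      refine ⟨?_⟩
      rw [withDensity_apply _ MeasurableSet.univ, Measure.restrict_univ,
        ← ofReal_integral_eq_lintegral_ofReal (hK.integrable r hr)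
          (Eventually.of_forall (hK.nonneg r hr)), hK.integral_eq_one r hr, ENNReal.ofReal_one]
    exact Measure.isProbabilityMeasure_map (by fun_prop)
  · infer_instance

lemma integral_wave_noise {r : ℝ} (hr : 0 ≤ r) (ξ : Rd d) :
    ∫ z, wave z ξ ∂noise K r = Complex.exp (-(r : ℂ) * L.symbol ξ) := by
  rw [noise]
  split_ifs with h
  · have hm : Measurable (K r) := (hK.smooth r h).continuous.measurable
    rw [integral_map (by fun_prop) (by fun_prop),
      integral_withDensity_eq_integral_toReal_smul (by fun_prop)
        (Eventually.of_forall fun x => ENNReal.ofReal_lt_top), ← hK.integral_wave_neg h ξ]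
    congr 1; ext x
    rw [ENNReal.toReal_ofReal (hK.nonneg r h x), Complex.real_smul, mul_comm]
  · rw [integral_dirac, wave_zero, show r = 0 by linarith]
    simp

/-- Along times tending to 0 the characteristic functions exp(-rΨ) tend to 1, so by Lévy's
continuity theorem the increments converge weakly to the Dirac mass at 0. The truncation min(1,|z|)
is used because the noise need not have a first moment. -/
lemma exists_integral_min_le {δ : ℝ} (hδ : 0 < δ) :
    ∃ h₀ > 0, ∀ r ∈ Icc 0 h₀, ∫ z, min 1 ‖z‖ ∂noise K r ≤ δ := by
  by_contra! H
  have : ∀ n : ℕ, ∃ r ∈ Icc (0 : ℝ) (1 / (n + 1)), δ < ∫ z, min 1 ‖z‖ ∂noise K r :=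
    fun n => H _ (by positivity)
  choose r hr hδr using this
  have hr0 : Tendsto r atTop (𝓝 0) :=
    squeeze_zero (fun n => (hr n).1) (fun n => (hr n).2) tendsto_one_div_add_atTop_nhds_zero_nat
  let μ : ℕ → ProbabilityMeasure (Rd d) := fun n =>
    ⟨noise K (r n), hK.isProbabilityMeasure_noise _⟩
  let μ₀ : ProbabilityMeasure (Rd d) := ⟨Measure.dirac 0, inferInstance⟩
  have h1 : Tendsto μ atTop (𝓝 μ₀) := by
    rw [ProbabilityMeasure.tendsto_iff_tendsto_charFun]
    intro ξ
    simp only [charFun_eq_integral_wave, ProbabilityMeasure.coe_mk, μ, μ₀, integral_dirac, wave_zero]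
    simp_rw [hK.integral_wave_noise (hr _).1]
    have h2 : Continuous fun r : ℝ => Complex.exp (-(r : ℂ) * L.symbol ξ) := by fun_prop
    simpa [Function.comp_def] using (h2.tendsto 0).comp hr0
  have h2 := (ProbabilityMeasure.tendsto_iff_forall_integral_tendsto.1 h1)
    (BoundedContinuousFunction.ofNormedAddCommGroup (fun z : Rd d => min 1 ‖z‖) (by fun_prop) 1
      fun z => by
        rw [Real.norm_of_nonneg (by positivity)]; exact min_le_left _ _)
  simp only [BoundedContinuousFunction.coe_ofNormedAddCommGroup, ProbabilityMeasure.coe_mk, μ, μ₀,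
    integral_dirac, norm_zero] at h2
  have h3 := ge_of_tendsto' h2 fun n => (hδr n).le
  simp at h3
  linarith

end LevyTriplet.IsSmoothHeatKernel

/-! ### Transport along a frozen drift -/

/-- The displacement caused between the times `τ` and `s` by the drift, frozen at `y`. -/
def displacement (T : ℝ) (b : ℝ → Rd d → Rd d) (τ s : ℝ) (y : Rd d) : Rd d :=
  ∫ q in τ..s, cutDrift T b q y

namespace IsDrift

variable {T : ℝ} {b : ℝ → Rd d → Rd d} (hb : IsDrift T b)
include hb

lemma intervalIntegrable_cutDrift (y : Rd d) (s t : ℝ) :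
    IntervalIntegrable (fun q => cutDrift T b q y) volume s t := by
  obtain ⟨M, -, hM, -⟩ := hb.exists_bound
  exact (intervalIntegrable_const (c := M)).mono_fun'
    (hb.measurable_cutDrift y).aestronglyMeasurable (Eventually.of_forall fun q => hM q y)

lemma hasDerivAt_displacement (τ : ℝ) {s : ℝ} (hs : s ∈ Ioo 0 T) (y : Rd d) :
    HasDerivAt (fun s => displacement T b τ s y) (cutDrift T b s y) s :=
  intervalIntegral.integral_hasDerivAt_right (hb.intervalIntegrable_cutDrift y _ _)
    (hb.measurable_cutDrift y).stronglyMeasurable.stronglyMeasurableAtFilter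
    ((hb.continuousOn_cutDrift y).continuousAt (isOpen_Ioo.mem_nhds hs))

lemma continuous_displacement_left (τ : ℝ) (y : Rd d) :
    Continuous fun s => displacement T b τ s y :=
  intervalIntegral.continuous_primitive (fun s t => hb.intervalIntegrable_cutDrift y s t) _

lemma continuous_displacement (τ s : ℝ) : Continuous (displacement T b τ s) := by
  obtain ⟨M, -, hM, -⟩ := hb.exists_bound
  exact intervalIntegral.continuous_of_dominated_interval (bound := fun _ => M)
    (fun y => (hb.measurable_cutDrift y).aestronglyMeasurable)
    (fun y => Eventually.of_forall fun q _ => hM q y) intervalIntegrable_const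
    (Eventually.of_forall fun q _ => hb.continuous_cutDrift q)

lemma continuousOn_frozen_driftTerm (μ : Measure (Rd d)) [IsProbabilityMeasure μ] (τ : ℝ)
    (ξ : Rd d) : ContinuousOn (fun s => driftTerm (fun _ => μ)
      (fun s y => y - displacement T b τ s y) (cutDrift T b) s ξ) (Ioo 0 T) := by
  obtain ⟨M, -, hM, -⟩ := hb.exists_bound
  refine continuousOn_of_dominated (bound := fun _ => M * ‖ξ‖) (fun s _ => ?_) (fun s _ =>
    Eventually.of_forall fun y => ?_) (integrable_const _) (Eventually.of_forall fun y => ?_)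
  · have := hb.continuous_displacement τ s
    have := hb.continuous_cutDrift s
    fun_prop
  · rw [norm_mul, norm_wave, one_mul, Complex.norm_real]
    refine (norm_inner_le_norm _ _).trans ?_
    gcongr
    exact hM s y
  · have h1 := (hb.continuous_displacement_left τ y).continuousOn (s := Ioo 0 T)
    have h2 := hb.continuousOn_cutDrift y
    simp only [wave]
    fun_prop

lemma measurable_frozen_driftTerm (μ : Measure (Rd d)) [IsProbabilityMeasure μ] (τ : ℝ)
    (ξ : Rd d) : Measurable fun s => driftTerm (fun _ => μ)
      (fun s y => y - displacement T b τ s y) (cutDrift T b) s ξ :=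
  measurable_of_continuousOn_Ioo (hb.continuousOn_frozen_driftTerm μ τ ξ)
    fun s hs => by simp [driftTerm, cutDrift_of_notMem hs]

lemma norm_frozen_driftTerm_le (μ : Measure (Rd d)) [IsProbabilityMeasure μ] {M : ℝ}
    (hM : ∀ s x, ‖cutDrift T b s x‖ ≤ M) (τ s : ℝ) (ξ : Rd d) :
    ‖driftTerm (fun _ => μ) (fun s y => y - displacement T b τ s y) (cutDrift T b) s ξ‖
      ≤ M * ‖ξ‖ := by
  refine (norm_integral_le_of_norm_le_const (C := M * ‖ξ‖)
    (Eventually.of_forall fun x => ?_)).trans_eq (by simp)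
  rw [norm_mul, norm_wave, one_mul, Complex.norm_real]
  refine (norm_inner_le_norm _ _).trans ?_
  gcongr
  exact hM s x

/-- The Fourier equation for pure transport without noise: each plane wave is differentiated along
the path y - ∫ b(q,y) dq, and the result is integrated in time. -/
lemma integral_wave_sub_displacement (μ : Measure (Rd d)) [IsProbabilityMeasure μ] {τ t : ℝ}
    (hτ : 0 ≤ τ) (hτt : τ ≤ t) (ht : t ≤ T) (ξ : Rd d) :
    ∫ y, wave (y - displacement T b τ t y) ξ ∂μ = ∫ y, wave y ξ ∂μ
      - ∫ s in τ..t, Complex.I * driftTerm (fun _ => μ)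
          (fun s y => y - displacement T b τ s y) (cutDrift T b) s ξ := by
  obtain ⟨M, -, hM, -⟩ := hb.exists_bound
  have hc := fun s => hb.continuous_displacement τ s
  have hc' := fun s => hb.continuous_cutDrift s
  set E := driftTerm (fun _ => μ) (fun s y => y - displacement T b τ s y) (cutDrift T b)
  have h0 : ∀ y : Rd d, displacement T b τ τ y = 0 := fun y => by simp [displacement]
  have hder : ∀ y, ∀ s ∈ Ioo 0 T, HasDerivAt (fun s => wave (y - displacement T b τ s y) ξ)
      (-(Complex.I * (wave (y - displacement T b τ s y) ξ
        * ((inner ℝ (cutDrift T b s y) ξ : ℝ) : ℂ)))) s := by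
    intro y s hs
    have h1 : HasDerivAt (fun s => inner ℝ (y - displacement T b τ s y) ξ)
        (-inner ℝ (cutDrift T b s y) ξ) s := by
      have := ((hb.hasDerivAt_displacement τ hs y).const_sub y).inner ℝ (hasDerivAt_const s ξ)
      simpa [inner_neg_left] using this
    have h2 := (h1.ofReal_comp.mul_const Complex.I).cexp
    refine h2.congr_deriv ?_
    simp only [wave]
    push_cast
    ring
  have hbd : ∀ y s, ‖-(Complex.I * (wave (y - displacement T b τ s y) ξ
        * ((inner ℝ (cutDrift T b s y) ξ : ℝ) : ℂ)))‖ ≤ M * ‖ξ‖ := by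
    intro y s
    rw [norm_neg, norm_mul, Complex.norm_I, one_mul, norm_mul, norm_wave, one_mul,
      Complex.norm_real]
    refine (norm_inner_le_norm _ _).trans ?_
    gcongr
    exact hM s y
  have hG : ∀ s ∈ Ioo τ t, HasDerivAt (fun s => ∫ y, wave (y - displacement T b τ s y) ξ ∂μ)
      (-(Complex.I * E s ξ)) s := by
    intro s hs
    have hs' : s ∈ Ioo 0 T := ⟨hτ.trans_lt hs.1, hs.2.trans_le ht⟩
    have := (hasDerivAt_integral_of_dominated_loc_of_deriv_le (μ := μ)
      (F := fun s y => wave (y - displacement T b τ s y) ξ) (bound := fun _ => M * ‖ξ‖)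
      (F' := fun s y => -(Complex.I * (wave (y - displacement T b τ s y) ξ
        * ((inner ℝ (cutDrift T b s y) ξ : ℝ) : ℂ)))) (isOpen_Ioo.mem_nhds hs')
      (Eventually.of_forall fun s => by fun_prop)
      (Integrable.of_bound (C := 1) (by fun_prop) (Eventually.of_forall fun y => (norm_wave _ _).le))
      (by fun_prop)
      (Eventually.of_forall fun y s _ => hbd y s) (integrable_const _)
      (Eventually.of_forall fun y s hs => hder y s hs)).2
    rw [integral_neg, integral_const_mul] at this
    exact this
  have hcont : Continuous fun s => ∫ y, wave (y - displacement T b τ s y) ξ ∂μ := by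
    refine continuous_of_dominated (bound := fun _ => 1) (fun s => by fun_prop)
      (fun s => Eventually.of_forall fun y => (norm_wave _ _).le) (integrable_const _)
      (Eventually.of_forall fun y => ?_)
    have := hb.continuous_displacement_left τ y
    fun_prop
  have hint : IntervalIntegrable (fun s => -(Complex.I * E s ξ)) volume τ t := by
    refine (intervalIntegrable_const (c := M * ‖ξ‖)).mono_fun'
      ((hb.measurable_frozen_driftTerm μ τ ξ).const_mul _).neg.aestronglyMeasurable
      (Eventually.of_forall fun s => ?_)
    beta_reduce
    rw [norm_neg, norm_mul, Complex.norm_I, one_mul]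
    exact hb.norm_frozen_driftTerm_le μ hM τ s ξ
  have := intervalIntegral.integral_eq_sub_of_hasDerivAt_of_le hτt hcont.continuousOn hG hint
  rw [intervalIntegral.integral_neg] at this
  simp only [h0, sub_zero] at this
  linear_combination -this

end IsDrift

/-! ### The Euler scheme -/

open Classical in
/-- One Euler step appended to a driven motion extends it from `[0, τ]` to `[0, τ + h]`. -/
lemma IsDriven.exists_extension {L : LevyTriplet d} {K : ℝ → Rd d → ℝ}
    (hK : L.IsSmoothHeatKernel K) {T : ℝ} {b : ℝ → Rd d → Rd d} (hb : IsDrift T b)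
    {m₀ : Measure (Rd d)} {M δ h τ : ℝ} (hM : ∀ s x, ‖cutDrift T b s x‖ ≤ M)
    (hlip : ∀ s x y, ‖cutDrift T b s x - cutDrift T b s y‖ ≤ M * ‖x - y‖)
    (hδ : ∀ r ∈ Icc 0 h, ∫ z, min 1 ‖z‖ ∂noise K r ≤ δ) (hτ : 0 ≤ τ) (hh : 0 ≤ h)
    (hT : τ + h ≤ T) {π : ℝ → Measure (Rd d × Rd d)} {X V : ℝ → Rd d × Rd d → Rd d}
    (H : IsDriven L τ m₀ π X V M)
    (hV : ∀ s ∈ Ioc 0 τ, ∫ w, ‖V s w - cutDrift T b s (X s w)‖ ∂π s ≤ 2 * M * (M * h + δ)) :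
    ∃ (π' : ℝ → Measure (Rd d × Rd d)) (X' V' : ℝ → Rd d × Rd d → Rd d),
      IsDriven L (τ + h) m₀ π' X' V' M ∧ ∀ s ∈ Ioc 0 (τ + h),
        ∫ w, ‖V' s w - cutDrift T b s (X' s w)‖ ∂π' s ≤ 2 * M * (M * h + δ) := by
  have hM0 := H.nonneg
  have hprob := H.prob
  have hXm := H.measX
  have hnoise := hK.isProbabilityMeasure_noise
  set μ : Measure (Rd d) := (π τ).map (X τ) with hμ
  have hμp : IsProbabilityMeasure μ := Measure.isProbabilityMeasure_map (hXm τ).aemeasurable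
  have hc := fun s => hb.continuous_displacement τ s
  have hc' := fun s => hb.continuous_cutDrift s
  -- After time τ, the first coordinate is the position at τ and the second an independent Lévy
  -- increment over s - τ. The drift is evaluated at the frozen position.
  let π' : ℝ → Measure (Rd d × Rd d) := fun s =>
    if s ≤ τ then π s else μ.prod (noise K (s - τ))
  let X' : ℝ → Rd d × Rd d → Rd d := fun s =>
    if s ≤ τ then X s else fun p => p.1 - displacement T b τ s p.1 + p.2
  let V' : ℝ → Rd d × Rd d → Rd d := fun s =>
    if s ≤ τ then V s else fun p => cutDrift T b s p.1
  set E := driftTerm (fun _ => μ) (fun s y => y - displacement T b τ s y) (cutDrift T b)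
  -- Independence factors the expectation into the transport part and the characteristic function of
  -- the noise.
  have hterm : ∀ ξ s, τ < s → driftTerm π' X' V' s ξ
      = Complex.exp (-((s - τ : ℝ) : ℂ) * L.symbol ξ) * E s ξ := by
    intro ξ s hs
    simp only [driftTerm, π', X', V', if_neg hs.not_ge, E]
    rw [← hK.integral_wave_noise (sub_nonneg.2 hs.le), mul_comm (∫ z, _ ∂noise K _), ←
      integral_prod_mul]
    congr 1; ext p
    rw [wave_add]
    ring
  have hterm' : ∀ ξ s, s ≤ τ → driftTerm π' X' V' s ξ = driftTerm π X V s ξ := by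
    intro ξ s hs
    simp only [driftTerm, π', X', V', if_pos hs]
  have hXV : ∀ s, τ < s → Integrable (fun p : Rd d × Rd d => min 1 ‖p.2‖)
      (μ.prod (noise K (s - τ))) := fun s _ =>
    Integrable.of_bound (C := 1) (by fun_prop) (Eventually.of_forall fun p => by
      rw [Real.norm_of_nonneg (by positivity)]; exact min_le_left _ _)
  refine ⟨π', X', V', ⟨fun s => ?_, fun s => ?_, fun s => ?_, fun s w => ?_, fun ξ => ?_,
    fun t ht ξ => ?_⟩, fun s hs => ?_⟩
  · simp only [π']; split_ifs <;> infer_instance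
  · simp only [X']; split_ifs
    · exact hXm s
    · fun_prop
  · simp only [V']; split_ifs
    · exact H.measV s
    · fun_prop
  · simp only [V']; split_ifs
    · exact H.boundV s w
    · exact hM s _
  · have h1 : (fun s => driftTerm π' X' V' s ξ) = (Iic τ).piecewise
        (fun s => driftTerm π X V s ξ)
        fun s => Complex.exp (-((s - τ : ℝ) : ℂ) * L.symbol ξ) * E s ξ := by
      ext s
      by_cases hs : s ≤ τ
      · simp [hs, hterm' ξ s hs]
      · simp [hs, hterm ξ s (not_le.1 hs)]
    rw [h1]
    refine (H.measurable_driftTerm ξ).piecewise measurableSet_Iic ?_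
    have := hb.measurable_frozen_driftTerm μ τ ξ
    fun_prop
  · rcases le_or_gt t τ with htτ | htτ
    · simp only [π', X', if_pos htτ]
      rw [H.eq t ⟨ht.1, htτ⟩ ξ]
      congr 1
      refine setIntegral_congr_fun measurableSet_Ioo fun s hs => ?_
      rw [← hterm' ξ s (hs.2.le.trans htτ)]
    · have h1 : ∫ w, wave (X' t w) ξ ∂π' t = Complex.exp (-((t - τ : ℝ) : ℂ) * L.symbol ξ)
          * ∫ y, wave (y - displacement T b τ t y) ξ ∂μ := by
        simp only [π', X', if_neg htτ.not_ge]
        rw [← hK.integral_wave_noise (sub_nonneg.2 htτ.le), mul_comm (∫ z, _ ∂noise K _), ←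
          integral_prod_mul]
        congr 1; ext p
        rw [wave_add]
      have h2 : ∫ y, wave y ξ ∂μ = ∫ w, wave (X τ w) ξ ∂π τ :=
        integral_map (hXm τ).aemeasurable (by fun_prop)
      have h3 := hb.integral_wave_sub_displacement μ hτ htτ.le (ht.2.trans hT) ξ
      have h4 := H.eq τ ⟨hτ, le_rfl⟩ ξ
      -- The integrating factor cancels the noise up to a constant in s, so what remains on [τ,t] is
      -- the transport identity times exp(τΨ).
      have hexp : ∀ s : ℝ, Complex.exp (s * L.symbol ξ) * Complex.exp (-((s - τ : ℝ) : ℂ)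
          * L.symbol ξ) = Complex.exp (τ * L.symbol ξ) := by
        intro s
        rw [← Complex.exp_add]
        congr 1; push_cast; ring
      have h5 : ∫ s in τ..t, Complex.exp (s * L.symbol ξ)
            * (Complex.I * driftTerm π' X' V' s ξ)
          = Complex.exp (τ * L.symbol ξ) * ∫ s in τ..t, Complex.I * E s ξ := by
        rw [← intervalIntegral.integral_const_mul, intervalIntegral.integral_of_le htτ.le,
          intervalIntegral.integral_of_le htτ.le]
        refine setIntegral_congr_fun measurableSet_Ioc fun s hs => ?_
        rw [hterm ξ s hs.1, ← hexp s]
        ring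
      have h6 : ∫ s in Ioo 0 τ, Complex.exp (s * L.symbol ξ) * (Complex.I * driftTerm π X V s ξ)
          = ∫ s in 0..τ, Complex.exp (s * L.symbol ξ)
            * (Complex.I * driftTerm π' X' V' s ξ) := by
        rw [intervalIntegral.integral_of_le hτ, integral_Ioc_eq_integral_Ioo]
        refine setIntegral_congr_fun measurableSet_Ioo fun s hs => ?_
        rw [hterm' ξ s hs.2.le]
      have i1 : IntervalIntegrable (fun s : ℝ => Complex.exp (s * L.symbol ξ)
            * (Complex.I * driftTerm π' X' V' s ξ)) volume 0 τ := by
        rw [intervalIntegrable_iff_integrableOn_Ioo_of_le hτ]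
        have : IntegrableOn (fun s : ℝ => Complex.exp (s * L.symbol ξ)
            * (Complex.I * driftTerm π X V s ξ)) (Ioo 0 τ) :=
          integrableOn_exp_mul (C := M * ‖ξ‖)
            ((H.measurable_driftTerm ξ).const_mul Complex.I).aestronglyMeasurable fun s => by
              rw [norm_mul, Complex.norm_I, one_mul]; exact H.norm_driftTerm_le s ξ
        exact this.congr_fun (fun s hs => by beta_reduce; rw [hterm' ξ s hs.2.le])
          measurableSet_Ioo
      have i2 : IntervalIntegrable (fun s : ℝ => Complex.exp (s * L.symbol ξ)
            * (Complex.I * driftTerm π' X' V' s ξ)) volume τ t := by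
        have : IntervalIntegrable (fun s => Complex.exp (τ * L.symbol ξ) *
            (Complex.I * E s ξ)) volume τ t := by
          refine (intervalIntegrable_const (c := ‖Complex.exp (τ * L.symbol ξ)‖ *
            (M * ‖ξ‖))).mono_fun' (((hb.measurable_frozen_driftTerm μ τ ξ).const_mul _).const_mul
              _).aestronglyMeasurable (Eventually.of_forall fun s => ?_)
          beta_reduce
          rw [norm_mul, norm_mul, Complex.norm_I, one_mul]
          gcongr
          exact hb.norm_frozen_driftTerm_le μ hM τ s ξ
        refine this.congr fun s hs => ?_
        rw [uIoc_of_le htτ.le] at hs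
        beta_reduce
        rw [hterm ξ s hs.1, ← hexp s]
        ring
      rw [h1, ← mul_assoc, hexp, h3, ← integral_Ioc_eq_integral_Ioo,
        ← intervalIntegral.integral_of_le ht.1,
        ← intervalIntegral.integral_add_adjacent_intervals i1 i2, h5, ← h6, h2]
      linear_combination h4
  · rcases le_or_gt s τ with hsτ | hsτ
    · simp only [π', X', V', if_pos hsτ]
      exact hV s ⟨hs.1, hsτ⟩
    · simp only [π', X', V', if_neg hsτ.not_ge]
      have h1 : ∀ y, ‖displacement T b τ s y‖ ≤ M * h := by
        intro y
        refine (intervalIntegral.norm_integral_le_of_norm_le_const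
          (fun q _ => hM q y)).trans ?_
        gcongr
        rw [abs_of_nonneg (by linarith)]
        linarith [hs.2]
      -- Large noise is handled by the sup bound 2M and small noise by the Lipschitz bound; both fit
      -- under the truncated expression.
      have h2 : ∀ p : Rd d × Rd d, ‖cutDrift T b s p.1
          - cutDrift T b s (p.1 - displacement T b τ s p.1 + p.2)‖
          ≤ 2 * M * (M * h + min 1 ‖p.2‖) := by
        intro p
        have e1 := norm_sub_le (cutDrift T b s p.1)
          (cutDrift T b s (p.1 - displacement T b τ s p.1 + p.2))
        have e2 := hM s p.1
        have e3 := hM s (p.1 - displacement T b τ s p.1 + p.2)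
        have e4 : 0 ≤ M * h := by positivity
        rcases le_total 1 ‖p.2‖ with h1p | h1p
        · rw [min_eq_left h1p]
          nlinarith
        · rw [min_eq_right h1p]
          refine (hlip s _ _).trans ?_
          have e5 : ‖p.1 - (p.1 - displacement T b τ s p.1 + p.2)‖ ≤ M * h + ‖p.2‖ := by
            rw [show p.1 - (p.1 - displacement T b τ s p.1 + p.2)
              = displacement T b τ s p.1 - p.2 by abel]
            exact (norm_sub_le _ _).trans (by linarith [h1 p.1])
          nlinarith [norm_nonneg p.2]
      have i1 := hXV s hsτ
      calc _ ≤ ∫ p : Rd d × Rd d, 2 * M * (M * h + min 1 ‖p.2‖) ∂μ.prod (noise K (s - τ)) := by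
            refine integral_mono_of_nonneg (Eventually.of_forall fun p => norm_nonneg _)
              (((integrable_const _).add i1).const_mul _) (Eventually.of_forall h2)
        _ = 2 * M * (M * h + ∫ z, min 1 ‖z‖ ∂noise K (s - τ)) := by
            rw [integral_const_mul, integral_add (integrable_const _) i1,
              integral_fun_snd (μ := μ) (ν := noise K (s - τ)) (fun z : Rd d => min 1 ‖z‖)]
            simp
        _ ≤ _ := by
            gcongr
            exact hδ _ ⟨by linarith, by linarith [hs.2]⟩

/-- The Euler scheme: driven motions whose velocity is arbitrarily close to the drift. -/
theorem IsDrift.exists_isDriven {L : LevyTriplet d} {K : ℝ → Rd d → ℝ}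
    (hK : L.IsSmoothHeatKernel K) {T : ℝ} (hT : 0 < T) {b : ℝ → Rd d → Rd d} (hb : IsDrift T b)
    (m₀ : Measure (Rd d)) [IsProbabilityMeasure m₀] {M : ℝ}
    (hM : ∀ s x, ‖cutDrift T b s x‖ ≤ M)
    (hlip : ∀ s x y, ‖cutDrift T b s x - cutDrift T b s y‖ ≤ M * ‖x - y‖) {η : ℝ} (hη : 0 < η) :
    ∃ (π : ℝ → Measure (Rd d × Rd d)) (X V : ℝ → Rd d × Rd d → Rd d),
      IsDriven L T m₀ π X V M ∧ ∀ s ∈ Ioc 0 T,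
        ∫ w, ‖V s w - cutDrift T b s (X s w)‖ ∂π s ≤ η := by
  have hM0 : 0 ≤ M := (norm_nonneg _).trans (hM 0 0)
  -- With δ = η/(4(M+1)) and (M+1)h ≤ δ, the one-step error 2M(Mh + δ) is at most 2(M+1)·2δ = η.
  obtain ⟨h₀, hh₀, hδ⟩ := hK.exists_integral_min_le (δ := η / (4 * (M + 1))) (by positivity)
  -- The first summand forces T/N ≤ h₀, the second forces (M+1)T/N ≤ η/(4(M+1)).
  obtain ⟨N, hN⟩ := exists_nat_gt (T / h₀ + T * (4 * (M + 1) * (M + 1)) / η)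
  have hN0 : (0 : ℝ) < N := lt_trans (by positivity) hN
  have hh : T / N ≤ h₀ := by
    rw [div_le_iff₀ hN0, ← div_le_iff₀' hh₀]
    have : 0 ≤ T * (4 * (M + 1) * (M + 1)) / η := by positivity
    linarith
  have hη' : 2 * M * (M * (T / N) + η / (4 * (M + 1))) ≤ η := by
    have h1 : T * (4 * (M + 1) * (M + 1)) / η ≤ N := by
      have : 0 ≤ T / h₀ := by positivity
      linarith
    rw [div_le_iff₀ hη] at h1
    have h2 : (M + 1) * (T / N) ≤ η / (4 * (M + 1)) := by
      rw [mul_div_assoc', div_le_div_iff₀ hN0 (by positivity)]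
      linarith
    have h3 : M * (T / N) ≤ η / (4 * (M + 1)) := le_trans (by gcongr; linarith) h2
    calc _ ≤ 2 * (M + 1) * (η / (4 * (M + 1)) + η / (4 * (M + 1))) := by gcongr; linarith
      _ = η := by field_simp; norm_num
  have key : ∀ k : ℕ, k ≤ N → ∃ (π : ℝ → Measure (Rd d × Rd d)) (X V : ℝ → Rd d × Rd d → Rd d),
      IsDriven L (k * (T / N)) m₀ π X V M ∧ ∀ s ∈ Ioc 0 (k * (T / N)),
        ∫ w, ‖V s w - cutDrift T b s (X s w)‖ ∂π s
          ≤ 2 * M * (M * (T / N) + η / (4 * (M + 1))) := by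
    intro k
    induction k with
    | zero =>
      intro _
      -- On the degenerate interval [0,0] only the first coordinate matters; the second factor and
      -- the zero velocity are placeholders. The error bound is vacuous there since it excludes time
      -- 0.
      refine ⟨fun _ => m₀.prod m₀, fun _ => Prod.fst, fun _ _ => 0, ⟨fun _ => inferInstance,
        fun _ => measurable_fst, fun _ => measurable_const, fun _ _ => by simpa using hM0,
        fun ξ => by simp [driftTerm], fun t ht ξ => ?_⟩, fun s hs => by simp at hs⟩
      have ht0 : t = 0 := by simpa using ht
      have := integral_fun_fst (μ := m₀) (ν := m₀) (fun z => wave z ξ)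
      simp [ht0, driftTerm, this, charFun_eq_integral_wave]
    | succ k ih =>
      intro hk
      obtain ⟨π, X, V, H, hV⟩ := ih (by omega)
      have e : ((k + 1 : ℕ) : ℝ) * (T / N) = k * (T / N) + T / N := by push_cast; ring
      rw [e]
      refine H.exists_extension hK hb hM hlip (fun r hr => hδ r ⟨hr.1, hr.2.trans hh⟩)
        (by positivity) (by positivity) ?_ hV
      rw [← e]
      calc ((k + 1 : ℕ) : ℝ) * (T / N) ≤ N * (T / N) := by gcongr
        _ = T := by field_simp
  obtain ⟨π, X, V, H, hV⟩ := key N le_rfl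
  rw [mul_div_cancel₀ T hN0.ne'] at H hV
  exact ⟨π, X, V, H, fun s hs => (hV s hs).trans hη'⟩

end

section
variable {d : ℕ}

/-! ### Existence of mild solutions -/

lemma tendsto_integral_of_tendsto {𝕜 ι : Type*} [RCLike 𝕜] {l : Filter ι}
    {μ : ι → ProbabilityMeasure (Rd d)} {μ' : ProbabilityMeasure (Rd d)} (h : Tendsto μ l (𝓝 μ'))
    {f : Rd d → 𝕜} {C : ℝ} (hf : Continuous f) (hC : ∀ x, ‖f x‖ ≤ C) :
    Tendsto (fun i => ∫ x, f x ∂(μ i : Measure (Rd d))) l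
      (𝓝 (∫ x, f x ∂(μ' : Measure (Rd d)))) :=
  (ProbabilityMeasure.tendsto_iff_forall_integral_rclike_tendsto 𝕜).1 h
    (BoundedContinuousFunction.ofNormedAddCommGroup f hf C hC)

lemma norm_integral_wave_sub_le {μ μ' : Measure (Rd d)} [IsProbabilityMeasure μ]
    [IsProbabilityMeasure μ'] {ε : ℝ} (h : ∀ f : Rd d → ℝ, Continuous f → (∀ x, |f x| ≤ 1) →
      |∫ x, f x ∂μ - ∫ x, f x ∂μ'| ≤ ε) (ξ : Rd d) :
    ‖∫ x, wave x ξ ∂μ - ∫ x, wave x ξ ∂μ'‖ ≤ 2 * ε := by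
  have hi : ∀ (ρ : Measure (Rd d)) [IsProbabilityMeasure ρ], Integrable (fun x => wave x ξ) ρ :=
    fun ρ _ => Integrable.of_bound (C := 1) (by fun_prop)
      (Eventually.of_forall fun x => (norm_wave _ _).le)
  have h1 := h (fun x => (wave x ξ).re) (by fun_prop)
    fun x => (Complex.abs_re_le_norm _).trans (norm_wave _ _).le
  have h2 := h (fun x => (wave x ξ).im) (by fun_prop)
    fun x => (Complex.abs_im_le_norm _).trans (norm_wave _ _).le
  have e1 : ∀ (ρ : Measure (Rd d)) [IsProbabilityMeasure ρ],
      ∫ x, (wave x ξ).re ∂ρ = (∫ x, wave x ξ ∂ρ).re := fun ρ _ => integral_re (hi ρ)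
  have e2 : ∀ (ρ : Measure (Rd d)) [IsProbabilityMeasure ρ],
      ∫ x, (wave x ξ).im ∂ρ = (∫ x, wave x ξ ∂ρ).im := fun ρ _ => integral_im (hi ρ)
  rw [e1, e1, ← Complex.sub_re] at h1
  rw [e2, e2, ← Complex.sub_im] at h2
  linarith [Complex.norm_le_abs_re_add_abs_im (∫ x, wave x ξ ∂μ - ∫ x, wave x ξ ∂μ')]

/-- The characteristic functions converge uniformly, so their limit is continuous and the laws are
tight. Prokhorov's theorem supplies a measure with this limit as characteristic function, and Lévy's
theorem gives convergence of the whole sequence. -/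
lemma exists_tendsto_of_forall_abs_integral_sub_le {μ : ℕ → ProbabilityMeasure (Rd d)} {ε : ℕ → ℝ}
    (hε : Tendsto ε atTop (𝓝 0)) (h : ∀ n k, ∀ f : Rd d → ℝ, Continuous f → (∀ x, |f x| ≤ 1) →
      |∫ x, f x ∂(μ n : Measure (Rd d)) - ∫ x, f x ∂(μ k : Measure (Rd d))| ≤ ε n + ε k) :
    ∃ μ' : ProbabilityMeasure (Rd d), Tendsto μ atTop (𝓝 μ') := by
  have h1 : ∀ n k ξ, ‖charFun (μ n : Measure (Rd d)) ξ - charFun (μ k : Measure (Rd d)) ξ‖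
      ≤ 2 * (ε n + ε k) := fun n k ξ => by
    rw [charFun_eq_integral_wave, charFun_eq_integral_wave]
    exact norm_integral_wave_sub_le (h n k) ξ
  have h2 : ∀ ξ, ∃ z, Tendsto (fun n => charFun (μ n : Measure (Rd d)) ξ) atTop (𝓝 z) := by
    intro ξ
    refine cauchySeq_tendsto_of_complete (Metric.cauchySeq_iff.2 fun δ hδ => ?_)
    obtain ⟨N, hN⟩ := eventually_atTop.1 (hε.eventually_lt_const (u := δ / 4) (by positivity))
    refine ⟨N, fun n hn k hk => ?_⟩
    rw [dist_eq_norm]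
    linarith [h1 n k ξ, hN n hn, hN k hk]
  choose F hF using h2
  have h3 : ∀ n ξ, ‖charFun (μ n : Measure (Rd d)) ξ - F ξ‖ ≤ 2 * (ε n + 0) := fun n ξ =>
    le_of_tendsto_of_tendsto' ((hF ξ).const_sub _).norm
      ((hε.const_add (ε n)).const_mul 2) fun k => h1 n k ξ
  have hFc : Continuous F := by
    have : TendstoUniformly (fun n ξ => charFun (μ n : Measure (Rd d)) ξ) F atTop := by
      rw [Metric.tendstoUniformly_iff]
      intro δ hδ
      filter_upwards [hε.eventually_lt_const (u := δ / 2) (by positivity)] with n hn ξ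
      rw [dist_comm, dist_eq_norm]
      linarith [h3 n ξ]
    exact this.continuous (Frequently.of_forall fun n => by fun_prop)
  have htight : IsTightMeasureSet (Set.range fun n => (μ n : Measure (Rd d))) :=
    isTightMeasureSet_of_tendsto_charFun hFc.continuousAt hF
  have hcomp : IsCompact (closure (Set.range μ)) :=
    isCompact_closure_of_isTightMeasureSet (by
      convert htight using 1
      ext ρ
      simp)
  -- A limit along a nonprincipal ultrafilter suffices, since it serves only to identify the
  -- limiting characteristic function.
  obtain ⟨μ', -, hμ'⟩ := hcomp.ultrafilter_le_nhds ((hyperfilter ℕ).map μ)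
    (le_trans (by simp) (monotone_principal subset_closure))
  have hμ'' : Tendsto μ (hyperfilter ℕ : Filter ℕ) (𝓝 μ') := hμ'
  refine ⟨μ', ProbabilityMeasure.tendsto_iff_tendsto_charFun.2 fun ξ => ?_⟩
  have h4 : Tendsto (fun n => charFun (μ n : Measure (Rd d)) ξ) (hyperfilter ℕ : Filter ℕ)
      (𝓝 (charFun (μ' : Measure (Rd d)) ξ)) := by
    simp_rw [charFun_eq_integral_wave]
    exact tendsto_integral_of_tendsto hμ'' (C := 1) (by fun_prop) fun x => (norm_wave _ _).le
  rw [tendsto_nhds_unique h4 ((hF ξ).mono_left Nat.hyperfilter_le_atTop)]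
  exact hF ξ

/-- Euler motions with error 1/(n+1) are approximate mild solutions for the same drift, so
`IsMildApprox.compare` makes their laws Cauchy at every time; the Fourier equation passes to the
limit by dominated convergence. -/
theorem IsDrift.exists_mild {L : LevyTriplet d} {T : ℝ} (hT : 0 < T) (hL : L.HeatKernelBounds T)
    {b : ℝ → Rd d → Rd d} (hb : IsDrift T b) (m₀ : ProbabilityMeasure (Rd d)) :
    ∃ (m : ℝ → ProbabilityMeasure (Rd d)) (M : ℝ), ContinuousOn m (Icc 0 T) ∧ m 0 = m₀ ∧
      IsDriven L T m₀ (fun s => (m s : Measure (Rd d))) (fun _ x => x) (cutDrift T b) M := by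
  obtain ⟨M, hM0, hM, hlip⟩ := hb.exists_bound
  obtain ⟨a, C, hG⟩ := hL.hasGradientBound
  obtain ⟨K, -, hK, -⟩ := hL
  have hη : ∀ n : ℕ, (0 : ℝ) < 1 / (n + 1) := fun n => by positivity
  choose π X V hD hV using fun n => hb.exists_isDriven hK hT (m₀ : Measure (Rd d)) hM hlip (hη n)
  have hp := fun n => (hD n).prob
  have hcb : ∀ s ∈ Ioo 0 T, Continuous (cutDrift T b s) := fun s _ => hb.continuous_cutDrift s
  have hcM : ∀ s ∈ Ioo 0 T, ∀ x, ‖cutDrift T b s x‖ ≤ M := fun s _ => hM s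
  obtain ⟨c, hc0, hc⟩ := IsMildApprox.compare (m₀ := (m₀ : Measure (Rd d))) hG hcb hM0 hcM
  have happ := fun n => (hD n).isMildApprox hG hcb hcM
    fun s hs => hV n s (Ioo_subset_Ioc_self hs)
  let μ : ℕ → ℝ → ProbabilityMeasure (Rd d) := fun n t =>
    ⟨(π n t).map (X n t), (happ n).prob t⟩
  have hε : Tendsto (fun n : ℕ => c * (C * (1 / ((n : ℝ) + 1)))) atTop (𝓝 0) := by
    simpa using ((tendsto_one_div_add_atTop_nhds_zero_nat (𝕜 := ℝ)).const_mul C).const_mul c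
  have hC := hG.nonneg
  have hlim : ∀ t, ∃ μ' : ProbabilityMeasure (Rd d), t ∈ Icc 0 T →
      Tendsto (fun n => μ n t) atTop (𝓝 μ') := by
    intro t
    by_cases ht : t ∈ Icc 0 T
    · obtain ⟨μ', h⟩ := exists_tendsto_of_forall_abs_integral_sub_le (μ := fun n => μ n t) hε
        fun n k f hf hf1 => by
          have := hc (mul_nonneg hC (hη n).le) (mul_nonneg hC (hη k).le) (happ n) (happ k) t ht
            f hf hf1
          rw [mul_add] at this
          exact this
      exact ⟨μ', fun _ => h⟩
    · exact ⟨m₀, fun h => absurd h ht⟩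
  choose m hm using hlim
  set D : ℝ → Rd d → ℂ := driftTerm (fun s => (m s : Measure (Rd d))) (fun _ x => x) (cutDrift T b)
    with hDdef
  have hDn : ∀ ξ, ∀ s ∈ Ioo 0 T,
      Tendsto (fun n => driftTerm (π n) (X n) (V n) s ξ) atTop (𝓝 (D s ξ)) := by
    intro ξ s hs
    have hcs := hb.continuous_cutDrift s
    have hbd : ∀ x, ‖wave x ξ * ((inner ℝ (cutDrift T b s x) ξ : ℝ) : ℂ)‖ ≤ M * ‖ξ‖ := by
      intro x
      rw [norm_mul, norm_wave, one_mul, Complex.norm_real]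
      refine (norm_inner_le_norm _ _).trans ?_
      gcongr
      exact hM s x
    have h1 := tendsto_integral_of_tendsto (hm s (Ioo_subset_Icc_self hs))
      (f := fun x => wave x ξ * ((inner ℝ (cutDrift T b s x) ξ : ℝ) : ℂ)) (by fun_prop) hbd
    -- The velocity differs from the drift by at most 1/(n+1) in mean, which vanishes after pairing
    -- with ξ.
    have h2 : Tendsto (fun n => driftTerm (π n) (X n) (V n) s ξ
        - ∫ x, wave x ξ * ((inner ℝ (cutDrift T b s x) ξ : ℝ) : ℂ) ∂(μ n s : Measure (Rd d)))
        atTop (𝓝 0) := by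
      refine squeeze_zero_norm (a := fun n : ℕ => 1 / ((n : ℝ) + 1) * ‖ξ‖) (fun n => ?_)
        (by simpa using (tendsto_one_div_add_atTop_nhds_zero_nat (𝕜 := ℝ)).mul_const ‖ξ‖)
      have hXm := (hD n).measX s
      have hVm := (hD n).measV s
      simp only [μ, ProbabilityMeasure.coe_mk]
      rw [integral_map hXm.aemeasurable (by fun_prop), driftTerm, ← integral_sub]
      · have i1 : Integrable (fun w => ‖V n s w - cutDrift T b s (X n s w)‖) (π n s) := by
          refine Integrable.of_bound (C := M + M) (by fun_prop) (Eventually.of_forall fun w => ?_)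
          rw [norm_norm]
          exact (norm_sub_le _ _).trans (add_le_add ((hD n).boundV s w) (hM s _))
        refine (norm_integral_le_of_norm_le (i1.mul_const ‖ξ‖)
          (Eventually.of_forall fun w => ?_)).trans ?_
        · rw [← mul_sub, norm_mul, norm_wave, one_mul, ← Complex.ofReal_sub, ← inner_sub_left,
            Complex.norm_real]
          exact norm_inner_le_norm _ _
        · rw [integral_mul_const]
          gcongr
          exact hV n s (Ioo_subset_Ioc_self hs)
      · exact Integrable.of_bound (C := M * ‖ξ‖) (by fun_prop)
          (Eventually.of_forall fun w => (hD n).norm_integrand_le s w ξ)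
      · exact Integrable.of_bound (C := M * ‖ξ‖) (by fun_prop)
          (Eventually.of_forall fun w => hbd _)
    have h3 := h2.add h1
    simp only [sub_add_cancel, zero_add] at h3
    exact h3
  -- Continuity of the limit curve is not yet known, so measurability in time comes from the
  -- approximations. The limiting equation then yields continuity.
  have hDm : ∀ ξ, AEStronglyMeasurable (fun s => D s ξ) (volume.restrict (Ioo 0 T)) := by
    intro ξ
    refine aestronglyMeasurable_of_tendsto_ae atTop
      (fun n => ((hD n).measurable_driftTerm ξ).aestronglyMeasurable) ?_
    filter_upwards [ae_restrict_mem measurableSet_Ioo] with s hs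
    exact hDn ξ s hs
  have hDb : ∀ ξ s, ‖Complex.I * D s ξ‖ ≤ M * ‖ξ‖ := by
    intro ξ s
    rw [norm_mul, Complex.norm_I, one_mul]
    refine (norm_integral_le_of_norm_le_const (C := M * ‖ξ‖)
      (Eventually.of_forall fun x => ?_)).trans_eq (by simp)
    rw [norm_mul, norm_wave, one_mul, Complex.norm_real]
    refine (norm_inner_le_norm _ _).trans ?_
    gcongr
    exact hM s x
  have heq : ∀ t ∈ Icc 0 T, ∀ ξ, Complex.exp (t * L.symbol ξ)
      * ∫ x, wave x ξ ∂(m t : Measure (Rd d)) = charFun (m₀ : Measure (Rd d)) ξ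
        - ∫ s in Ioo 0 t, Complex.exp (s * L.symbol ξ) * (Complex.I * D s ξ) := by
    intro t ht ξ
    have h1 : Tendsto (fun n => Complex.exp (t * L.symbol ξ) * ∫ w, wave (X n t w) ξ ∂π n t) atTop
        (𝓝 (Complex.exp (t * L.symbol ξ) * ∫ x, wave x ξ ∂(m t : Measure (Rd d)))) := by
      refine Tendsto.const_mul _ ?_
      have := tendsto_integral_of_tendsto (hm t ht) (f := fun x => wave x ξ) (C := 1)
        (by fun_prop) fun x => (norm_wave _ _).le
      refine this.congr fun n => ?_
      simp only [μ, ProbabilityMeasure.coe_mk]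
      exact integral_map ((hD n).measX t).aemeasurable (by fun_prop)
    refine tendsto_nhds_unique h1 ?_
    simp_rw [fun n => (hD n).eq t ht ξ]
    refine Tendsto.const_sub _ ?_
    refine tendsto_integral_of_dominated_convergence
      (fun _ => Real.exp (T * ‖L.symbol ξ‖) * (M * ‖ξ‖)) (fun n => ?_) (integrable_const _)
      (fun n => ?_) ?_
    · have := (hD n).measurable_driftTerm ξ
      fun_prop
    · filter_upwards [ae_restrict_mem measurableSet_Ioo] with s hs
      rw [norm_mul, norm_mul, Complex.norm_I, one_mul]
      gcongr
      · exact norm_exp_mul_le hs.1.le (hs.2.le.trans ht.2)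
      · exact (hD n).norm_driftTerm_le s ξ
    · filter_upwards [ae_restrict_mem measurableSet_Ioo] with s hs
      exact ((hDn ξ s ⟨hs.1, hs.2.trans_le ht.2⟩).const_mul _).const_mul _
  have hcont : ContinuousOn m (Icc 0 T) := by
    have h1 : ∀ ξ, ContinuousOn (fun t => charFun (m t : Measure (Rd d)) ξ) (Icc 0 T) := by
      intro ξ
      have hi : IntegrableOn (fun s : ℝ => Complex.exp (s * L.symbol ξ) * (Complex.I * D s ξ))
          (Icc 0 T) := by
        rw [integrableOn_Icc_iff_integrableOn_Ioo]
        exact integrableOn_exp_mul ((hDm ξ).const_mul _) (hDb ξ)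
      have h2 := intervalIntegral.continuousOn_primitive (μ := volume) hi
      have h3 : ContinuousOn (fun t : ℝ => Complex.exp (-(t : ℂ) * L.symbol ξ)
          * (charFun (m₀ : Measure (Rd d)) ξ - ∫ s in Ioc 0 t,
            Complex.exp (s * L.symbol ξ) * (Complex.I * D s ξ))) (Icc 0 T) := by
        fun_prop
      refine h3.congr fun t ht => ?_
      beta_reduce
      rw [integral_Ioc_eq_integral_Ioo, ← heq t ht ξ, ← mul_assoc, ← Complex.exp_add,
        charFun_eq_integral_wave]
      simp
    intro t ht
    refine tendsto_of_seq_tendsto fun u hu => ProbabilityMeasure.tendsto_iff_tendsto_charFun.2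
      fun ξ => ?_
    exact (h1 ξ t ht).tendsto.comp hu
  refine ⟨m, M, hcont, ?_, fun s => inferInstance, fun _ => measurable_id,
    fun s => (hb.continuous_cutDrift s).measurable, hM, fun ξ => ?_, heq⟩
  · have h0 := heq 0 ⟨le_rfl, hT.le⟩
    have h1 : (m 0 : Measure (Rd d)) = m₀ := Measure.ext_of_charFun (funext fun ξ => by
      have := h0 ξ
      simp only [Complex.ofReal_zero, zero_mul, Complex.exp_zero, one_mul, Ioo_self,
        setIntegral_empty, sub_zero] at this
      rw [charFun_eq_integral_wave, this])
    exact Subtype.ext h1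
  · exact measurable_of_continuousOn_Ioo (hb.continuousOn_driftTerm hcont ξ)
      fun s hs => by simp [driftTerm, cutDrift_of_notMem hs]

end

/-! ### From mild solutions back to the weak form, for test functions constant in time. -/

section
variable {d : ℕ}

/-! ### Mild solutions are weak solutions -/

/-- A weakly continuous solution of the mild form of the equation. -/
structure IsMild (L : LevyTriplet d) (T : ℝ) (b : ℝ → Rd d → Rd d)
    (m₀ : ProbabilityMeasure (Rd d)) (m : ℝ → ProbabilityMeasure (Rd d)) (M : ℝ) : Prop where
  continuousOn : ContinuousOn m (Icc 0 T)
  zero : m 0 = m₀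
  driven : IsDriven L T m₀ (fun s => (m s : Measure (Rd d))) (fun _ x => x) (cutDrift T b) M

/-- The generator `𝓛 - b · D` at time `s`. -/
def generator (L : LevyTriplet d) (T : ℝ) (b : ℝ → Rd d → Rd d) (u : Rd d → ℝ) (s : ℝ)
    (x : Rd d) : ℝ :=
  L.op u x - fderiv ℝ u x (cutDrift T b s x)

lemma CB2.abs_generator_le {u : Rd d → ℝ} {M₀ M₁ M₂ : ℝ} (hu : CB2 u M₀ M₁ M₂)
    (L : LevyTriplet d) {T M : ℝ} {b : ℝ → Rd d → Rd d} (hM : ∀ s x, ‖cutDrift T b s x‖ ≤ M)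
    (s : ℝ) (x : Rd d) : |generator L T b u s x| ≤
      (‖L.B‖ + (∑ i, ∑ j, |L.A i j|) + 2 * ∫ z, min 1 (‖z‖ ^ 2) ∂L.ν) * (M₀ + M₁ + M₂)
        + M₁ * M := by
  refine (abs_sub _ _).trans (add_le_add (hu.abs_op_le L x) ?_)
  rw [← Real.norm_eq_abs]
  refine (ContinuousLinearMap.le_opNorm _ _).trans ?_
  have := hu.nonneg₁
  gcongr
  · exact hu.bound₁ x
  · exact hM s x

lemma CB2.continuous_generator {u : Rd d → ℝ} {M₀ M₁ M₂ : ℝ} (hu : CB2 u M₀ M₁ M₂)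
    (L : LevyTriplet d) {T : ℝ} {b : ℝ → Rd d → Rd d} (hb : IsDrift T b) (s : ℝ) :
    Continuous (generator L T b u s) := by
  have h1 := hu.continuous_op L
  have h2 := hu.continuous_fderiv
  have h3 := hb.continuous_cutDrift s
  unfold generator
  fun_prop

lemma CB2.continuousOn_integral_generator {u : Rd d → ℝ} {M₀ M₁ M₂ : ℝ} (hu : CB2 u M₀ M₁ M₂)
    (L : LevyTriplet d) {T : ℝ} {b : ℝ → Rd d → Rd d} (hb : IsDrift T b)
    {m : ℝ → ProbabilityMeasure (Rd d)} (hm : ContinuousOn m (Icc 0 T)) :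
    ContinuousOn (fun s => ∫ x, generator L T b u s x ∂(m s : Measure (Rd d))) (Ioo 0 T) := by
  obtain ⟨M, hM0, hM, -⟩ := hb.exists_bound
  refine continuousOn_integral (hm.mono Ioo_subset_Icc_self)
    (fun s _ => hu.continuous_generator L hb s) (fun s _ x => hu.abs_generator_le L hM s x)
    fun s hs ε hε => ?_
  have h1 := hu.nonneg₁
  filter_upwards [hb.eventually_norm_sub_le hs (ε := ε / (M₁ + 1)) (by positivity),
    self_mem_nhdsWithin] with r hr hr' x
  rw [generator, generator, sub_sub_sub_cancel_left, ← map_sub, cutDrift_of_mem hr',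
    cutDrift_of_mem hs]
  refine (ContinuousLinearMap.le_opNorm _ _).trans ?_
  calc _ ≤ M₁ * (ε / (M₁ + 1)) := by
        gcongr
        · exact hu.bound₁ x
        · rw [norm_sub_rev]; exact hr x
    _ ≤ (M₁ + 1) * (ε / (M₁ + 1)) := by gcongr; linarith
    _ = ε := by field_simp

/-- The velocity, on the Fourier side, of a mild solution. -/
def velocity (L : LevyTriplet d) (T : ℝ) (b : ℝ → Rd d → Rd d)
    (m : ℝ → ProbabilityMeasure (Rd d)) (s : ℝ) (ξ : Rd d) : ℂ :=
  -L.symbol ξ * (∫ x, wave x ξ ∂(m s : Measure (Rd d))) - Complex.I *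
    driftTerm (fun s => (m s : Measure (Rd d))) (fun _ x => x) (cutDrift T b) s ξ

namespace IsMild

variable {L : LevyTriplet d} {T M : ℝ} {b : ℝ → Rd d → Rd d} {m₀ : ProbabilityMeasure (Rd d)}
  {m : ℝ → ProbabilityMeasure (Rd d)} (hm : IsMild L T b m₀ m M)
include hm

lemma norm_velocity_le {C : ℝ} (hC0 : 0 ≤ C) (hC : ∀ ξ, ‖L.symbol ξ‖ ≤ C * (1 + ‖ξ‖ ^ 2)) (s : ℝ)
    (ξ : Rd d) : ‖velocity L T b m s ξ‖ ≤ (C + M) * (1 + ‖ξ‖ ^ 2) := by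
  have h1 : ‖∫ x, wave x ξ ∂(m s : Measure (Rd d))‖ ≤ 1 := by
    refine (norm_integral_le_of_norm_le_const (C := 1)
      (Eventually.of_forall fun x => (norm_wave _ _).le)).trans_eq (by simp)
  have h2 := hm.driven.norm_driftTerm_le s ξ
  have hM := hm.driven.nonneg
  refine (norm_sub_le _ _).trans ?_
  rw [norm_mul, norm_mul, norm_neg, Complex.norm_I, one_mul]
  calc _ ≤ C * (1 + ‖ξ‖ ^ 2) * 1 + M * ‖ξ‖ := by gcongr; exact hC ξ
    _ ≤ _ := by nlinarith [sq_nonneg (‖ξ‖ - 1)]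

variable (hb : IsDrift T b)
include hb

lemma continuousOn_integral_wave (ξ : Rd d) :
    ContinuousOn (fun s => ∫ x, wave x ξ ∂(m s : Measure (Rd d))) (Icc 0 T) :=
  continuousOn_integral hm.continuousOn (G := fun _ x => wave x ξ) (C := 1)
    (fun s _ => by fun_prop) (fun s _ x => (norm_wave _ _).le)
    fun s _ ε hε => Eventually.of_forall fun r x => by simp [hε.le]

lemma continuousOn_velocity (ξ : Rd d) :
    ContinuousOn (fun s => velocity L T b m s ξ) (Ioo 0 T) := by
  have h1 := (hm.continuousOn_integral_wave hb ξ).mono Ioo_subset_Icc_self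
  have h2 := hb.continuousOn_driftTerm hm.continuousOn ξ
  unfold velocity
  fun_prop

/-- Multiplying the Fourier equation by exp(-tΨ) and differentiating gives the velocity -Ψ m̂ minus
the drift term. It is continuous and bounded on (0,T), so it can be integrated back. -/
theorem integral_wave_sub {t : ℝ} (ht : t ∈ Icc 0 T) (ξ : Rd d) :
    ∫ x, wave x ξ ∂(m t : Measure (Rd d)) - ∫ x, wave x ξ ∂(m₀ : Measure (Rd d))
      = ∫ s in Ioo 0 t, velocity L T b m s ξ := by
  obtain ⟨C, hC0, hC⟩ := L.exists_norm_symbol_le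
  set P : ℝ → ℂ := fun s => ∫ x, wave x ξ ∂(m s : Measure (Rd d))
  set D : ℝ → ℂ := fun s =>
    driftTerm (fun s => (m s : Measure (Rd d))) (fun _ x => x) (cutDrift T b) s ξ
  have hD := hb.continuousOn_driftTerm hm.continuousOn ξ
  set F : ℝ → ℂ := fun s => Complex.exp (s * L.symbol ξ) * (Complex.I * D s)
  have hFi : ∀ s, IntegrableOn F (Ioo 0 s) := fun s =>
    integrableOn_exp_mul (C := M * ‖ξ‖)
      ((hm.driven.measurable_driftTerm ξ).const_mul Complex.I).aestronglyMeasurable fun s => by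
        rw [norm_mul, Complex.norm_I, one_mul]; exact hm.driven.norm_driftTerm_le s ξ
  have hder : ∀ s ∈ Ioo 0 t, HasDerivAt P (velocity L T b m s ξ) s := by
    intro s hs
    have hs' : s ∈ Ioo 0 T := ⟨hs.1, hs.2.trans_le ht.2⟩
    have h1 : HasDerivAt (fun r => ∫ q in 0..r, F q) (F s) s := by
      refine intervalIntegral.integral_hasDerivAt_right ?_ ?_ ?_
      · rw [intervalIntegrable_iff_integrableOn_Ioo_of_le hs.1.le]
        exact hFi s
      · have : Measurable F := by
          have := hm.driven.measurable_driftTerm ξ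
          fun_prop
        exact this.stronglyMeasurable.stronglyMeasurableAtFilter
      · have : ContinuousOn F (Ioo 0 T) := by
          simp only [F, D]
          fun_prop
        exact this.continuousAt (isOpen_Ioo.mem_nhds hs')
    have h2 : HasDerivAt (fun r : ℝ => Complex.exp (-((r : ℂ) * L.symbol ξ)))
        (Complex.exp (-((s : ℂ) * L.symbol ξ)) * -(1 * L.symbol ξ)) s :=
      ((Complex.ofRealCLM.hasDerivAt (x := s)).mul_const (L.symbol ξ)).neg.cexp
    have h3 := h2.mul (h1.const_sub (charFun (m₀ : Measure (Rd d)) ξ))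
    have hPe : ∀ r ∈ Ioo 0 T, Complex.exp (-((r : ℂ) * L.symbol ξ)) *
        (charFun (m₀ : Measure (Rd d)) ξ - ∫ q in 0..r, F q) = P r := by
      intro r hr
      rw [intervalIntegral.integral_of_le hr.1.le, integral_Ioc_eq_integral_Ioo,
        ← hm.driven.eq r (Ioo_subset_Icc_self hr) ξ, ← mul_assoc, ← Complex.exp_add]
      simp [P]
    refine (h3.congr_of_eventuallyEq (f₁ := P) ?_).congr_deriv ?_
    · filter_upwards [isOpen_Ioo.mem_nhds hs'] with r hr
      exact (hPe r hr).symm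
    · have e1 := hPe s hs'
      have e2 : Complex.exp (-((s : ℂ) * L.symbol ξ)) * Complex.exp (s * L.symbol ξ) = 1 := by
        rw [← Complex.exp_add]; simp
      simp only [velocity, F]
      change _ = -L.symbol ξ * P s - Complex.I * D s
      linear_combination -L.symbol ξ * e1 - (Complex.I * D s) * e2
  have hint : IntervalIntegrable (fun s => velocity L T b m s ξ) volume 0 t := by
    rw [intervalIntegrable_iff_integrableOn_Ioo_of_le ht.1]
    refine Integrable.mono' (g := fun _ => (C + M) * (1 + ‖ξ‖ ^ 2)) (integrable_const _) ?_
      (Eventually.of_forall fun s => hm.norm_velocity_le hC0 hC s ξ)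
    exact ((hm.continuousOn_velocity hb ξ).mono
      (Ioo_subset_Ioo_right ht.2)).aestronglyMeasurable measurableSet_Ioo
  have := intervalIntegral.integral_eq_sub_of_hasDerivAt_of_le ht.1
    ((hm.continuousOn_integral_wave hb ξ).mono (Icc_subset_Icc_right ht.2)) hder hint
  rw [intervalIntegral.integral_of_le ht.1, integral_Ioc_eq_integral_Ioo] at this
  rw [this, hm.zero]

/-- The identity moves the generator to the Fourier side by Fubini; the quadratic growth of the
velocity is matched by the weight of the amplitude. -/
lemma integral_generator_synth {g : Rd d → ℂ} (hg : IsAmplitude volume g) (s : ℝ) :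
    ∫ x, generator L T b (fun x => (synth volume g x).re) s x ∂(m s : Measure (Rd d))
      = (∫ ξ, g ξ * velocity L T b m s ξ).re := by
  obtain ⟨C, hC0, hC⟩ := L.exists_norm_symbol_le
  have hgm := hg.meas
  have hΨ := L.measurable_symbol
  have hcd := hb.continuous_cutDrift s
  have hM := hm.driven.nonneg
  set k : Rd d → Rd d → ℂ := fun x ξ => g ξ * (wave x ξ *
    (-L.symbol ξ - Complex.I * ((inner ℝ (cutDrift T b s x) ξ : ℝ) : ℂ))) with hk
  have hkm : AEStronglyMeasurable (Function.uncurry k)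
      ((m s : Measure (Rd d)).prod volume) := by
    have h1 : AEStronglyMeasurable (fun p : Rd d × Rd d => g p.2)
      ((m s : Measure (Rd d)).prod volume) := hgm.comp_snd
    have h2 : Measurable fun p : Rd d × Rd d => wave p.1 p.2 * (-L.symbol p.2 - Complex.I *
        ((inner ℝ (cutDrift T b s p.1) p.2 : ℝ) : ℂ)) := by fun_prop
    exact h1.mul h2.aestronglyMeasurable
  have hkb : ∀ x ξ, ‖k x ξ‖ ≤ (C + M) * ((1 + ‖ξ‖ ^ 2) * ‖g ξ‖) := by
    intro x ξ
    rw [hk]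
    simp only [norm_mul, norm_wave, one_mul]
    have h1 : ‖-L.symbol ξ - Complex.I * ((inner ℝ (cutDrift T b s x) ξ : ℝ) : ℂ)‖
        ≤ (C + M) * (1 + ‖ξ‖ ^ 2) := by
      refine (norm_sub_le _ _).trans ?_
      rw [norm_neg, norm_mul, Complex.norm_I, one_mul, Complex.norm_real]
      have h2 : ‖inner ℝ (cutDrift T b s x) ξ‖ ≤ M * ‖ξ‖ := by
        refine (norm_inner_le_norm _ _).trans ?_
        gcongr
        exact hm.driven.boundV s x
      nlinarith [hC ξ, sq_nonneg (‖ξ‖ - 1)]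
    calc _ ≤ ‖g ξ‖ * ((C + M) * (1 + ‖ξ‖ ^ 2)) := by gcongr
      _ = _ := by ring
  have hki : Integrable (Function.uncurry k) ((m s : Measure (Rd d)).prod volume) :=
    ((hg.int.const_mul (C + M)).comp_snd _).mono' hkm (Eventually.of_forall fun p => hkb p.1 p.2)
  have e1 : ∀ x, generator L T b (fun x => (synth volume g x).re) s x = (∫ ξ, k x ξ).re := by
    intro x
    rw [generator, L.op_synth_re hg, hg.fderiv_re_apply, ← Complex.sub_re, ← integral_sub]
    · congr 2; ext ξ
      rw [real_inner_comm _ ξ]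
      simp only [k]
      ring
    · refine (hg.int.const_mul C).mono' (by fun_prop) (Eventually.of_forall fun ξ => ?_)
      rw [norm_mul, norm_wave, one_mul, norm_mul, norm_neg, ← mul_assoc]
      gcongr
      exact hC ξ
    · refine (hg.integrable_norm_mul.const_mul M).mono' (by fun_prop)
        (Eventually.of_forall fun ξ => ?_)
      rw [norm_mul, norm_wave, one_mul, norm_mul, norm_mul, Complex.norm_I, one_mul,
        Complex.norm_real, ← mul_assoc]
      gcongr
      refine (norm_inner_le_norm _ _).trans ?_
      rw [mul_comm]
      gcongr
      exact hm.driven.boundV s x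
  simp_rw [e1]
  have e2 : ∫ x, (∫ ξ, k x ξ).re ∂(m s : Measure (Rd d))
      = (∫ x, (∫ ξ, k x ξ) ∂(m s : Measure (Rd d))).re := integral_re hki.integral_prod_left
  rw [e2, integral_integral_swap hki]
  congr 2; ext ξ
  simp only [k, velocity, driftTerm]
  rw [integral_const_mul]
  congr 1
  rw [← integral_const_mul, ← integral_const_mul, ← integral_sub]
  · congr 1; ext x; ring
  · exact Integrable.of_bound (C := ‖L.symbol ξ‖) (by fun_prop) (Eventually.of_forall fun x => by
      rw [norm_mul, norm_wave, mul_one, norm_neg])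
  · exact Integrable.of_bound (C := M * ‖ξ‖) (by fun_prop) (Eventually.of_forall fun x => by
      rw [norm_mul, Complex.norm_I, one_mul]; exact hm.driven.norm_integrand_le s x ξ)

/-- The identity for single plane waves is integrated against the amplitude g, and Fubini exchanges
time and frequency. -/
theorem weak_synth {g : Rd d → ℂ} (hg : IsAmplitude volume g) {t : ℝ} (ht : t ∈ Icc 0 T) :
    ∫ x, (synth volume g x).re ∂(m t : Measure (Rd d))
        - ∫ x, (synth volume g x).re ∂(m₀ : Measure (Rd d))
      = ∫ s in Ioo 0 t, ∫ x, generator L T b (fun x => (synth volume g x).re) s x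
          ∂(m s : Measure (Rd d)) := by
  obtain ⟨C, hC0, hC⟩ := L.exists_norm_symbol_le
  have hgm := hg.meas
  have e1 : ∀ μ : ProbabilityMeasure (Rd d), ∫ x, (synth volume g x).re ∂(μ : Measure (Rd d))
      = (∫ ξ, g ξ * ∫ x, wave x ξ ∂(μ : Measure (Rd d))).re := by
    intro μ
    have hi : Integrable (fun p : Rd d × Rd d => wave p.1 p.2 * g p.2)
        ((μ : Measure (Rd d)).prod volume) := by
      refine (hg.integrable.norm.comp_snd _).mono' ?_ (Eventually.of_forall fun p => ?_)
      · have h2 : AEStronglyMeasurable (fun p : Rd d × Rd d => g p.2)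
          ((μ : Measure (Rd d)).prod volume) := hgm.comp_snd
        exact (by fun_prop : Measurable fun p : Rd d × Rd d =>
          wave p.1 p.2).aestronglyMeasurable.mul h2
      · rw [norm_mul, norm_wave, one_mul]
    have h1 : ∫ x, (synth volume g x).re ∂(μ : Measure (Rd d))
      = (∫ x, synth volume g x ∂(μ : Measure (Rd d))).re := integral_re hi.integral_prod_left
    rw [h1]
    simp only [synth, smul_eq_mul]
    rw [integral_integral_swap (f := fun x ξ => wave x ξ * g ξ) hi]
    simp_rw [integral_mul_const, mul_comm]
  have hi : ∀ μ : ProbabilityMeasure (Rd d),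
      Integrable fun ξ => g ξ * ∫ x, wave x ξ ∂(μ : Measure (Rd d)) := by
    intro μ
    simp_rw [← charFun_eq_integral_wave]
    refine hg.integrable.norm.mono' (by fun_prop) (Eventually.of_forall fun ξ => ?_)
    rw [norm_mul]
    exact mul_le_of_le_one_right (norm_nonneg _) (norm_charFun_le_one ξ)
  rw [e1, e1, ← Complex.sub_re, ← integral_sub (hi _) (hi _)]
  simp_rw [← mul_sub, hm.integral_wave_sub hb ht, hm.integral_generator_synth hb hg]
  have hVi : Integrable (Function.uncurry fun s ξ => g ξ * velocity L T b m s ξ)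
      ((volume.restrict (Ioo 0 t)).prod volume) := by
    have hae : ∀ᵐ p ∂((volume.restrict (Ioo 0 t)).prod (volume : Measure (Rd d))),
        p.1 ∈ Ioo 0 t := Measure.quasiMeasurePreserving_fst.ae (ae_restrict_mem measurableSet_Ioo)
    refine ((hg.int.const_mul (C + M)).comp_snd (volume.restrict (Ioo 0 t))).mono' ?_
      (Eventually.of_forall fun p => ?_)
    · have h1 : AEStronglyMeasurable (fun p : ℝ × Rd d => g p.2)
        ((volume.restrict (Ioo 0 t)).prod volume) := hgm.comp_snd
      have hΨ := L.measurable_symbol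
      -- The curve is arbitrary outside [0,T], so joint measurability is obtained after truncating
      -- in time: continuity in ξ for each s and measurability in s for each ξ.
      have h2 : Measurable fun p : ℝ × Rd d => (Ioo 0 T).indicator
          (fun s => ∫ x, wave x p.2 ∂(m s : Measure (Rd d))) p.1 := by
        refine (stronglyMeasurable_uncurry_of_continuous_of_stronglyMeasurable
          (u := fun (ξ : Rd d) (s : ℝ) => (Ioo 0 T).indicator
            (fun s => ∫ x, wave x ξ ∂(m s : Measure (Rd d))) s) (fun s => ?_)
          (fun ξ => ?_)).measurable.comp measurable_swap
        · by_cases hs : s ∈ Ioo 0 T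
          · simp only [indicator_of_mem hs, ← charFun_eq_integral_wave]
            fun_prop
          · simp only [indicator_of_notMem hs]
            exact continuous_const
        · exact (measurable_of_continuousOn_Ioo (((hm.continuousOn_integral_wave hb ξ).mono
            Ioo_subset_Icc_self).congr fun s hs => indicator_of_mem hs _)
              fun s hs => indicator_of_notMem hs _).stronglyMeasurable
      have h3 := hm.driven.measurable_driftTerm_uncurry
      have h4 : Measurable fun p : ℝ × Rd d => -L.symbol p.2 * (Ioo 0 T).indicator
          (fun s => ∫ x, wave x p.2 ∂(m s : Measure (Rd d))) p.1 - Complex.I *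
          driftTerm (fun s => (m s : Measure (Rd d))) (fun _ x => x) (cutDrift T b) p.1 p.2 := by
        fun_prop
      refine h1.mul (h4.aestronglyMeasurable.congr ?_)
      filter_upwards [hae] with p hp
      rw [indicator_of_mem (show p.1 ∈ Ioo 0 T from ⟨hp.1, hp.2.trans_le ht.2⟩)]
      rfl
    · rw [Function.uncurry_def, norm_mul]
      calc _ ≤ ‖g p.2‖ * ((C + M) * (1 + ‖p.2‖ ^ 2)) := by
            gcongr; exact hm.norm_velocity_le hC0 hC _ _
        _ = _ := by ring
  have e2 : ∫ s in Ioo 0 t, (∫ ξ, g ξ * velocity L T b m s ξ).re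
      = (∫ s in Ioo 0 t, ∫ ξ, g ξ * velocity L T b m s ξ).re := integral_re hVi.integral_prod_left
  rw [e2, integral_integral_swap hVi]
  simp_rw [integral_const_mul]

/-- The weak form of the equation for test functions that do not depend on time. -/
theorem weak {u : Rd d → ℝ} {M₀ M₁ M₂ : ℝ} (hu : CB2 u M₀ M₁ M₂) {t : ℝ} (ht : t ∈ Icc 0 T) :
    ∫ x, u x ∂(m t : Measure (Rd d)) - ∫ x, u x ∂(m₀ : Measure (Rd d))
      = ∫ s in Ioo 0 t, ∫ x, generator L T b u s x ∂(m s : Measure (Rd d)) := by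
  -- The approximations share their C² bounds and converge pointwise with two derivatives, so each
  -- integral converges by domination.
  obtain ⟨N₀, N₁, N₂, hN, h1, h2⟩ := hu.exists_smoothApprox
  have hM := hm.driven.boundV
  have hw : ∀ n, ∫ x, smoothApprox n u x ∂(m t : Measure (Rd d))
        - ∫ x, smoothApprox n u x ∂(m₀ : Measure (Rd d))
      = ∫ s in Ioo 0 t, ∫ x, generator L T b (smoothApprox n u) s x ∂(m s : Measure (Rd d)) := by
    intro n
    obtain ⟨g, hg, hgu⟩ := exists_isAmplitude (contDiff_smoothApprox n hu.continuous)
      (hasCompactSupport_smoothApprox n u)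
    have := hm.weak_synth hb hg ht
    simp only [hgu] at this
    exact this
  have h0 : ∀ x, Tendsto (fun n => smoothApprox n u x) atTop (𝓝 (u x)) :=
    tendsto_smoothApprox hu.continuous
  have l1 : ∀ μ : ProbabilityMeasure (Rd d),
      Tendsto (fun n => ∫ x, smoothApprox n u x ∂(μ : Measure (Rd d))) atTop
        (𝓝 (∫ x, u x ∂(μ : Measure (Rd d)))) := fun μ =>
    tendsto_integral_of_dominated_convergence (fun _ => N₀)
      (fun n => (hN n).continuous.aestronglyMeasurable) (integrable_const _)
      (fun n => Eventually.of_forall (hN n).bound₀) (Eventually.of_forall h0)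
  have hgen : ∀ s x, Tendsto (fun n => generator L T b (smoothApprox n u) s x) atTop
      (𝓝 (generator L T b u s x)) := fun s x =>
    (L.tendsto_op hN x h0 (h1 x) (h2 x)).sub (tendsto_clm_apply (h1 x) _)
  have l2 : ∀ s, Tendsto (fun n => ∫ x, generator L T b (smoothApprox n u) s x
      ∂(m s : Measure (Rd d))) atTop (𝓝 (∫ x, generator L T b u s x ∂(m s : Measure (Rd d)))) :=
    fun s => tendsto_integral_of_dominated_convergence _
      (fun n => ((hN n).continuous_generator L hb s).aestronglyMeasurable) (integrable_const _)
      (fun n => Eventually.of_forall fun x => (hN n).abs_generator_le L hM s x)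
      (Eventually.of_forall (hgen s))
  refine tendsto_nhds_unique ((l1 (m t)).sub (l1 m₀)) ?_
  simp_rw [hw]
  refine tendsto_integral_of_dominated_convergence _ (fun n => ?_) (integrable_const _)
    (fun n => Eventually.of_forall fun s => abs_integral_le_of_abs_le fun x =>
      (hN n).abs_generator_le L hM s x) (Eventually.of_forall l2)
  exact (((hN n).continuousOn_integral_generator L hb hm.continuousOn).mono
    (Ioo_subset_Ioo_right ht.2)).aestronglyMeasurable measurableSet_Ioo

/-- The increments of `∫ u dm(t)`. -/
theorem weak_sub {u : Rd d → ℝ} {M₀ M₁ M₂ : ℝ} (hu : CB2 u M₀ M₁ M₂) {s t : ℝ} (hs : 0 ≤ s)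
    (hst : s ≤ t) (ht : t ≤ T) :
    ∫ x, u x ∂(m t : Measure (Rd d)) - ∫ x, u x ∂(m s : Measure (Rd d))
      = ∫ r in Ioo s t, ∫ x, generator L T b u r x ∂(m r : Measure (Rd d)) := by
  have hM := hm.driven.boundV
  have hi : ∀ r q, 0 ≤ r → r ≤ q → q ≤ T → IntervalIntegrable
      (fun r => ∫ x, generator L T b u r x ∂(m r : Measure (Rd d))) volume r q := by
    intro r q hr hrq hq
    rw [intervalIntegrable_iff_integrableOn_Ioo_of_le hrq]
    refine Integrable.mono' (integrable_const _) ?_ (Eventually.of_forall fun s =>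
      abs_integral_le_of_abs_le fun x => hu.abs_generator_le L hM s x)
    exact ((hu.continuousOn_integral_generator L hb hm.continuousOn).mono
      (Ioo_subset_Ioo hr hq)).aestronglyMeasurable measurableSet_Ioo
  have h1 := hm.weak hb hu (t := t) ⟨hs.trans hst, ht⟩
  have h2 := hm.weak hb hu (t := s) ⟨hs, hst.trans ht⟩
  rw [← integral_Ioc_eq_integral_Ioo, ← intervalIntegral.integral_of_le] at h1 h2 ⊢
  · rw [← intervalIntegral.integral_add_adjacent_intervals (hi 0 s le_rfl hs (hst.trans ht))
      (hi s t hs hst ht), ← h2] at h1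
    linarith
  all_goals linarith

end IsMild

end

/-! ### A priori estimates: regularity in time, tightness, moments. -/

section
variable {d : ℕ}

/-! ### Smooth approximation of Lipschitz functions -/

/-- The increment falls on the weight, whose derivative is integrable. The constant depends on the
bump alone, so the lemma also applies to gradients. -/
lemma exists_norm_mollify_sub_le (φ : ContDiffBump (0 : Rd d)) : ∃ C, 0 ≤ C ∧
    ∀ {F : Type} [NormedAddCommGroup F] [NormedSpace ℝ F] [CompleteSpace F] {f : Rd d → F} {M : ℝ},
      Continuous f → (∀ x, ‖f x‖ ≤ M) → ∀ x v,
        ‖mollify φ f (x + v) - mollify φ f x‖ ≤ M * (C * ‖v‖) := by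
  have hc : ContDiff ℝ 1 (φ.normed volume) := φ.contDiff_normed
  have hfin : ∫⁻ x, ‖fderiv ℝ (φ.normed volume) x‖ₑ ≠ ⊤ :=
    ((hc.continuous_fderiv one_ne_zero).integrable_of_hasCompactSupport
      (φ.hasCompactSupport_normed.fderiv ℝ)).2.ne
  refine ⟨(∫⁻ x, ‖fderiv ℝ (φ.normed volume) x‖ₑ).toReal, ENNReal.toReal_nonneg, ?_⟩
  intro F _ _ _ f M hf hM x v
  have hM0 : 0 ≤ M := (norm_nonneg _).trans (hM 0)
  have e1 : ∀ x, mollify φ f x = ∫ w, φ.normed volume (x - w) • f w := by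
    intro x
    rw [mollify, ← integral_sub_left_eq_self _ volume x]
    simp
  have i1 : ∀ x, Integrable fun w => φ.normed volume (x - w) • f w := by
    intro x
    have := (integrable_mollify φ hf x).comp_sub_left x
    simpa using this
  have i2 : Integrable fun w => ‖φ.normed volume (w + v) - φ.normed volume w‖ :=
    ((φ.integrable_normed.comp_add_right v).sub φ.integrable_normed).norm
  rw [e1, e1, ← integral_sub (i1 _) (i1 _)]
  calc _ ≤ ∫ w, M * ‖φ.normed volume (x - w + v) - φ.normed volume (x - w)‖ := by
        refine norm_integral_le_of_norm_le ((i2.comp_sub_left x).const_mul M)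
          (Eventually.of_forall fun w => ?_)
        rw [← sub_smul, norm_smul, mul_comm, show x + v - w = x - w + v by abel]
        gcongr
        exact hM w
    _ = M * ∫ w, ‖φ.normed volume (w + v) - φ.normed volume w‖ := by
        rw [integral_const_mul, integral_sub_left_eq_self
          (fun w => ‖φ.normed volume (w + v) - φ.normed volume w‖) volume x]
    _ ≤ _ := by
        gcongr
        have i3 := ((φ.integrable_normed (μ := volume)).comp_add_right v).sub
          (φ.integrable_normed (μ := volume))
        have e2 := integral_norm_eq_lintegral_enorm i3.aestronglyMeasurable
        simp only [Pi.sub_apply] at e2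
        rw [e2, ← toReal_enorm v, ← ENNReal.toReal_mul]
        exact ENNReal.toReal_mono (ENNReal.mul_ne_top hfin enorm_ne_top)
          (lintegral_enorm_add_sub_le hc v)

lemma norm_mollify_sub_self_le (φ : ContDiffBump (0 : Rd d)) (hφ : φ.rOut = 1) {f : Rd d → ℝ}
    {K : ℝ} (hK : 0 ≤ K) (hf : Continuous f) (h : ∀ x y, ‖f x - f y‖ ≤ K * ‖x - y‖) (x : Rd d) :
    ‖mollify φ f x - f x‖ ≤ K := by
  rw [mollify_eq_convolution, ← dist_eq_norm]
  refine φ.dist_normed_convolution_le hf.aestronglyMeasurable fun y hy => ?_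
  rw [hφ, Metric.mem_ball, dist_eq_norm] at hy
  rw [dist_eq_norm]
  exact (h y x).trans (mul_le_of_le_one_right hK hy.le)

/-- Mollification at unit scale is applied twice. The first makes f differentiable with gradient at
most K, the second bounds the Hessian by the sup of that gradient. Each one moves the function by at
most K. -/
lemma exists_CB2_approx (d : ℕ) : ∃ C, 0 ≤ C ∧ ∀ (f : Rd d → ℝ) (K : ℝ), 0 ≤ K → Continuous f →
    (∀ x, |f x| ≤ 1) → (∀ x y, ‖f x - f y‖ ≤ K * ‖x - y‖) →
    ∃ u, CB2 u 1 K (K * C) ∧ ∀ x, |u x - f x| ≤ 2 * K := by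
  obtain ⟨C, hC, h⟩ := exists_norm_mollify_sub_le (bump d 0)
  have hout : (bump d 0).rOut = 1 := by simp [bump]
  refine ⟨C, hC, fun f K hK hf hf1 hfK => ?_⟩
  set φ := bump d 0
  set g := mollify φ f
  have hg : ContDiff ℝ ∞ g := contDiff_mollify φ hf
  have hg1 : ContDiff ℝ 1 g := contDiff_infty.1 hg 1
  have hgK : ∀ x y, ‖g x - g y‖ ≤ K * ‖x - y‖ := fun x y => by
    have := norm_mollify_sub_le φ hf hfK y (x - y)
    rwa [add_sub_cancel] at this
  have hgd : ∀ x, ‖fderiv ℝ g x‖ ≤ K := fun x =>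
    norm_fderiv_le_of_lip' ℝ hK (Eventually.of_forall fun y => hgK y x)
  have hud : fderiv ℝ (mollify φ g) = mollify φ (fderiv ℝ g) :=
    funext fun x => (hasFDerivAt_mollify φ hg1 hgd x).fderiv
  refine ⟨mollify φ g, ⟨contDiff_infty.1 (contDiff_mollify φ hg.continuous) 2,
    norm_mollify_le φ (f := g) (norm_mollify_le φ (f := f) hf1), fun x => ?_, fun x => ?_⟩,
    fun x => ?_⟩
  · rw [hud]
    exact norm_mollify_le φ hgd x
  · rw [hud]
    refine norm_fderiv_le_of_lip' ℝ (by positivity) (Eventually.of_forall fun y => ?_)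
    have := h (hg1.continuous_fderiv one_ne_zero) hgd x (y - x)
    rwa [add_sub_cancel, ← mul_assoc] at this
  · have h1 := norm_mollify_sub_self_le φ hout hK hf hfK x
    have h2 := norm_mollify_sub_self_le φ hout hK hg.continuous hgK x
    rw [← Real.norm_eq_abs, ← sub_add_sub_cancel _ (g x)]
    exact (norm_add_le _ _).trans (by linarith)

/-- The unit-scale result is applied to φ(ε·), which is ε-Lipschitz, and rescaled back. The gradient
bound stays 1 and the Hessian bound becomes C/ε. -/
lemma exists_CB2_approx_scale (d : ℕ) : ∃ C, 0 ≤ C ∧ ∀ φ ∈ Lip d, ∀ ε : ℝ, 0 < ε →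
    ∃ u, CB2 u 1 1 (C / ε) ∧ ∀ x, |u x - φ x| ≤ 2 * ε := by
  obtain ⟨C, hC, h⟩ := exists_CB2_approx d
  refine ⟨C, hC, fun φ hφ ε hε => ?_⟩
  obtain ⟨χ, hχ, hχφ⟩ := h (fun x => φ (ε • x)) ε hε.le
    ((continuous_of_mem_Lip hφ).comp (continuous_const_smul ε)) (fun x => hφ.1 _) fun x y => by
      refine (hφ.2 _ _).trans_eq ?_
      rw [← smul_sub, norm_smul, Real.norm_of_nonneg hε.le]
  have hei : 0 ≤ ε⁻¹ := by positivity
  refine ⟨fun x => χ (ε⁻¹ • x), ⟨hχ.contDiff.comp (contDiff_const_smul _), fun x => hχ.bound₀ _,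
    fun x => ?_, fun x => ?_⟩, fun x => ?_⟩
  · rw [fderiv_comp_const_smul, norm_smul, Real.norm_of_nonneg hei, inv_mul_le_iff₀ hε, mul_one]
    exact hχ.bound₁ _
  · rw [fderiv_fderiv_comp_const_smul hχ.contDiff]
    refine (ContinuousLinearMap.opNorm_smul_le _ _).trans ?_
    rw [Real.norm_of_nonneg (by positivity)]
    calc _ ≤ ε⁻¹ * ε⁻¹ * (ε * C) := by gcongr; exact hχ.bound₂ _
      _ = C / ε := by field_simp
  · have := hχφ (ε⁻¹ • x)
    rwa [smul_inv_smul₀ hε.ne'] at this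

/-! ### Hölder continuity in time -/

lemma IsDrift.norm_cutDrift_le {T : ℝ} {b : ℝ → Rd d → Rd d} (hb : IsDrift T b) (s : ℝ)
    (x : Rd d) : ‖cutDrift T b s x‖ ≤ driftNorm T b := by
  by_cases hs : s ∈ Ioo 0 T
  · rw [cutDrift_of_mem hs]; exact hb.norm_le_driftNorm hs x
  · rw [cutDrift_of_notMem hs]; simpa using hb.driftNorm_nonneg

lemma IsMild.abs_integral_sub_le {L : LevyTriplet d} {T M : ℝ} {b : ℝ → Rd d → Rd d}
    {m₀ : ProbabilityMeasure (Rd d)} {m : ℝ → ProbabilityMeasure (Rd d)}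
    (hm : IsMild L T b m₀ m M) (hb : IsDrift T b) {u : Rd d → ℝ} {M₀ M₁ M₂ : ℝ}
    (hu : CB2 u M₀ M₁ M₂) {s t : ℝ} (hs : 0 ≤ s) (hst : s ≤ t) (ht : t ≤ T) :
    |∫ x, u x ∂(m t : Measure (Rd d)) - ∫ x, u x ∂(m s : Measure (Rd d))| ≤
      ((‖L.B‖ + (∑ i, ∑ j, |L.A i j|) + 2 * ∫ z, min 1 (‖z‖ ^ 2) ∂L.ν) * (M₀ + M₁ + M₂)
        + M₁ * driftNorm T b) * (t - s) := by
  rw [hm.weak_sub hb hu hs hst ht, ← Real.norm_eq_abs]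
  refine (norm_setIntegral_le_of_norm_le_const (by simp) fun r _ =>
    abs_integral_le_of_abs_le fun x =>
      hu.abs_generator_le L hb.norm_cutDrift_le r x).trans_eq ?_
  rw [measureReal_def, Real.volume_Ioo, ENNReal.toReal_ofReal (by linarith)]

/-- The choice ε = √(t-s) balances the approximation error 4ε against the Hessian contribution
(C/ε)(t-s). -/
theorem exists_holder_bound (L : LevyTriplet d) {T : ℝ} (hT : 0 < T) :
    ∃ c₀ : ℝ, 0 < c₀ ∧ ∀ b : ℝ → Rd d → Rd d, IsDrift T b →
      ∀ (m₀ : ProbabilityMeasure (Rd d)) (m : ℝ → ProbabilityMeasure (Rd d)) (M : ℝ),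
      IsMild L T b m₀ m M → ∀ s ∈ Icc 0 T, ∀ t ∈ Icc 0 T,
        d₀ (m s) (m t) ≤ c₀ * (1 + driftNorm T b) * |s - t| ^ (1 / 2 : ℝ) := by
  obtain ⟨C, hC, hC'⟩ := exists_CB2_approx_scale d
  set κ : ℝ := ‖L.B‖ + (∑ i, ∑ j, |L.A i j|) + 2 * ∫ z, min 1 (‖z‖ ^ 2) ∂L.ν
  have hκ : 0 ≤ κ := by positivity
  -- The terms linear in t - s are weakened to √T √(t-s); the remaining κC comes from the Hessian
  -- and 4 from two approximation errors of 2ε.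
  refine ⟨√T * (2 * κ + 1) + κ * C + 4, by positivity, fun b hb m₀ m M hm => ?_⟩
  have hN := hb.driftNorm_nonneg
  have key : ∀ s t, 0 ≤ s → s < t → t ≤ T → ∀ φ ∈ Lip d,
      |∫ x, φ x ∂(m t : Measure (Rd d)) - ∫ x, φ x ∂(m s : Measure (Rd d))|
        ≤ (√T * (2 * κ + 1) + κ * C + 4) * (1 + driftNorm T b) * |s - t| ^ (1 / 2 : ℝ) := by
    intro s t hs hst ht φ hφ
    rw [abs_sub_comm s t, abs_of_pos (sub_pos.2 hst), ← Real.sqrt_eq_rpow]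
    set ε := √(t - s)
    have hε : 0 < ε := Real.sqrt_pos.2 (sub_pos.2 hst)
    have hε2 : t - s = ε * ε := (Real.mul_self_sqrt (sub_pos.2 hst).le).symm
    have hεT : ε ≤ √T := Real.sqrt_le_sqrt (by linarith)
    obtain ⟨u, hu, huφ⟩ := hC' φ hφ ε hε
    have h1 := hm.abs_integral_sub_le hb hu hs hst.le ht
    have h2 : ∀ μ : ProbabilityMeasure (Rd d),
        |∫ x, φ x ∂(μ : Measure (Rd d)) - ∫ x, u x ∂(μ : Measure (Rd d))| ≤ 2 * ε := by
      intro μ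
      rw [← integral_sub]
      · exact abs_integral_le_of_abs_le fun x => by rw [abs_sub_comm]; exact huφ x
      · exact Integrable.of_bound (continuous_of_mem_Lip hφ).aestronglyMeasurable 1
          (Eventually.of_forall hφ.1)
      · exact Integrable.of_bound hu.continuous.aestronglyMeasurable 1
          (Eventually.of_forall hu.bound₀)
    have h3 := abs_le.1 (h2 (m t))
    have h4 := abs_le.1 (h2 (m s))
    have h5 : (κ * (1 + 1 + C / ε) + 1 * driftNorm T b) * (t - s)
        = ε * (2 * κ + driftNorm T b) * ε + κ * C * ε := by
      rw [hε2]; field_simp; ring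
    rw [h5] at h1
    have h6 : |∫ x, φ x ∂(m t : Measure (Rd d)) - ∫ x, φ x ∂(m s : Measure (Rd d))|
        ≤ ε * (2 * κ + driftNorm T b) * ε + κ * C * ε + 4 * ε := by
      have := abs_le.1 h1
      rw [abs_le]
      constructor <;> linarith
    refine h6.trans ?_
    calc _ ≤ √T * (2 * κ + driftNorm T b) * ε + κ * C * ε + 4 * ε := by gcongr
      _ = (√T * (2 * κ + driftNorm T b) + κ * C + 4) * ε := by ring
      _ ≤ ((√T * (2 * κ + 1) + κ * C + 4) * (1 + driftNorm T b)) * ε := by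
          gcongr
          have a1 : 0 ≤ √T * κ * driftNorm T b := by positivity
          have a2 : 0 ≤ κ * C * driftNorm T b := by positivity
          have a3 : 0 ≤ √T := by positivity
          nlinarith
  intro s hs t ht
  rcases lt_trichotomy s t with hst | rfl | hst
  · exact d₀_le (key s t hs.1 hst ht.2)
  · refine d₀_le fun φ _ => ?_
    simp only [sub_self, abs_zero]
    positivity
  · refine d₀_le fun φ hφ => ?_
    rw [abs_sub_comm, abs_sub_comm s t]
    exact key t s ht.1 hst hs.2 φ hφ

lemma isContinuousCurve_of_holder {T c : ℝ} {m : ℝ → ProbabilityMeasure (Rd d)}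
    (h : ∀ s ∈ Icc 0 T, ∀ t ∈ Icc 0 T, d₀ (m s) (m t) ≤ c * |s - t| ^ (1 / 2 : ℝ)) :
    IsContinuousCurve T m := by
  intro t ht
  have h1 : Tendsto (fun s : ℝ => c * |s - t| ^ (1 / 2 : ℝ)) (𝓝[Icc 0 T] t) (𝓝 0) := by
    have : Continuous fun s : ℝ => c * |s - t| ^ (1 / 2 : ℝ) :=
      continuous_const.mul ((by fun_prop : Continuous fun s : ℝ => |s - t|).rpow_const
        fun _ => Or.inr (by norm_num))
    have h2 := (this.tendsto t).mono_left (nhdsWithin_le_nhds (s := Icc 0 T))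
    simpa using h2
  refine squeeze_zero' (Eventually.of_forall fun s => d₀_nonneg _ _) ?_ h1
  filter_upwards [self_mem_nhdsWithin] with s hs
  exact h s hs t ht

/-- The image of [0,T] is weakly compact, hence tight by the converse half of Prokhorov's theorem.
-/
lemma isTightMeasureSet_of_continuousOn {T : ℝ} {m : ℝ → ProbabilityMeasure (Rd d)}
    (hm : ContinuousOn m (Icc 0 T)) :
    IsTightMeasureSet {μ : Measure (Rd d) | ∃ t ∈ Icc 0 T, μ = m t} := by
  refine (isTightMeasureSet_of_isCompact_closure
    (isCompact_Icc.image_of_continuousOn hm).closure).subset ?_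
  rintro μ ⟨t, ht, rfl⟩
  exact ⟨m t, ⟨t, ht, rfl⟩, rfl⟩

end

section
variable {d : ℕ}

/-! ### Generalized moments -/

lemma norm_fderiv_fderiv_le {u : Rd d → ℝ} {M : ℝ} {x : Rd d} (h : ‖iteratedFDeriv ℝ 2 u x‖ ≤ M) :
    ‖fderiv ℝ (fderiv ℝ u) x‖ ≤ M := by
  refine ContinuousLinearMap.opNorm_le_bound₂ _ ((norm_nonneg _).trans h) fun v w => ?_
  have h1 := (iteratedFDeriv ℝ 2 u x).le_opNorm ![v, w]
  rw [iteratedFDeriv_two_apply] at h1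
  simp only [Fin.prod_univ_two, Matrix.cons_val_zero, Matrix.cons_val_one] at h1
  refine h1.trans ?_
  rw [← mul_assoc]
  gcongr

/-- A bounded increasing transformation of nonnegative functions, close to the identity for
large `R`. -/
def saturate (R : ℝ) (ψ : Rd d → ℝ) (x : Rd d) : ℝ := R * ψ x / (R + ψ x)

namespace IsTightnessFunction

variable {ψ : Rd d → ℝ} (hψ : IsTightnessFunction ψ)
include hψ

lemma norm_fderiv_le (x : Rd d) : ‖fderiv ℝ ψ x‖ ≤ ⨆ x, ‖fderiv ℝ ψ x‖ := by
  obtain ⟨M, hM⟩ := hψ.bounded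
  exact le_ciSup (f := fun x => ‖fderiv ℝ ψ x‖) ⟨M, by rintro _ ⟨x, rfl⟩; exact (hM x).1⟩ x

lemma norm_fderiv_two_le (x : Rd d) :
    ‖fderiv ℝ (fderiv ℝ ψ) x‖ ≤ ⨆ x, ‖iteratedFDeriv ℝ 2 ψ x‖ := by
  obtain ⟨M, hM⟩ := hψ.bounded
  exact norm_fderiv_fderiv_le (le_ciSup (f := fun x => ‖iteratedFDeriv ℝ 2 ψ x‖)
    ⟨M, by rintro _ ⟨x, rfl⟩; exact (hM x).2⟩ x)

/-- A function with zero gradient is constant and cannot tend to infinity on a noncompact space; d ≥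
1 provides noncompactness. Positivity is needed because `momentConst` divides by this supremum. -/
lemma iSup_norm_fderiv_pos (hd : 1 ≤ d) : 0 < ⨆ x, ‖fderiv ℝ ψ x‖ := by
  have : Nonempty (Fin d) := ⟨⟨0, hd⟩⟩
  have : NoncompactSpace (Rd d) := NormedSpace.noncompactSpace ℝ (Rd d)
  by_contra! h
  have h0 : ∀ x, fderiv ℝ ψ x = 0 := fun x => norm_le_zero_iff.1 ((hψ.norm_fderiv_le x).trans h)
  have h1 := is_const_of_fderiv_eq_zero (hψ.contDiff.differentiable (by norm_num)) h0
  obtain ⟨x, hx⟩ := (hψ.tendsto.eventually_gt_atTop (ψ 0)).exists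
  exact hx.ne (h1 0 x)

lemma hasFDerivAt_saturate {R : ℝ} (hR : 0 < R) (x : Rd d) :
    HasFDerivAt (saturate R ψ) ((R / (R + ψ x)) ^ 2 • fderiv ℝ ψ x) x := by
  have h0 := hψ.nonneg x
  have h1 : R + ψ x ≠ 0 := by positivity
  have hd := (hψ.contDiff.differentiable (by norm_num) x).hasFDerivAt
  have h2 : HasDerivAt (fun r : ℝ => R * r / (R + r)) ((R / (R + ψ x)) ^ 2) (ψ x) := by
    have := ((hasDerivAt_id (ψ x)).const_mul R).div ((hasDerivAt_id (ψ x)).const_add R) h1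
    refine this.congr_deriv ?_
    simp only [id]
    field_simp
    ring
  exact h2.comp_hasFDerivAt x hd

lemma hasFDerivAt_saturate_deriv {R : ℝ} (hR : 0 < R) (x : Rd d) :
    HasFDerivAt (fun x => (R / (R + ψ x)) ^ 2)
      ((-2 * R ^ 2 / (R + ψ x) ^ 3) • fderiv ℝ ψ x) x := by
  have h0 := hψ.nonneg x
  have h1 : R + ψ x ≠ 0 := by positivity
  have hd := (hψ.contDiff.differentiable (by norm_num) x).hasFDerivAt
  have h2 : HasDerivAt (fun r : ℝ => (R / (R + r)) ^ 2) (-2 * R ^ 2 / (R + ψ x) ^ 3) (ψ x) := by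
    have := (((hasDerivAt_const (ψ x) R).div ((hasDerivAt_id (ψ x)).const_add R) h1).pow 2)
    refine this.congr_deriv ?_
    simp only [id, Pi.div_apply, Nat.cast_ofNat, Nat.add_one_sub_one, pow_one]
    field_simp
    ring
  exact h2.comp_hasFDerivAt x hd

/-- The profile r ↦ Rr/(R+r) has slope (R/(R+r))² ≤ 1 and second derivative of modulus 2R²/(R+r)³ ≤
2 for R ≥ 1. Only the sup bound depends on R. -/
lemma saturate_CB2 {R : ℝ} (hR : 1 ≤ R) : CB2 (saturate R ψ) R (⨆ x, ‖fderiv ℝ ψ x‖)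
    ((⨆ x, ‖iteratedFDeriv ℝ 2 ψ x‖) + 2 * (⨆ x, ‖fderiv ℝ ψ x‖) ^ 2) := by
  have hR0 : 0 < R := by linarith
  have hn := hψ.nonneg
  have hfd : fderiv ℝ (saturate R ψ) = fun x => (R / (R + ψ x)) ^ 2 • fderiv ℝ ψ x :=
    funext fun x => (hψ.hasFDerivAt_saturate hR0 x).fderiv
  have hle : ∀ x, (R / (R + ψ x)) ^ 2 ≤ 1 := fun x => by
    have := hn x
    have h1 : R / (R + ψ x) ≤ 1 := div_le_one_of_le₀ (by linarith) (by positivity)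
    exact pow_le_one₀ (by positivity) h1
  refine ⟨?_, fun x => ?_, fun x => ?_, fun x => ?_⟩
  · have hc := hψ.contDiff
    have : ∀ x, R + ψ x ≠ 0 := fun x => by have := hn x; positivity
    exact (contDiff_const.mul hc).div (contDiff_const.add hc) this
  · have := hn x
    rw [saturate, abs_of_nonneg (by positivity), div_le_iff₀ (by positivity)]
    nlinarith
  · rw [hfd]
    simp only
    refine (ContinuousLinearMap.opNorm_smul_le _ _).trans ?_
    rw [Real.norm_of_nonneg (by positivity)]
    exact (mul_le_of_le_one_left (by positivity) (hle x)).trans (hψ.norm_fderiv_le x)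
  · have hx := hn x
    have hd : DifferentiableAt ℝ (fderiv ℝ ψ) x :=
      (hψ.contDiff.fderiv_right (m := 1) (by norm_num)).differentiable (by norm_num) x
    have h1 := hψ.hasFDerivAt_saturate_deriv hR0 x
    rw [hfd]
    refine (norm_fderiv_smul_le h1.differentiableAt hd).trans (add_le_add ?_ ?_)
    · rw [abs_of_nonneg (by positivity)]
      exact (mul_le_of_le_one_left (by positivity) (hle x)).trans (hψ.norm_fderiv_two_le x)
    · rw [h1.fderiv, norm_smul, mul_assoc, ← sq]
      have h2 : ‖-2 * R ^ 2 / (R + ψ x) ^ 3‖ ≤ 2 := by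
        rw [norm_div, norm_mul, norm_neg, Real.norm_of_nonneg (by positivity : (0:ℝ) ≤ 2),
          Real.norm_of_nonneg (by positivity), Real.norm_of_nonneg (by positivity),
          div_le_iff₀ (by positivity)]
        have : R ^ 2 ≤ (R + ψ x) ^ 3 := by
          calc R ^ 2 ≤ R ^ 3 := pow_le_pow_right₀ hR (by norm_num)
            _ ≤ _ := by gcongr; linarith
        linarith
      gcongr
      exact hψ.norm_fderiv_le x

/-- The profile is increasing with slope at most one, so the subadditivity of ψ bounds upward jumps
uniformly in R. A one-sided bound suffices for an upper moment estimate. -/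
lemma saturate_add_sub_le {R : ℝ} (hR : 0 < R) (x z : Rd d) :
    saturate R ψ (x + z) - saturate R ψ x ≤ ψ z := by
  have h1 := hψ.nonneg x
  have h2 := hψ.nonneg z
  have h3 := hψ.nonneg (x + z)
  have h4 := hψ.subadditive x z
  rw [saturate, saturate, div_sub_div _ _ (by positivity) (by positivity),
    div_le_iff₀ (by positivity)]
  have e : R * ψ (x + z) * (R + ψ x) - (R + ψ (x + z)) * (R * ψ x)
      = R ^ 2 * (ψ (x + z) - ψ x) := by ring
  rw [e]
  have : R ^ 2 ≤ (R + ψ (x + z)) * (R + ψ x) := by nlinarith [mul_nonneg h1 h3]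
  calc R ^ 2 * (ψ (x + z) - ψ x) ≤ R ^ 2 * ψ z := by gcongr; linarith
    _ ≤ _ := by rw [mul_comm]; gcongr

lemma tendsto_saturate (x : Rd d) :
    Tendsto (fun n : ℕ => saturate ((n : ℝ) + 1) ψ x) atTop (𝓝 (ψ x)) := by
  have h0 := hψ.nonneg x
  have h1 : Tendsto (fun n : ℕ => ψ x / (1 + ψ x * (1 / ((n : ℝ) + 1)))) atTop
      (𝓝 (ψ x / (1 + ψ x * 0))) :=
    tendsto_const_nhds.div (tendsto_const_nhds.add
      (tendsto_one_div_add_atTop_nhds_zero_nat.const_mul _)) (by simp)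
  simp only [mul_zero, add_zero, div_one] at h1
  refine h1.congr fun n => ?_
  rw [saturate]
  field_simp

end IsTightnessFunction

/-- The constant in the bound on generalized moments. -/
def momentConst (ψ : Rd d → ℝ) : ℝ :=
  d + 1 + (d ^ 2 + 1) * (((⨆ x, ‖iteratedFDeriv ℝ 2 ψ x‖) + 2 * (⨆ x, ‖fderiv ℝ ψ x‖) ^ 2)
    / ⨆ x, ‖fderiv ℝ ψ x‖)

lemma iSup_norm_nonneg {ι E : Type*} [NormedAddCommGroup E] (f : ι → E) : 0 ≤ ⨆ x, ‖f x‖ :=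
  Real.iSup_nonneg fun _ => norm_nonneg _

lemma momentConst_pos (ψ : Rd d → ℝ) : 0 < momentConst ψ := by
  have h1 := iSup_norm_nonneg (fderiv ℝ ψ)
  have h2 := iSup_norm_nonneg (iteratedFDeriv ℝ 2 ψ)
  unfold momentConst
  positivity

lemma norm_le_mul_iSup_abs (B : Rd d) : ‖B‖ ≤ d * ⨆ i, |B i| := by
  have hle : ∀ i, |B i| ≤ ⨆ i, |B i| := fun i =>
    le_ciSup (f := fun i => |B i|) (Set.finite_range _).bddAbove i
  rw [EuclideanSpace.norm_eq]
  refine Real.sqrt_le_iff.2 ⟨mul_nonneg d.cast_nonneg (Real.iSup_nonneg fun _ => abs_nonneg _), ?_⟩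
  calc ∑ i, ‖B i‖ ^ 2 ≤ ∑ _i : Fin d, (⨆ i, |B i|) ^ 2 :=
        Finset.sum_le_sum fun i _ => pow_le_pow_left₀ (norm_nonneg _) (hle i) 2
    _ = d * (⨆ i, |B i|) ^ 2 := by simp
    _ ≤ (d * ⨆ i, |B i|) ^ 2 := by
        rw [mul_pow]
        gcongr
        exact_mod_cast Nat.le_self_pow two_ne_zero d

lemma abs_apply_le_norm_toEuclideanCLM (A : Matrix (Fin d) (Fin d) ℝ) (i j : Fin d) :
    |A i j| ≤ ‖Matrix.toEuclideanCLM (𝕜 := ℝ) A‖ := by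
  have h1 : A i j = (Matrix.toEuclideanCLM (𝕜 := ℝ) A (EuclideanSpace.single j 1)) i := by
    simp [Matrix.ofLp_toEuclideanCLM]
  rw [h1, ← Real.norm_eq_abs]
  refine (PiLp.norm_apply_le _ i).trans ((ContinuousLinearMap.le_opNorm _ _).trans_eq ?_)
  simp

/-- Jumps smaller than 1 use the Hessian bound Q and larger ones use subadditivity. The powers of d
come from comparing |B| with its largest coordinate and from summing over the entries of A. -/
lemma IsTightnessFunction.generator_saturate_le (hd : 1 ≤ d) {ψ : Rd d → ℝ}
    (hψ : IsTightnessFunction ψ) (L : LevyTriplet d) (hψν : IntegrableOn ψ {z | 1 ≤ ‖z‖} L.ν)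
    {T : ℝ} {b : ℝ → Rd d → Rd d} (hb : IsDrift T b) {R : ℝ} (hR : 1 ≤ R) (s : ℝ) (x : Rd d) :
    generator L T b (saturate R ψ) s x ≤ (⨆ x, ‖fderiv ℝ ψ x‖) * (momentConst ψ *
      (‖Matrix.toEuclideanCLM (𝕜 := ℝ) L.A‖ + (⨆ i, |L.B i|) + driftNorm T b
        + ∫ z in {z | ‖z‖ < 1}, ‖z‖ ^ 2 ∂L.ν)) + ∫ z in {z | 1 ≤ ‖z‖}, ψ z ∂L.ν := by
  have hu := hψ.saturate_CB2 hR
  have hP := hψ.iSup_norm_fderiv_pos hd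
  set P := ⨆ x, ‖fderiv ℝ ψ x‖
  set Q := (⨆ x, ‖iteratedFDeriv ℝ 2 ψ x‖) + 2 * P ^ 2 with hQ
  have hQ0 : 0 ≤ Q := hu.nonneg₂
  set u := saturate R ψ
  set a := ‖Matrix.toEuclideanCLM (𝕜 := ℝ) L.A‖
  set β := ⨆ i, |L.B i|
  have hβ : 0 ≤ β := Real.iSup_nonneg fun _ => abs_nonneg _
  have ha : 0 ≤ a := norm_nonneg _
  have hN := hb.driftNorm_nonneg
  have hI : 0 ≤ ∫ z in {z : Rd d | ‖z‖ < 1}, ‖z‖ ^ 2 ∂L.ν := integral_nonneg fun z => by positivity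
  set I := ∫ z in {z : Rd d | ‖z‖ < 1}, ‖z‖ ^ 2 ∂L.ν
  have e1 : fderiv ℝ u x L.B ≤ P * (d * β) := by
    refine (Real.le_norm_self _).trans ((ContinuousLinearMap.le_opNorm _ _).trans ?_)
    gcongr
    · exact hu.bound₁ x
    · exact norm_le_mul_iSup_abs _
  have e2 : -fderiv ℝ u x (cutDrift T b s x) ≤ P * driftNorm T b := by
    rw [← map_neg]
    refine (Real.le_norm_self _).trans ((ContinuousLinearMap.le_opNorm _ _).trans ?_)
    rw [norm_neg]
    gcongr
    · exact hu.bound₁ x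
    · exact hb.norm_cutDrift_le s x
  have e3 : ∑ i, ∑ j, L.A i j * fderiv ℝ (fderiv ℝ u) x (EuclideanSpace.single i 1)
      (EuclideanSpace.single j 1) ≤ d ^ 2 * (a * Q) := by
    calc _ ≤ ∑ _i : Fin d, ∑ _j : Fin d, a * Q := by
          refine Finset.sum_le_sum fun i _ => Finset.sum_le_sum fun j _ => ?_
          refine (le_abs_self _).trans ?_
          rw [abs_mul]
          gcongr
          · exact abs_apply_le_norm_toEuclideanCLM _ _ _
          · rw [← Real.norm_eq_abs]
            refine (ContinuousLinearMap.le_opNorm₂ _ _ _).trans ?_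
            simpa using hu.bound₂ x
      _ = _ := by simp; ring
  have hball : Metric.ball (0 : Rd d) 1 = {z | ‖z‖ < 1} := by
    ext z; rw [Metric.mem_ball, dist_zero_right]; rfl
  have hcompl : (Metric.ball (0 : Rd d) 1)ᶜ = {z | 1 ≤ ‖z‖} := by
    ext z; rw [mem_compl_iff, Metric.mem_ball, dist_zero_right, not_lt]; rfl
  have hball_m : MeasurableSet (Metric.ball (0 : Rd d) 1) := Metric.isOpen_ball.measurableSet
  have hj := hu.integrable_jump L x
  have e4 : ∫ z, jump u x z ∂L.ν ≤ Q * I + ∫ z in {z | 1 ≤ ‖z‖}, ψ z ∂L.ν := by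
    rw [← integral_add_compl hball_m hj]
    refine add_le_add ?_ ?_
    · have hi : IntegrableOn (fun z : Rd d => ‖z‖ ^ 2) (Metric.ball 0 1) L.ν := by
        refine L.integrable_min.integrableOn.congr_fun (fun z hz => ?_) hball_m
        rw [Metric.mem_ball, dist_zero_right] at hz
        exact min_eq_right (by nlinarith [norm_nonneg z])
      simp only [I]
      rw [← integral_const_mul, ← hball]
      refine setIntegral_mono_on hj.integrableOn (hi.const_mul Q) hball_m fun z hz => ?_
      rw [jump, indicator_of_mem hz]
      exact (le_abs_self _).trans (abs_taylor_le hu.contDiff hu.bound₂ x z)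
    · rw [hcompl]
      refine setIntegral_mono_on hj.integrableOn hψν (hcompl ▸ hball_m.compl) fun z hz => ?_
      rw [jump, indicator_of_notMem (by rw [← mem_compl_iff, hcompl]; exact hz), sub_zero]
      exact hψ.saturate_add_sub_le (by linarith) x z
  rw [generator, L.op_eq]
  -- `momentConst` contains Q/P so that the prefactor P = ‖Dψ‖_∞ of the stated bound restores the
  -- Hessian term.
  have e5 : P * momentConst ψ = P * (d + 1) + (d ^ 2 + 1) * Q := by
    change P * (d + 1 + (d ^ 2 + 1) * (Q / P)) = _
    field_simp
  have e6 : P * (momentConst ψ * (a + β + driftNorm T b + I))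
      = (P * (d + 1) + (d ^ 2 + 1) * Q) * (a + β + driftNorm T b + I) := by
    rw [← mul_assoc, e5]
  rw [e6]
  have hd0 : (0 : ℝ) ≤ d := d.cast_nonneg
  have f1 : 0 ≤ P * (d + 1) * a + P * β + P * d * driftNorm T b + P * (d + 1) * I := by positivity
  have f2 : 0 ≤ Q * a + (d ^ 2 + 1) * Q * β + (d ^ 2 + 1) * Q * driftNorm T b + d ^ 2 * Q * I := by
    positivity
  nlinarith

/-- The weak form is tested with saturations of ψ; their bound is uniform in n, and Fatou's lemma
yields both finiteness and the estimate. -/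
theorem IsMild.moment_le (hd : 1 ≤ d) {L : LevyTriplet d} {T M : ℝ} {b : ℝ → Rd d → Rd d}
    {m₀ : ProbabilityMeasure (Rd d)} {m : ℝ → ProbabilityMeasure (Rd d)}
    (hm : IsMild L T b m₀ m M) (hb : IsDrift T b) {ψ : Rd d → ℝ} (hψ : IsTightnessFunction ψ)
    (hψ₀ : Integrable ψ (m₀ : Measure (Rd d))) (hψν : IntegrableOn ψ {z | 1 ≤ ‖z‖} L.ν)
    {t : ℝ} (ht : t ∈ Icc 0 T) : Integrable ψ (m t : Measure (Rd d)) ∧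
      ∫ x, ψ x ∂(m t : Measure (Rd d)) ≤ ∫ x, ψ x ∂(m₀ : Measure (Rd d))
        + (⨆ x, ‖fderiv ℝ ψ x‖) * (2 + momentConst ψ * T *
            (‖Matrix.toEuclideanCLM (𝕜 := ℝ) L.A‖ + (⨆ i, |L.B i|) + driftNorm T b
              + ∫ z in {z | ‖z‖ < 1}, ‖z‖ ^ 2 ∂L.ν))
        + T * ∫ z in {z | 1 ≤ ‖z‖}, ψ z ∂L.ν := by
  set P := ⨆ x, ‖fderiv ℝ ψ x‖
  set W := ‖Matrix.toEuclideanCLM (𝕜 := ℝ) L.A‖ + (⨆ i, |L.B i|) + driftNorm T b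
    + ∫ z in {z | ‖z‖ < 1}, ‖z‖ ^ 2 ∂L.ν
  set J := ∫ z in {z | 1 ≤ ‖z‖}, ψ z ∂L.ν
  have hP : 0 ≤ P := (hψ.iSup_norm_fderiv_pos hd).le
  have hW : 0 ≤ W := by
    have h1 : 0 ≤ ⨆ i, |L.B i| := Real.iSup_nonneg fun _ => abs_nonneg _
    have h2 := hb.driftNorm_nonneg
    have h3 : 0 ≤ ∫ z in {z : Rd d | ‖z‖ < 1}, ‖z‖ ^ 2 ∂L.ν :=
      integral_nonneg fun z => by positivity
    positivity
  have hJ : 0 ≤ J := integral_nonneg hψ.nonneg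
  have hc := momentConst_pos ψ
  have h0 : 0 ≤ ∫ x, ψ x ∂(m₀ : Measure (Rd d)) := integral_nonneg hψ.nonneg
  set K := ∫ x, ψ x ∂(m₀ : Measure (Rd d)) + P * (2 + momentConst ψ * T * W) + T * J with hK
  have hT : 0 ≤ T := ht.1.trans ht.2
  have hK0 : 0 ≤ K := by positivity
  have hsat : ∀ n : ℕ, ∫ x, saturate ((n : ℝ) + 1) ψ x ∂(m t : Measure (Rd d)) ≤ K := by
    intro n
    have hn : (1 : ℝ) ≤ n + 1 := by linarith [n.cast_nonneg (α := ℝ)]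
    have hu := hψ.saturate_CB2 hn
    have h1 := hm.weak hb hu ht
    have h2 : ∫ x, saturate ((n : ℝ) + 1) ψ x ∂(m₀ : Measure (Rd d))
        ≤ ∫ x, ψ x ∂(m₀ : Measure (Rd d)) := by
      refine integral_mono (Integrable.of_bound hu.continuous.aestronglyMeasurable _
        (Eventually.of_forall hu.bound₀)) hψ₀ fun x => ?_
      have := hψ.nonneg x
      simp only [saturate]
      rw [div_le_iff₀ (by positivity)]
      nlinarith
    have h3 : ∫ s in Ioo 0 t, ∫ x, generator L T b (saturate ((n : ℝ) + 1) ψ) s x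
        ∂(m s : Measure (Rd d)) ≤ ∫ s in Ioo 0 t, (P * (momentConst ψ * W) + J) := by
      refine setIntegral_mono_on ?_ (integrable_const _) measurableSet_Ioo fun s hs => ?_
      · refine Integrable.mono' (integrable_const _) ?_ (Eventually.of_forall fun s =>
          abs_integral_le_of_abs_le fun x => hu.abs_generator_le L hm.driven.boundV s x)
        exact ((hu.continuousOn_integral_generator L hb hm.continuousOn).mono
          (Ioo_subset_Ioo_right ht.2)).aestronglyMeasurable measurableSet_Ioo
      · calc _ ≤ ∫ _x, (P * (momentConst ψ * W) + J) ∂(m s : Measure (Rd d)) := by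
              refine integral_mono (Integrable.of_bound
                (hu.continuous_generator L hb s).aestronglyMeasurable _
                (Eventually.of_forall fun x => hu.abs_generator_le L hm.driven.boundV s x))
                (integrable_const _) fun x => hψ.generator_saturate_le hd L hψν hb hn s x
          _ = _ := by simp
    have h4 : ∫ s in Ioo 0 t, (P * (momentConst ψ * W) + J) ≤ T * (P * (momentConst ψ * W) + J) := by
      rw [setIntegral_const, measureReal_def, Real.volume_Ioo, sub_zero,
        ENNReal.toReal_ofReal ht.1, smul_eq_mul]
      have : 0 ≤ P * (momentConst ψ * W) + J := by positivity
      gcongr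
      exact ht.2
    have h5 : T * (P * (momentConst ψ * W) + J) = P * (momentConst ψ * T * W) + T * J := by ring
    rw [hK]
    linarith
  -- Fatou's lemma along the saturations, which converge pointwise to ψ.
  have hlint : ∫⁻ x, ENNReal.ofReal (ψ x) ∂(m t : Measure (Rd d)) ≤ ENNReal.ofReal K := by
    have h1 : ∀ x, ENNReal.ofReal (ψ x)
        = liminf (fun n : ℕ => ENNReal.ofReal (saturate ((n : ℝ) + 1) ψ x)) atTop := fun x =>
      ((ENNReal.continuous_ofReal.tendsto _).comp (hψ.tendsto_saturate x)).liminf_eq.symm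
    have hu := fun n : ℕ => hψ.saturate_CB2 (R := (n : ℝ) + 1)
      (by linarith [n.cast_nonneg (α := ℝ)])
    simp_rw [h1]
    refine (lintegral_liminf_le fun n =>
      ENNReal.measurable_ofReal.comp (hu n).continuous.measurable).trans ?_
    refine liminf_le_of_le (by isBoundedDefault) fun a ha => ?_
    obtain ⟨n, hn⟩ := ha.exists
    refine hn.trans ?_
    simp only [Function.comp_apply]
    rw [← ofReal_integral_eq_lintegral_ofReal]
    · exact ENNReal.ofReal_le_ofReal (hsat n)
    · exact Integrable.of_bound (hu n).continuous.aestronglyMeasurable _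
        (Eventually.of_forall (hu n).bound₀)
    · refine Eventually.of_forall fun x => ?_
      have := hψ.nonneg x
      simp only [saturate, Pi.zero_apply]
      positivity
  have hψm : AEStronglyMeasurable ψ (m t : Measure (Rd d)) :=
    hψ.contDiff.continuous.aestronglyMeasurable
  refine ⟨⟨hψm, ?_⟩, ?_⟩
  · rw [hasFiniteIntegral_iff_ofReal (Eventually.of_forall hψ.nonneg)]
    exact hlint.trans_lt ENNReal.ofReal_lt_top
  · rw [integral_eq_lintegral_of_nonneg_ae (Eventually.of_forall hψ.nonneg) hψm]
    exact ENNReal.toReal_le_of_le_ofReal hK0 hlint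

end

/-! ### The weak form for test functions varying in time. -/

section
variable {d : ℕ}

/-! ### Test functions depending on time -/

/-- Measure and integrand vary together. Joint convergence near each x gives uniform convergence on
compact sets, and tightness of the curve controls the rest. -/
lemma tendsto_integral_of_tendsto_nhds {ι : Type*} {l : Filter ι} {T C t : ℝ}
    {m : ℝ → ProbabilityMeasure (Rd d)} (hm : ContinuousOn m (Icc 0 T)) (ht : t ∈ Icc 0 T)
    {σ : ι → ℝ} (hσ : Tendsto σ l (𝓝[Icc 0 T] t)) {G : ι → Rd d → ℝ} {G₀ : Rd d → ℝ}
    (hGc : ∀ᶠ i in l, Continuous (G i)) (hG₀c : Continuous G₀) (hC : ∀ᶠ i in l, ∀ x, |G i x| ≤ C)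
    (hC₀ : ∀ x, |G₀ x| ≤ C)
    (hG : ∀ x, Tendsto (fun p : ι × Rd d => G p.1 p.2) (l ×ˢ 𝓝 x) (𝓝 (G₀ x))) :
    Tendsto (fun i => ∫ x, G i x ∂(m (σ i) : Measure (Rd d))) l
      (𝓝 (∫ x, G₀ x ∂(m t : Measure (Rd d)))) := by
  have hC0 : 0 ≤ C := (abs_nonneg _).trans (hC₀ 0)
  have h1 : Tendsto (fun i => ∫ x, G₀ x ∂(m (σ i) : Measure (Rd d))) l
      (𝓝 (∫ x, G₀ x ∂(m t : Measure (Rd d)))) :=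
    tendsto_integral_of_tendsto ((hm t ht).tendsto.comp hσ) hG₀c hC₀
  have hloc : TendstoLocallyUniformly G G₀ l := by
    rw [Metric.tendstoLocallyUniformly_iff]
    intro ε hε x
    have h2 : ∀ᶠ p in l ×ˢ 𝓝 x, dist (G₀ p.2) (G p.1 p.2) < ε := by
      have h3 : Tendsto (fun p : ι × Rd d => dist (G₀ p.2) (G p.1 p.2)) (l ×ˢ 𝓝 x)
          (𝓝 (dist (G₀ x) (G₀ x))) :=
        ((hG₀c.tendsto x).comp tendsto_snd).dist (hG x)
      rw [dist_self] at h3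
      exact h3.eventually_lt_const hε
    obtain ⟨pa, hpa, pb, hpb, h⟩ := eventually_prod_iff.1 h2
    exact ⟨{y | pb y}, hpb, hpa.mono fun i hi y hy => h hi hy⟩
  have h2 : Tendsto (fun i => ∫ x, G i x ∂(m (σ i) : Measure (Rd d))
      - ∫ x, G₀ x ∂(m (σ i) : Measure (Rd d))) l (𝓝 0) := by
    rw [Metric.tendsto_nhds]
    intro ε hε
    -- The tail costs at most 2Cδ ≤ ε/2 and the compact set at most ε/4.
    set δ : ℝ := ε / (4 * (C + 1))
    have hδ : 0 < δ := by positivity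
    obtain ⟨K, hK, hKm⟩ := isTightMeasureSet_iff_exists_isCompact_measure_compl_le.1
      (isTightMeasureSet_of_continuousOn hm) (ENNReal.ofReal δ) (ENNReal.ofReal_pos.2 hδ)
    have hu := (tendstoLocallyUniformlyOn_iff_tendstoUniformlyOn_of_compact hK).1
      hloc.tendstoLocallyUniformlyOn
    filter_upwards [Metric.tendstoUniformlyOn_iff.1 hu (ε / 4) (by positivity), hGc, hC,
      hσ.eventually self_mem_nhdsWithin] with i hi hic hiC hiσ
    set μ : Measure (Rd d) := (m (σ i) : Measure (Rd d))
    have hμK : μ.real Kᶜ ≤ δ :=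
      ENNReal.toReal_le_of_le_ofReal hδ.le (hKm μ ⟨σ i, hiσ, rfl⟩)
    have i1 : Integrable (G i) μ := Integrable.of_bound hic.aestronglyMeasurable C
      (Eventually.of_forall hiC)
    have i2 : Integrable G₀ μ := Integrable.of_bound hG₀c.aestronglyMeasurable C
      (Eventually.of_forall hC₀)
    have i3 : Integrable (fun x => G i x - G₀ x) μ := i1.sub i2
    rw [dist_zero_right, ← integral_sub i1 i2, ← integral_add_compl hK.measurableSet i3]
    refine (norm_add_le _ _).trans_lt ?_
    have a1 : ‖∫ x in K, (G i x - G₀ x) ∂μ‖ ≤ ε / 4 * μ.real K :=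
      norm_setIntegral_le_of_norm_le_const (measure_lt_top _ _) fun x hx => by
        rw [← dist_eq_norm, dist_comm]; exact (hi x hx).le
    have a2 : ‖∫ x in Kᶜ, (G i x - G₀ x) ∂μ‖ ≤ (C + C) * μ.real Kᶜ :=
      norm_setIntegral_le_of_norm_le_const (measure_lt_top _ _) fun x _ =>
        (norm_sub_le _ _).trans (add_le_add (hiC x) (hC₀ x))
    have a3 : μ.real K ≤ 1 := measureReal_le_one
    have a4 : (C + C) * δ ≤ ε / 2 := by
      calc (C + C) * δ ≤ (2 * (C + 1)) * δ := by gcongr; linarith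
        _ = ε / 2 := by simp only [δ]; field_simp; norm_num
    have a5 : (C + C) * μ.real Kᶜ ≤ (C + C) * δ := by gcongr
    have a6 : ε / 4 * μ.real K ≤ ε / 4 * 1 := by gcongr
    refine lt_of_le_of_lt (add_le_add a1 a2) ?_
    linarith
  have h3 := h2.add h1
  simp only [sub_add_cancel, zero_add] at h3
  exact h3

namespace IsTestFunction

variable {T : ℝ} {φ : ℝ → Rd d → ℝ} (hφ : IsTestFunction T φ)
include hφ

lemma exists_CB2 : ∃ C, ∀ t ∈ Icc 0 T, CB2 (φ t) C C C ∧
    ∀ x, |derivWithin (fun s => φ s x) (Icc 0 T) t| ≤ C := by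
  obtain ⟨C, hC⟩ := hφ.bounded
  exact ⟨C, fun t ht => ⟨⟨hφ.contDiff t ht, fun x => (hC t ht x).1, fun x => (hC t ht x).2.2.1,
    fun x => norm_fderiv_fderiv_le (hC t ht x).2.2.2⟩, fun x => (hC t ht x).2.1⟩⟩

lemma abs_sub_le {a ε : ℝ} {x : Rd d} {S : Set ℝ} (hS : S ⊆ Icc 0 T) (hconv : Convex ℝ S)
    (h : ∀ r ∈ S, |derivWithin (fun s => φ s x) (Icc 0 T) r - a| ≤ ε) {s t : ℝ}
    (hs : s ∈ S) (ht : t ∈ S) : |φ s x - φ t x - (s - t) * a| ≤ ε * |s - t| := by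
  have h1 : ∀ r ∈ S, HasDerivWithinAt (fun r => φ r x - r * a)
      (derivWithin (fun s => φ s x) (Icc 0 T) r - a) S r := by
    intro r hr
    have h2 := ((hφ.differentiableOn x r (hS hr)).hasDerivWithinAt.mono hS).sub
      ((hasDerivWithinAt_id r S).mul_const a)
    exact h2.congr_deriv (by simp)
  have := hconv.norm_image_sub_le_of_norm_hasDerivWithin_le h1 h ht hs
  rw [Real.norm_eq_abs, Real.norm_eq_abs] at this
  rwa [show φ s x - s * a - (φ t x - t * a) = φ s x - φ t x - (s - t) * a by ring] at this

/-- The difference quotients converge jointly in time and space, by the mean value inequality and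
the joint continuity of ∂ₜφ. This is the form needed when the measure moves as well. -/
lemma tendsto_slope {t : ℝ} (ht : t ∈ Ioo 0 T) (x : Rd d) :
    Tendsto (fun p : ℝ × Rd d => (p.1 - t)⁻¹ * (φ p.1 p.2 - φ t p.2)) (𝓝[≠] t ×ˢ 𝓝 x)
      (𝓝 (derivWithin (fun s => φ s x) (Icc 0 T) t)) := by
  rw [Metric.tendsto_nhds]
  intro ε hε
  have h1 := hφ.continuousOn_dt (t, x) ⟨Ioo_subset_Icc_self ht, mem_univ _⟩
  rw [ContinuousWithinAt, nhdsWithin_prod_eq, nhdsWithin_univ,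
    nhdsWithin_eq_nhds.2 (Icc_mem_nhds ht.1 ht.2), Metric.tendsto_nhds] at h1
  obtain ⟨pa, hpa, pb, hpb, h⟩ := eventually_prod_iff.1 (h1 (ε / 2) (by positivity))
  obtain ⟨δ, hδ, hball⟩ := Metric.eventually_nhds_iff_ball.1
    (hpa.and (Ioo_mem_nhds ht.1 ht.2))
  have h2 : ∀ᶠ s in 𝓝[≠] t, s ∈ Metric.ball t δ ∧ s ≠ t := by
    filter_upwards [nhdsWithin_le_nhds (Metric.ball_mem_nhds t hδ), self_mem_nhdsWithin]
      with s hs hst using ⟨hs, hst⟩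
  refine eventually_prod_iff.2 ⟨_, h2, pb, hpb, ?_⟩
  rintro s ⟨hs, hst⟩ y hy
  have h3 := hφ.abs_sub_le (x := y) (S := Metric.ball t δ)
    (a := derivWithin (fun s => φ s x) (Icc 0 T) t) (ε := ε / 2)
    (fun r hr => Ioo_subset_Icc_self (hball r hr).2) (convex_ball t δ)
    (fun r hr => (h (hball r hr).1 hy).le) hs (Metric.mem_ball_self hδ)
  have hst' : 0 < |s - t| := abs_pos.2 (sub_ne_zero.2 hst)
  rw [Real.dist_eq, show (s - t)⁻¹ * (φ s y - φ t y) - derivWithin (fun s => φ s x) (Icc 0 T) t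
    = (s - t)⁻¹ * (φ s y - φ t y - (s - t) * derivWithin (fun s => φ s x) (Icc 0 T) t) by
      field_simp [sub_ne_zero.2 hst], abs_mul, abs_inv, inv_mul_lt_iff₀ hst']
  nlinarith

end IsTestFunction

lemma IsMild.hasDerivAt_integral {L : LevyTriplet d} {T M : ℝ} {b : ℝ → Rd d → Rd d}
    {m₀ : ProbabilityMeasure (Rd d)} {m : ℝ → ProbabilityMeasure (Rd d)}
    (hm : IsMild L T b m₀ m M) (hb : IsDrift T b) {u : Rd d → ℝ} {M₀ M₁ M₂ : ℝ}
    (hu : CB2 u M₀ M₁ M₂) {t : ℝ} (ht : t ∈ Ioo 0 T) :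
    HasDerivAt (fun s => ∫ x, u x ∂(m s : Measure (Rd d)))
      (∫ x, generator L T b u t x ∂(m t : Measure (Rd d))) t := by
  have hc := hu.continuousOn_integral_generator L hb hm.continuousOn
  have hi : IntervalIntegrable (fun s => ∫ x, generator L T b u s x ∂(m s : Measure (Rd d)))
      volume 0 t := by
    rw [intervalIntegrable_iff_integrableOn_Ioo_of_le ht.1.le]
    refine Integrable.mono' (integrable_const _) ?_ (Eventually.of_forall fun s =>
      abs_integral_le_of_abs_le fun x => hu.abs_generator_le L hm.driven.boundV s x)
    exact (hc.mono (Ioo_subset_Ioo_right ht.2.le)).aestronglyMeasurable measurableSet_Ioo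
  have h1 := intervalIntegral.integral_hasDerivAt_right hi
    (hc.stronglyMeasurableAtFilter isOpen_Ioo t ht) (hc.continuousAt (isOpen_Ioo.mem_nhds ht))
  refine (h1.const_add (∫ x, u x ∂(m₀ : Measure (Rd d)))).congr_of_eventuallyEq ?_
  filter_upwards [isOpen_Ioo.mem_nhds ht] with s hs
  rw [intervalIntegral.integral_of_le hs.1.le, integral_Ioc_eq_integral_Ioo,
    ← hm.weak hb hu (Ioo_subset_Icc_self hs)]
  ring

/-- The reason is a product rule: the derivative of ∫φ(s) dm(s) is the integral of ∂ₜφ plus the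
generator applied to φ(s). Continuity up to the end points of [0,T] then allows integration. -/
theorem IsMild.isSolution {L : LevyTriplet d} {T M : ℝ} {b : ℝ → Rd d → Rd d}
    {m₀ : ProbabilityMeasure (Rd d)} {m : ℝ → ProbabilityMeasure (Rd d)}
    (hm : IsMild L T b m₀ m M) (hb : IsDrift T b) (hcont : IsContinuousCurve T m) :
    IsSolution L T b m₀ m := by
  refine ⟨hcont, fun φ hφ t ht => ?_⟩
  obtain ⟨C, hC⟩ := hφ.exists_CB2
  have hmc := hm.continuousOn
  set F : ℝ → ℝ := fun s => ∫ x, φ s x ∂(m s : Measure (Rd d))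
  set F' : ℝ → ℝ := fun s => ∫ x, (derivWithin (fun r => φ r x) (Icc 0 T) s + L.op (φ s) x
          - fderiv ℝ (φ s) x (b s x)) ∂(m s : Measure (Rd d))
  have hdt : ∀ s ∈ Icc 0 T, Continuous fun x => derivWithin (fun r => φ r x) (Icc 0 T) s := by
    intro s hs
    exact hφ.continuousOn_dt.comp_continuous (by fun_prop : Continuous fun x : Rd d => (s, x))
      fun x => ⟨hs, mem_univ _⟩
  have hFc : ContinuousOn F (Icc 0 T) := by
    intro s hs
    refine tendsto_integral_of_tendsto_nhds hmc hs (σ := fun r => r) tendsto_id ?_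
      (hC s hs).1.continuous ?_ (hC s hs).1.bound₀ fun x => ?_
    · filter_upwards [self_mem_nhdsWithin] with r hr using (hC r hr).1.continuous
    · filter_upwards [self_mem_nhdsWithin] with r hr using (hC r hr).1.bound₀
    · have := hφ.continuousOn (s, x) ⟨hs, mem_univ _⟩
      rwa [ContinuousWithinAt, nhdsWithin_prod_eq, nhdsWithin_univ] at this
  have hF'eq : ∀ s ∈ Ioo 0 T, F' s
      = ∫ x, derivWithin (fun r => φ r x) (Icc 0 T) s ∂(m s : Measure (Rd d))
        + ∫ x, generator L T b (φ s) s x ∂(m s : Measure (Rd d)) := by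
    intro s hs
    have hs' := Ioo_subset_Icc_self hs
    rw [← integral_add]
    · simp only [F', generator, cutDrift_of_mem hs]
      congr 1; ext x; ring
    · exact Integrable.of_bound (hdt s hs').aestronglyMeasurable C
        (Eventually.of_forall (hC s hs').2)
    · exact Integrable.of_bound ((hC s hs').1.continuous_generator L hb s).aestronglyMeasurable _
        (Eventually.of_forall fun x => (hC s hs').1.abs_generator_le L hm.driven.boundV s x)
  have hder : ∀ s ∈ Ioo 0 T, HasDerivAt F (F' s) s := by
    intro s hs
    have hs' := Ioo_subset_Icc_self hs
    rw [hF'eq s hs, hasDerivAt_iff_tendsto_slope]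
    have h1 := hasDerivAt_iff_tendsto_slope.1 (hm.hasDerivAt_integral hb (hC s hs').1 hs)
    have hnear : ∀ᶠ r in 𝓝[≠] s, r ∈ Icc 0 T :=
      nhdsWithin_le_nhds (Icc_mem_nhds hs.1 hs.2)
    have h2 := tendsto_integral_of_tendsto_nhds hmc hs' (σ := fun r => r) (l := 𝓝[≠] s) (C := C)
      (G := fun r x => (r - s)⁻¹ * (φ r x - φ s x))
      (tendsto_nhdsWithin_iff.2 ⟨tendsto_id.mono_left nhdsWithin_le_nhds, hnear⟩) ?_ (hdt s hs') ?_
      (hC s hs').2 (hφ.tendsto_slope hs)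
    -- The increment splits into the change of φ integrated against m(r) and the change of m tested
    -- with the fixed function φ(s).
    · refine (h2.add h1).congr' ?_
      filter_upwards [hnear] with r hr
      have j1 : ∀ q ∈ Icc 0 T, Integrable (φ q) (m r : Measure (Rd d)) := fun q hq =>
        Integrable.of_bound (hC q hq).1.continuous.aestronglyMeasurable C
          (Eventually.of_forall (hC q hq).1.bound₀)
      rw [integral_const_mul, integral_sub (j1 r hr) (j1 s hs'), slope_def_field, slope_def_field]
      simp only [F]
      ring
    · filter_upwards [hnear] with r hr
      have := (hC r hr).1.continuous
      have := (hC s hs').1.continuous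
      fun_prop
    · filter_upwards [hnear, self_mem_nhdsWithin] with r hr hrs x
      have hpos : 0 < |r - s| := abs_pos.2 (sub_ne_zero.2 hrs)
      have h3 := hφ.abs_sub_le (x := x) (a := 0) (ε := C) (S := Icc 0 T) subset_rfl
        (convex_Icc 0 T) (fun q hq => by simpa using (hC q hq).2 x) hr hs'
      rw [mul_zero, sub_zero] at h3
      rw [abs_mul, abs_inv, inv_mul_le_iff₀ hpos, mul_comm]
      exact h3
  have hint : IntervalIntegrable F' volume 0 t := by
    rw [intervalIntegrable_iff_integrableOn_Ioo_of_le ht.1]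
    -- F' agrees with the derivative of F on the open interval, and derivatives are measurable.
    have hm1 : AEStronglyMeasurable F' (volume.restrict (Ioo 0 t)) := by
      refine (measurable_deriv F).aestronglyMeasurable.congr ?_
      filter_upwards [ae_restrict_mem measurableSet_Ioo] with s hs
      exact (hder s ⟨hs.1, hs.2.trans_le ht.2⟩).deriv
    refine Integrable.mono' (g := fun _ => C + ((‖L.B‖ + (∑ i, ∑ j, |L.A i j|)
      + 2 * ∫ z, min 1 (‖z‖ ^ 2) ∂L.ν) * (C + C + C) + C * M)) (integrable_const _) hm1 ?_
    filter_upwards [ae_restrict_mem measurableSet_Ioo] with s hs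
    have hs' : s ∈ Ioo 0 T := ⟨hs.1, hs.2.trans_le ht.2⟩
    rw [hF'eq s hs']
    have hsI := Ioo_subset_Icc_self hs'
    exact (norm_add_le _ _).trans (add_le_add (abs_integral_le_of_abs_le (hC s hsI).2)
      (abs_integral_le_of_abs_le fun x => (hC s hsI).1.abs_generator_le L hm.driven.boundV s x))
  have := intervalIntegral.integral_eq_sub_of_hasDerivAt_of_le ht.1
    (hFc.mono (Icc_subset_Icc_right ht.2))
    (fun s hs => hder s ⟨hs.1, hs.2.trans_le ht.2⟩) hint
  rw [this]
  simp only [F, hm.zero]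

end

/-! ### Consequences of the comparison estimate. -/

section
variable {d : ℕ}

/-! ### Stability and uniqueness -/

lemma norm_cutDrift_sub_le {T : ℝ} {b b' : ℝ → Rd d → Rd d} (hb : IsDrift T b)
    (hb' : IsDrift T b') (s : ℝ) (x : Rd d) : ‖cutDrift T b' s x - cutDrift T b s x‖
      ≤ driftNorm T fun t x => b' t x - b t x := by
  by_cases hs : s ∈ Ioo 0 T
  · rw [cutDrift_of_mem hs, cutDrift_of_mem hs]
    refine le_csSup ⟨driftNorm T b' + driftNorm T b, ?_⟩ ⟨s, hs, x, rfl⟩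
    rintro r ⟨t, ht, y, rfl⟩
    exact (norm_sub_le _ _).trans
      (add_le_add (hb'.norm_le_driftNorm ht y) (hb.norm_le_driftNorm ht y))
  · rw [cutDrift_of_notMem hs, cutDrift_of_notMem hs, sub_self, norm_zero]
    refine Real.sSup_nonneg ?_
    rintro r ⟨t, ht, y, rfl⟩
    exact norm_nonneg _

lemma driftNorm_sub_self (T : ℝ) (b : ℝ → Rd d → Rd d) :
    driftNorm T (fun t x => b t x - b t x) = 0 := by
  refine le_antisymm (Real.sSup_nonpos ?_) (Real.sSup_nonneg ?_) <;>
  · rintro r ⟨t, ht, y, rfl⟩; simp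

/-- Both curves are approximate mild solutions for the one drift b: m without error, m' with error C
times the distance of the drifts. The constant depends on b but not on b', as convergence of a
sequence of drifts requires. -/
theorem exists_stability_bound {L : LevyTriplet d} {T : ℝ} (hT : 0 < T)
    (hL : L.HeatKernelBounds T) {b : ℝ → Rd d → Rd d} (hb : IsDrift T b)
    (m₀ : ProbabilityMeasure (Rd d)) :
    ∃ c, 0 ≤ c ∧ ∀ (b' : ℝ → Rd d → Rd d) (m m' : ℝ → ProbabilityMeasure (Rd d)), IsDrift T b' →
      IsSolution L T b m₀ m → IsSolution L T b' m₀ m' →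
      ∀ t ∈ Icc 0 T, ∀ f : Rd d → ℝ, Continuous f → (∀ x, |f x| ≤ 1) →
        |∫ x, f x ∂(m t : Measure (Rd d)) - ∫ x, f x ∂(m' t : Measure (Rd d))|
          ≤ c * driftNorm T fun t x => b' t x - b t x := by
  obtain ⟨M, hM0, hM, -⟩ := hb.exists_bound
  obtain ⟨a, C, hG⟩ := hL.hasGradientBound
  have hcb : ∀ s ∈ Ioo 0 T, Continuous (cutDrift T b s) := fun s _ => hb.continuous_cutDrift s
  have hcM : ∀ s ∈ Ioo 0 T, ∀ x, ‖cutDrift T b s x‖ ≤ M := fun s _ => hM s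
  obtain ⟨c, hc0, hc⟩ := IsMildApprox.compare (m₀ := (m₀ : Measure (Rd d))) hG hcb hM0 hcM
  have hC := hG.nonneg
  have happ : ∀ (b' : ℝ → Rd d → Rd d) (m : ℝ → ProbabilityMeasure (Rd d)), IsDrift T b' →
      IsSolution L T b' m₀ m → IsMildApprox L T a (cutDrift T b) m₀
        (C * driftNorm T fun t x => b' t x - b t x) fun t => (m t : Measure (Rd d)) := by
    intro b' m hb' hm
    obtain ⟨M', -, hM', -⟩ := hb'.exists_bound
    have := (hm.isDriven hT hb' hM').isMildApprox hG hcb hcM fun s _ =>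
      (le_abs_self _).trans (abs_integral_le_of_abs_le fun x => by
        rw [abs_of_nonneg (norm_nonneg _)]
        exact norm_cutDrift_sub_le hb hb' s x)
    simpa only [Measure.map_id'] using this
  refine ⟨c * C, by positivity, fun b' m m' hb' hm hm' t ht f hf hf1 => ?_⟩
  have h0 := driftNorm_sub_self T b
  have h1 := happ b m hb hm
  have h2 := happ b' m' hb' hm'
  rw [h0, mul_zero] at h1
  have hn : 0 ≤ driftNorm T fun t x => b' t x - b t x :=
    (norm_nonneg _).trans (norm_cutDrift_sub_le hb hb' 0 0)
  have := hc le_rfl (by positivity) h1 h2 t ht f hf hf1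
  rwa [zero_add, ← mul_assoc] at this

/-- The case b' = b: the bound vanishes, so the characteristic functions coincide. -/
theorem IsSolution.unique {L : LevyTriplet d} {T : ℝ} (hT : 0 < T) (hL : L.HeatKernelBounds T)
    {b : ℝ → Rd d → Rd d} (hb : IsDrift T b) {m₀ : ProbabilityMeasure (Rd d)}
    {m m' : ℝ → ProbabilityMeasure (Rd d)} (hm : IsSolution L T b m₀ m)
    (hm' : IsSolution L T b m₀ m') {t : ℝ} (ht : t ∈ Icc 0 T) : m' t = m t := by
  obtain ⟨c, -, hc⟩ := exists_stability_bound hT hL hb m₀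
  have h0 := driftNorm_sub_self T b
  have h2 : (m' t : Measure (Rd d)) = m t := by
    refine Measure.ext_of_charFun (funext fun ξ => ?_)
    rw [charFun_eq_integral_wave, charFun_eq_integral_wave, ← sub_eq_zero, ← norm_le_zero_iff]
    have := norm_integral_wave_sub_le (μ := (m' t : Measure (Rd d)))
      (μ' := (m t : Measure (Rd d))) (ε := 0) (fun f hf hf1 => by
        have := hc b m m' hb hm hm' t ht f hf hf1
        rw [h0, mul_zero] at this
        rwa [abs_sub_comm]) ξ
    simpa using this
  exact Subtype.ext h2

theorem IsSolution.eventually_d₀_le {L : LevyTriplet d} {T : ℝ} (hT : 0 < T)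
    (hL : L.HeatKernelBounds T) {b : ℝ → Rd d → Rd d} (hb : IsDrift T b)
    {m₀ : ProbabilityMeasure (Rd d)} {m : ℝ → ProbabilityMeasure (Rd d)}
    (hm : IsSolution L T b m₀ m) {bₙ : ℕ → ℝ → Rd d → Rd d}
    {mₙ : ℕ → ℝ → ProbabilityMeasure (Rd d)} (hbₙ : ∀ n, IsDrift T (bₙ n))
    (hmₙ : ∀ n, IsSolution L T (bₙ n) m₀ (mₙ n))
    (hlim : Tendsto (fun n => driftNorm T (fun t x => bₙ n t x - b t x)) atTop (𝓝 0))
    {ε : ℝ} (hε : 0 < ε) : ∀ᶠ n in atTop, ∀ t ∈ Icc 0 T, d₀ (mₙ n t) (m t) ≤ ε := by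
  obtain ⟨c, hc0, hc⟩ := exists_stability_bound hT hL hb m₀
  have h1 : Tendsto (fun n => c * driftNorm T (fun t x => bₙ n t x - b t x)) atTop (𝓝 0) := by
    simpa using hlim.const_mul c
  filter_upwards [h1.eventually_le_const hε] with n hn t ht
  exact d₀_le fun φ hφ => (hc (bₙ n) m (mₙ n) (hbₙ n) hm (hmₙ n) t ht φ
    (continuous_of_mem_Lip hφ) hφ.1).trans hn

end

end FokkerPlanck

end

/-! ### Assembly of the theorem. -/

open FokkerPlanck

theorem mainTheorem8 (d : ℕ) (hd : 1 ≤ d) :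
    ∃ c : (Rd d → ℝ) → ℝ, (∀ ψ, 0 < c ψ) ∧
      ∀ (T : ℝ), 0 < T → ∀ (L : LevyTriplet d), L.HeatKernelBounds T →
      ∃ c₀ : ℝ, 0 < c₀ ∧
      ∀ (b : ℝ → Rd d → Rd d), IsDrift T b → ∀ (m₀ : ProbabilityMeasure (Rd d)),
      ∃ m : ℝ → ProbabilityMeasure (Rd d),
        -- existence
        IsSolution L T b m₀ m ∧
        -- Hölder continuity in time
        (∀ s ∈ Icc 0 T, ∀ t ∈ Icc 0 T,
          d₀ (m s) (m t) ≤ c₀ * (1 + driftNorm T b) * |s - t| ^ (1 / 2 : ℝ)) ∧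
        -- tightness and the bound on generalized moments
        IsTightMeasureSet {μ : Measure (Rd d) | ∃ t ∈ Icc 0 T, μ = m t} ∧
        (∀ ψ : Rd d → ℝ, IsTightnessFunction ψ → Integrable ψ (m₀ : Measure (Rd d)) →
          IntegrableOn ψ {z | 1 ≤ ‖z‖} L.ν → ∀ t ∈ Icc 0 T,
            Integrable ψ (m t : Measure (Rd d)) ∧
            ∫ x, ψ x ∂(m t : Measure (Rd d)) ≤ ∫ x, ψ x ∂(m₀ : Measure (Rd d))
              + (⨆ x, ‖fderiv ℝ ψ x‖) * (2 + c ψ * T *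
                  (‖Matrix.toEuclideanCLM (𝕜 := ℝ) L.A‖ + (⨆ i, |L.B i|) + driftNorm T b
                    + ∫ z in {z | ‖z‖ < 1}, ‖z‖ ^ 2 ∂L.ν))
              + T * ∫ z in {z | 1 ≤ ‖z‖}, ψ z ∂L.ν) ∧
        -- uniqueness
        (∀ m' : ℝ → ProbabilityMeasure (Rd d), IsSolution L T b m₀ m' →
          ∀ t ∈ Icc 0 T, m' t = m t) ∧
        -- stability under uniform convergence of the drifts
        (∀ (bₙ : ℕ → ℝ → Rd d → Rd d) (mₙ : ℕ → ℝ → ProbabilityMeasure (Rd d)),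
          (∀ n, IsDrift T (bₙ n)) → (∀ n, IsSolution L T (bₙ n) m₀ (mₙ n)) →
          Tendsto (fun n => driftNorm T (fun t x => bₙ n t x - b t x)) atTop (𝓝 0) →
          ∀ ε > 0, ∀ᶠ n in atTop, ∀ t ∈ Icc 0 T, d₀ (mₙ n t) (m t) ≤ ε) := by
  refine ⟨momentConst, momentConst_pos, fun T hT L hL => ?_⟩
  obtain ⟨c₀, hc₀, hholder⟩ := exists_holder_bound L hT
  refine ⟨c₀, hc₀, fun b hb m₀ => ?_⟩
  obtain ⟨m, M, hcont, h0, hD⟩ := hb.exists_mild hT hL m₀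
  have hm : IsMild L T b m₀ m M := ⟨hcont, h0, hD⟩
  -- The Hölder bound is proved for mild solutions first, because it supplies the d₀-continuity that
  -- a distributional solution must have.
  have hh := hholder b hb m₀ m M hm
  have hsol := hm.isSolution hb (isContinuousCurve_of_holder hh)
  exact ⟨m, hsol, hh, isTightMeasureSet_of_continuousOn hcont,
    fun ψ hψ h1 h2 t ht => hm.moment_le hd hb hψ h1 h2 ht,
    fun m' hm' t ht => hsol.unique hT hL hb hm' ht,
    fun bₙ mₙ hbₙ hmₙ hlim ε hε => hsol.eventually_d₀_le hT hL hb hbₙ hmₙ hlim hε⟩
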